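/- In the (unweighted) SetCover problem an instance $\Gamma=(S,U,E)$ is a finite bipartite graph with sides $S$ and $U$; a solution is a set $C\subseteq S$ such that every $u\in U$ has a neighbour in $C$, and $\mathsf{OPT}(\Gamma)$ is the minimum size of a solution ($\infty$ if there is none). The parameterized problem $k$-SetCover asks, given $(\Gamma,k)$ with parameter $k\in\mathbb N$, whether $\mathsf{OPT}(\Gamma)\le k$. An algorithm (deterministic Turing machine) is FPT if on inputs $x=(\Gamma,k)$, encoded as binary strings, it runs in time $f(k)\cdot|x|^{O(1)}$ for some computable function $f$. The hypothesis $\mathsf{W[2]}\ne\mathsf{FPT}$ is taken in the equivalent form that no FPT algorithm decides $k$-SetCover. Theorem. Assume $\mathsf{W[2]}\neq\mathsf{FPT}$. Then for every constant $c\ge 1$ there is no deterministic FPT algorithm that approximates $k$-SetCover within ratio $c$. That is, (a) no FPT algorithm solves the $c$-gap $k$-SetCover problem, i.e. distinguishes the inputs $(\Gamma,k)$ with $\mathsf{OPT}(\Gamma)\le k$ from those with $\mathsf{OPT}(\Gamma)>ck$ (with no requirement, not even on the running time, on other inputs); and (b) there is no FPT algorithm that, for every input $(\Gamma,k)$ with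 $\mathsf{OPT}(\Gamma)\le k$, outputs a solution of $\Gamma$ of size at most $ck$ (and halts within its FPT time bound, with arbitrary output, on the other inputs). -/

import Mathlib

open scoped ENNReal

namespace ParamSetCover

/-- An instance of (unweighted) SetCover: a bipartite graph with sides `S = Fin numS` and
`U = Fin numU`; `adj s u` says whether `s` and `u` are joined by an edge. -/
structure Instance where
  numS : ℕ
  numU : ℕ
  adj : Fin numS → Fin numU → Bool

namespace Instance

/-- `C ⊆ S` is a solution if every `u ∈ U` is a neighbour of some `s ∈ C`, that is `N(C) = U`. -/
def IsCover (Γ : Instance) (C : Finset (Fin Γ.numS)) : Prop :=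
  ∀ u : Fin Γ.numU, ∃ s ∈ C, Γ.adj s u = true

/-- `OPT(Γ)`, the minimum size of a solution (`⊤` if there is none). -/
noncomputable def opt (Γ : Instance) : ℕ∞ :=
  ⨅ (C : Finset (Fin Γ.numS)) (_ : Γ.IsCover C), (C.card : ℕ∞)

end Instance

/-- The binary string encoding the pair `(Γ, k)`: the numbers `k`, `|S|`, `|U|` in unary, each
terminated by `0`, followed by the `|S| × |U|` adjacency matrix row by row. (Whether `k` is
written in unary or in binary makes no difference for running times `f(k) · |x|^{O(1)}`.) -/
def encode (x : Instance × ℕ) : List Bool :=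
  List.replicate x.2 true ++ false ::
    (List.replicate x.1.numS true ++ false ::
      (List.replicate x.1.numU true ++ false ::
        (List.ofFn fun s => List.ofFn fun u => x.1.adj s u).flatten))

/-- The binary string encoding a set `C ⊆ S`: its characteristic vector. -/
def encodeSet {n : ℕ} (C : Finset (Fin n)) : List Bool :=
  List.ofFn fun s => decide (s ∈ C)

/-- Algorithms: deterministic multi-stack (equivalently, multi-tape) Turing machines with binary
input and output alphabet. -/
abbrev Machine : Type 1 := Turing.TM2ComputableAux Bool Bool

/-- On input `x` the machine `M` halts after at most `t` steps with output `y`. -/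
def Machine.HaltsWithin (M : Machine) (x y : List Bool) (t : ℕ) : Prop :=
  Nonempty (Turing.TM2OutputsInTime M.tm (x.map M.inputAlphabet.symm)
    (some (y.map M.outputAlphabet.symm)) t)

/-- There is an FPT algorithm for the promise problem on pairs `(Γ, k)` with parameter `k`,
yes-instances `yes` and no-instances `no`: a machine that outputs `1` on all yes-instances and `0`
on all no-instances, in time `f(k) · |x|^d` for a computable function `f` and a constant `d`. -/
def HasFPTDecider (yes no : Instance → ℕ → Prop) : Prop :=
  ∃ (M : Machine) (f : ℕ → ℕ) (d : ℕ), Computable f ∧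
    ∀ (Γ : Instance) (k : ℕ),
      (yes Γ k →
        M.HaltsWithin (encode (Γ, k)) [true] (f k * (encode (Γ, k)).length ^ d)) ∧
      (no Γ k →
        M.HaltsWithin (encode (Γ, k)) [false] (f k * (encode (Γ, k)).length ^ d))

/-- `k`-SetCover is fixed parameter tractable: `OPT(Γ) ≤ k` can be decided in time
`f(k) · |x|^{O(1)}` for some computable `f`. -/
def SetCoverFPT : Prop :=
  HasFPTDecider (fun Γ k => Γ.opt ≤ (k : ℕ∞)) (fun Γ k => ¬ Γ.opt ≤ (k : ℕ∞))

/-- The hypothesis `W[2] ≠ FPT`. -/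
def W2NeFPT : Prop := ¬ SetCoverFPT

/-- The `c`-gap `k`-SetCover problem, to distinguish between `OPT(Γ) ≤ k` and `OPT(Γ) > c k`,
has an FPT algorithm. -/
def GapSetCoverFPT (c : ℝ) : Prop :=
  HasFPTDecider (fun Γ k => Γ.opt ≤ (k : ℕ∞))
    (fun Γ k => ENNReal.ofReal (c * k) < (Γ.opt : ℝ≥0∞))

/-- There is an FPT algorithm that approximates `k`-SetCover within ratio `c`: a machine that halts
on every input `(Γ, k)` in time `f(k) · |x|^d`, for a computable `f` and a constant `d`, and that
outputs a solution of size at most `c k` whenever `OPT(Γ) ≤ k`. -/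
def HasFPTApproximation (c : ℝ) : Prop :=
  ∃ (M : Machine) (f : ℕ → ℕ) (d : ℕ), Computable f ∧
    ∀ (Γ : Instance) (k : ℕ), ∃ y : List Bool,
      M.HaltsWithin (encode (Γ, k)) y (f k * (encode (Γ, k)).length ^ d) ∧
      (Γ.opt ≤ (k : ℕ∞) →
        ∃ C : Finset (Fin Γ.numS), y = encodeSet C ∧ Γ.IsCover C ∧ (C.card : ℝ) ≤ c * k)

end ParamSetCover

namespace ParamSetCover

open Turing TM2 Function

/-! ### Stack programs and their compilation to Turing machines -/

/-- `f`, started in `a`, reaches `b` within `t` steps. -/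
def Reach {α : Type*} (f : α → Option α) (t : ℕ) (a : α) (b : Option α) : Prop :=
  ∃ n ≤ t, (flip bind f)^[n] (some a) = b

namespace Reach

variable {α : Type*} {f : α → Option α}

theorem refl (a : α) : Reach f 0 a (some a) := ⟨0, le_rfl, rfl⟩

theorem mono {t t' : ℕ} {a : α} {b : Option α} (h : Reach f t a b) (ht : t ≤ t') :
    Reach f t' a b := by
  obtain ⟨n, hn, h⟩ := h
  exact ⟨n, hn.trans ht, h⟩

theorem trans {t t' : ℕ} {a b : α} {c : Option α} (h : Reach f t a (some b))
    (h' : Reach f t' b c) : Reach f (t + t') a c := by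
  obtain ⟨n, hn, h⟩ := h
  obtain ⟨n', hn', h'⟩ := h'
  exact ⟨n' + n, by omega, by rw [iterate_add_apply, h, h']⟩

theorem single {a : α} {b : Option α} (h : f a = b) : Reach f 1 a b :=
  ⟨1, le_rfl, by simpa [flip] using h⟩

theorem head {t : ℕ} {a b : α} {c : Option α} (h : f a = some b) (h' : Reach f t b c) :
    Reach f (t + 1) a c :=
  ((single h).trans h').mono (by omega)

end Reach

theorem haltsWithin_iff (M : Machine) (x y : List Bool) (t : ℕ) :
    M.HaltsWithin x y t ↔ Reach M.tm.step t (initList M.tm (x.map M.inputAlphabet.symm))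
      (some (haltList M.tm (y.map M.outputAlphabet.symm))) := by
  constructor
  · rintro ⟨⟨⟨n, h⟩, hn⟩⟩
    exact ⟨n, hn, h⟩
  · rintro ⟨n, hn, h⟩
    exact ⟨⟨⟨n, h⟩, hn⟩⟩

theorem initList_eq (tm : FinTM2) (s : List (tm.Γ tm.k₀)) :
    initList tm s = ⟨some tm.main, tm.initialState, update (fun _ => []) tm.k₀ s⟩ := by
  unfold initList
  congr 1
  funext k
  by_cases h : k = tm.k₀
  · subst h; simp
  · simp [h]

theorem haltList_eq (tm : FinTM2) (s : List (tm.Γ tm.k₁)) :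
    haltList tm s = ⟨none, tm.initialState, update (fun _ => []) tm.k₁ s⟩ := by
  unfold haltList
  congr 1
  funext k
  by_cases h : k = tm.k₁
  · subst h; simp
  · simp [h]

/-- Programs that act on registers, indexed by natural numbers, each of which holds a stack of
bits. -/
inductive Prog
  | skip
  | push (r : ℕ) (b : Bool)
  | seq (p q : Prog)
  /-- Pop a bit: run `p` if there was none, `q₀` if it is `false`, `q₁` if it is `true`. -/
  | case (r : ℕ) (p q₀ q₁ : Prog)
  /-- Pop bits until the register is empty, running `q₀` after a `false` and `q₁` after a `true`. -/
  | loop (r : ℕ) (q₀ q₁ : Prog)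
  /-- Pop bits until the register is empty or a `false` is popped, running `q` after each `true`. -/
  | scan (r : ℕ) (q : Prog)
  /-- Run a given machine on the reversal of the register `a`, which is emptied, and push the
  output to the register `b`. -/
  | call (a b : ℕ)

/-- Contents of the registers. -/
abbrev State := ℕ → List Bool

/-- `Run M p s t s'`: started in `s`, the program `p` with calls to `M` ends in `s'` after at most
`t` steps. -/
inductive Run (M : Machine) : Prog → State → ℕ → State → Prop
  | skip (s) : Run M .skip s 1 s
  | push (s r b) : Run M (.push r b) s 1 (update s r (b :: s r))
  | seq {p q s t s' t' s''} : Run M p s t s' → Run M q s' t' s'' → Run M (.seq p q) s (t + t') s''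
  | case_nil {r p q₀ q₁ s t s'} : s r = [] → Run M p s t s' → Run M (.case r p q₀ q₁) s (t + 1) s'
  | case_cons {r p q₀ q₁ s t s' b l} : s r = b :: l → Run M (cond b q₁ q₀) (update s r l) t s' →
      Run M (.case r p q₀ q₁) s (t + 1) s'
  | loop_nil {r q₀ q₁ s} : s r = [] → Run M (.loop r q₀ q₁) s 1 s
  | loop_cons {r q₀ q₁ s t s' t' s'' b l} : s r = b :: l →
      Run M (cond b q₁ q₀) (update s r l) t s' → Run M (.loop r q₀ q₁) s' t' s'' →
      Run M (.loop r q₀ q₁) s (t + t' + 1) s''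
  | scan_nil {r q s} : s r = [] → Run M (.scan r q) s 1 s
  | scan_false {r q s l} : s r = false :: l → Run M (.scan r q) s 1 (update s r l)
  | scan_true {r q s t s' t' s'' l} : s r = true :: l →
      Run M q (update s r l) t s' → Run M (.scan r q) s' t' s'' →
      Run M (.scan r q) s (t + t' + 1) s''
  | call {a b s y t} : M.HaltsWithin (s a).reverse y t →
      Run M (.call a b) s ((s a).length + 1 + t + (y.length + 1))
        (update (update s a []) b (y.reverse ++ update s a [] b))

namespace Prog

/-- A bound for the registers that a program uses. -/
def maxReg : Prog → ℕ
  | skip => 0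
  | push r _ => r
  | seq p q => max p.maxReg q.maxReg
  | case r p q₀ q₁ => max r (max p.maxReg (max q₀.maxReg q₁.maxReg))
  | loop r q₀ q₁ => max r (max q₀.maxReg q₁.maxReg)
  | scan r q => max r q.maxReg
  | call a b => max a b

/-- The labels of the Turing machine for a program. -/
def Lab (M : Machine) : Prog → Type
  | skip => Unit
  | push _ _ => Unit
  | seq p q => p.Lab M ⊕ q.Lab M
  | case _ p q₀ q₁ => Option (p.Lab M ⊕ (q₀.Lab M ⊕ q₁.Lab M))
  | loop _ q₀ q₁ => Option (q₀.Lab M ⊕ q₁.Lab M)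
  | scan _ q => Option (q.Lab M)
  | call _ _ => Option (Option M.tm.Λ)

/-- There are finitely many labels. -/
@[reducible]
def labFintype (M : Machine) : (p : Prog) → Fintype (p.Lab M)
  | skip => inferInstanceAs (Fintype Unit)
  | push _ _ => inferInstanceAs (Fintype Unit)
  | seq p q =>
    letI := p.labFintype M; letI := q.labFintype M
    inferInstanceAs (Fintype (p.Lab M ⊕ q.Lab M))
  | case _ p q₀ q₁ =>
    letI := p.labFintype M; letI := q₀.labFintype M; letI := q₁.labFintype M
    inferInstanceAs (Fintype (Option (p.Lab M ⊕ (q₀.Lab M ⊕ q₁.Lab M))))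
  | loop _ q₀ q₁ =>
    letI := q₀.labFintype M; letI := q₁.labFintype M
    inferInstanceAs (Fintype (Option (q₀.Lab M ⊕ q₁.Lab M)))
  | scan _ q =>
    letI := q.labFintype M
    inferInstanceAs (Fintype (Option (q.Lab M)))
  | call _ _ =>
    letI := M.tm.ΛFin
    inferInstanceAs (Fintype (Option (Option M.tm.Λ)))

/-- The label at which a program starts. -/
def entry (M : Machine) : (p : Prog) → p.Lab M
  | skip => ()
  | push _ _ => ()
  | seq p _ => Sum.inl (p.entry M)
  | case _ _ _ _ => (none : Option _)
  | loop _ _ _ => (none : Option _)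
  | scan _ _ => (none : Option _)
  | call _ _ => (none : Option _)

end Prog

/-- The stack alphabets: the registers `0, …, R`, and the stacks of `M`. -/
abbrev StackSym (M : Machine) (R : ℕ) : Fin (R + 1) ⊕ M.tm.K → Type
  | .inl _ => Bool
  | .inr k => M.tm.Γ k

/-- The internal states: those of `M`, and the bit that was last popped. -/
abbrev Control (M : Machine) : Type := M.tm.σ × Option Bool

/-- The stacks of the compiled machine. -/
def joinStk (M : Machine) (R : ℕ) (s : State) (S : ∀ k, List (M.tm.Γ k)) :
    ∀ k, List (StackSym M R k)
  | .inl i => s i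
  | .inr k => S k

/-- The stack of a register. -/
abbrev regStack (M : Machine) (R r : ℕ) : Fin (R + 1) ⊕ M.tm.K := .inl (Fin.ofNat (R + 1) r)

theorem joinStk_regStack (M : Machine) {R r : ℕ} (hr : r ≤ R) (s : State)
    (S : ∀ k, List (M.tm.Γ k)) : joinStk M R s S (regStack M R r) = s r := by
  have : r % (R + 1) = r := Nat.mod_eq_of_lt (by omega)
  simp [joinStk, this]

theorem update_regStack (M : Machine) {R r : ℕ} (hr : r ≤ R) (s : State)
    (S : ∀ k, List (M.tm.Γ k)) (l : List Bool) :
    update (joinStk M R s S) (regStack M R r) l = joinStk M R (update s r l) S := by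
  have hmod : r % (R + 1) = r := Nat.mod_eq_of_lt (by omega)
  funext k
  rcases k with i | k
  · by_cases h : (i : ℕ) = r
    · have : i = Fin.ofNat (R + 1) r := by ext; simp [h, hmod]
      subst this
      simp [joinStk, hmod]
    · have : i ≠ Fin.ofNat (R + 1) r := fun e => h (by rw [e]; simp [hmod])
      have h' : (Sum.inl i : Fin (R + 1) ⊕ M.tm.K) ≠ regStack M R r := by
        simpa [regStack] using this
      rw [update_of_ne h']
      simp [joinStk, h]
  · simp [joinStk, regStack]

theorem update_inr (M : Machine) {R : ℕ} (s : State) (S : ∀ k, List (M.tm.Γ k)) (k : M.tm.K)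
    (l : List (M.tm.Γ k)) :
    update (joinStk M R s S) (Sum.inr k) l = joinStk M R s (update S k l) := by
  funext k'
  rcases k' with i | k'
  · simp [joinStk]
  · by_cases h : k' = k
    · subst h; simp [joinStk]
    · simp [joinStk, h]

/-- A statement of `M` as a statement of the compiled machine. -/
def liftStmt (M : Machine) (R : ℕ) {Λ : Type} (e : Option M.tm.Λ → Λ) :
    Stmt M.tm.Γ M.tm.Λ M.tm.σ → Stmt (StackSym M R) Λ (Control M)
  | .push k f q => .push (.inr k) (fun v => f v.1) (liftStmt M R e q)
  | .peek k f q => .peek (.inr k) (fun v o => (f v.1 o, v.2)) (liftStmt M R e q)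
  | .pop k f q => .pop (.inr k) (fun v o => (f v.1 o, v.2)) (liftStmt M R e q)
  | .load f q => .load (fun v => (f v.1, v.2)) (liftStmt M R e q)
  | .branch f q₁ q₂ => .branch (fun v => f v.1) (liftStmt M R e q₁) (liftStmt M R e q₂)
  | .goto f => .goto fun v => e (some (f v.1))
  | .halt => .goto fun _ => e none

/-- A configuration of `M` as a configuration of the compiled machine. -/
def liftCfg (M : Machine) (R : ℕ) {Λ : Type} (e : Option M.tm.Λ → Λ) (s : State) (o : Option Bool)
    (c : Cfg M.tm.Γ M.tm.Λ M.tm.σ) : Cfg (StackSym M R) Λ (Control M) :=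
  ⟨some (e c.l), (c.var, o), joinStk M R s c.stk⟩

theorem stepAux_liftStmt (M : Machine) (R : ℕ) {Λ : Type} (e : Option M.tm.Λ → Λ) (s : State)
    (o : Option Bool) (q : Stmt M.tm.Γ M.tm.Λ M.tm.σ) (v : M.tm.σ) (S : ∀ k, List (M.tm.Γ k)) :
    stepAux (liftStmt M R e q) (v, o) (joinStk M R s S) =
      liftCfg M R e s o (stepAux q v S) := by
  induction q generalizing v S with
  | push k f q ih => 
    simp only [liftStmt, stepAux, ← ih, ← update_inr]
    rfl
  | peek k f q ih =>
    simp only [liftStmt, stepAux, ← ih]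
    rfl
  | pop k f q ih =>
    simp only [liftStmt, stepAux, ← ih, ← update_inr]
    rfl
  | load f q ih => simp only [liftStmt, stepAux, ← ih]
  | branch f q₁ q₂ ih₁ ih₂ =>
    simp only [liftStmt, stepAux]
    cases f v <;> simp [ih₁, ih₂]
  | goto f => rfl
  | halt => rfl

theorem iterate_bind_none {α : Type*} (f : α → Option α) (n : ℕ) :
    (flip bind f)^[n] (none : Option α) = none := by
  induction n with
  | zero => rfl
  | succ n ih => rw [iterate_succ_apply]; exact ih

theorem reach_liftCfg (M : Machine) (R : ℕ) {Λ : Type} (e : Option M.tm.Λ → Λ) (s : State)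
    (o : Option Bool) (m : Λ → Stmt (StackSym M R) Λ (Control M))
    (hm : ∀ l, m (e (some l)) = liftStmt M R e (M.tm.m l)) {t : ℕ} {c c' : M.tm.Cfg}
    (h : Reach M.tm.step t c (some c')) :
    Reach (step m) t (liftCfg M R e s o c) (some (liftCfg M R e s o c')) := by
  obtain ⟨n, hn, h⟩ := h
  induction n generalizing t c with
  | zero =>
    simp only [iterate_zero, id, Option.some.injEq] at h
    subst h
    exact (Reach.refl _).mono (Nat.zero_le _)
  | succ n ih =>
    rw [iterate_succ_apply] at h
    obtain ⟨l, v, S⟩ := c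
    cases l with
    | none =>
      have h0 : flip bind M.tm.step (some ⟨none, v, S⟩) = none := rfl
      rw [h0, iterate_bind_none] at h
      cases h
    | some l =>
      have h1 : flip bind M.tm.step (some ⟨some l, v, S⟩) = some (stepAux (M.tm.m l) v S) := rfl
      rw [h1] at h
      obtain ⟨t, rfl⟩ : ∃ t', t = t' + 1 := ⟨t - 1, by omega⟩
      refine Reach.head ?_ (ih (t := t) (by omega) h)
      simp only [liftCfg, step, hm, stepAux_liftStmt]

/-- Pop a bit from a register and branch on the result. -/
def popTo (M : Machine) (R r : ℕ) {Λ : Type} (l l₀ l₁ : Λ) :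
    Stmt (StackSym M R) Λ (Control M) :=
  .pop (regStack M R r) (fun v o => (v.1, o)) <| .goto fun v =>
    match v.2 with
    | none => l
    | some false => l₀
    | some true => l₁

/-- The statements of the compiled machine: the labels of the program are embedded by `e`, and at
its end the machine continues at the label `x`. -/
def Prog.code (M : Machine) (R : ℕ) {Λ : Type} : (p : Prog) → (p.Lab M → Λ) → Λ → p.Lab M →
    Stmt (StackSym M R) Λ (Control M)
  | .skip, _, x, _ => .goto fun _ => x
  | .push r b, _, x, _ => .push (regStack M R r) (fun _ => b) (.goto fun _ => x)
  | .seq p q, e, x, l => match (l : p.Lab M ⊕ q.Lab M) with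
    | .inl l => p.code M R (fun l => e (Sum.inl l)) (e (Sum.inr (q.entry M))) l
    | .inr l => q.code M R (fun l => e (Sum.inr l)) x l
  | .case r p q₀ q₁, e, x, l => match (l : Option (p.Lab M ⊕ (q₀.Lab M ⊕ q₁.Lab M))) with
    | none => popTo M R r (e (some (.inl (p.entry M)))) (e (some (.inr (.inl (q₀.entry M)))))
        (e (some (.inr (.inr (q₁.entry M)))))
    | some (.inl l) => p.code M R (fun l => e (some (.inl l))) x l
    | some (.inr (.inl l)) => q₀.code M R (fun l => e (some (.inr (.inl l)))) x l
    | some (.inr (.inr l)) => q₁.code M R (fun l => e (some (.inr (.inr l)))) x l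
  | .loop r q₀ q₁, e, x, l => match (l : Option (q₀.Lab M ⊕ q₁.Lab M)) with
    | none => popTo M R r x (e (some (.inl (q₀.entry M)))) (e (some (.inr (q₁.entry M))))
    | some (.inl l) => q₀.code M R (fun l => e (some (.inl l))) (e (none : Option _)) l
    | some (.inr l) => q₁.code M R (fun l => e (some (.inr l))) (e (none : Option _)) l
  | .scan r q, e, x, l => match (l : Option (q.Lab M)) with
    | none => popTo M R r x x (e (some (q.entry M)))
    | some l => q.code M R (fun l => e (some l)) (e (none : Option _)) l
  | .call a b, e, x, l => match (l : Option (Option M.tm.Λ)) with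
    | none => .pop (regStack M R a) (fun v o => (v.1, o)) <|
        .branch (fun v => v.2.isSome)
          (.push (.inr M.tm.k₀) (fun v => M.inputAlphabet.symm (v.2.getD false))
            (.goto fun _ => e (none : Option _)))
          (.goto fun _ => e (some (some M.tm.main)))
    | some none => .pop (.inr M.tm.k₁) (fun v o => (v.1, o.map M.outputAlphabet)) <|
        .branch (fun v => v.2.isSome)
          (.push (regStack M R b) (fun v => v.2.getD false)
            (.goto fun _ => e (some none)))
          (.goto fun _ => x)
    | some (some l) => liftStmt M R (fun l => e (some l)) (M.tm.m l)

section Correctness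

variable {M : Machine} {R : ℕ} {Λ : Type} {m : Λ → Stmt (StackSym M R) Λ (Control M)}

theorem step_popTo_nil {r : ℕ} (hr : r ≤ R) {l l' l₀ l₁ : Λ} (hm : m l = popTo M R r l' l₀ l₁)
    {s : State} (hs : s r = []) (v : M.tm.σ) (o : Option Bool) (S : ∀ k, List (M.tm.Γ k)) :
    step m ⟨some l, (v, o), joinStk M R s S⟩ = some ⟨some l', (v, none), joinStk M R s S⟩ := by
  rw [step, hm]
  have h : s = update s r [] := by rw [← hs, update_eq_self]
  conv_rhs => rw [h]
  simp [popTo, stepAux, joinStk_regStack M hr, hs, update_regStack M hr]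

theorem step_popTo_cons {r : ℕ} (hr : r ≤ R) {l l' l₀ l₁ : Λ} (hm : m l = popTo M R r l' l₀ l₁)
    {s : State} {b : Bool} {w : List Bool} (hs : s r = b :: w) (v : M.tm.σ) (o : Option Bool)
    (S : ∀ k, List (M.tm.Γ k)) :
    step m ⟨some l, (v, o), joinStk M R s S⟩ =
      some ⟨some (cond b l₁ l₀), (v, some b), joinStk M R (update s r w) S⟩ := by
  rw [step, hm]
  cases b <;> simp [popTo, stepAux, joinStk_regStack M hr, hs, update_regStack M hr]

theorem reach_move_in {a : ℕ} (ha : a ≤ R) {l₀ l₁ : Λ}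
    (h₀ : m l₀ = .pop (regStack M R a) (fun v o => (v.1, o)) (.branch (fun v => v.2.isSome)
      (.push (.inr M.tm.k₀) (fun v => M.inputAlphabet.symm (v.2.getD false)) (.goto fun _ => l₀))
      (.goto fun _ => l₁))) (w : List Bool) :
    ∀ (s : State) (z : List Bool) (o : Option Bool), s a = w →
    Reach (step m) (w.length + 1)
      ⟨some l₀, (M.tm.initialState, o),
        joinStk M R s (update (fun _ => []) M.tm.k₀ (z.map M.inputAlphabet.symm))⟩
      (some ⟨some l₁, (M.tm.initialState, none), joinStk M R (update s a [])
          (update (fun _ => []) M.tm.k₀ ((w.reverse ++ z).map M.inputAlphabet.symm))⟩) := by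
  induction w with
  | nil =>
    intro s z o hs
    refine Reach.single ?_
    simp [step, h₀, stepAux, joinStk_regStack M ha, hs, update_regStack M ha]
  | cons c w ih =>
    intro s z o hs
    have h := ih (update s a w) (c :: z) (some c) (by simp)
    have e₁ : w.reverse ++ c :: z = (c :: w).reverse ++ z := by simp
    rw [update_idem, e₁] at h
    refine Reach.head ?_ h
    simp only [step, h₀, stepAux, joinStk_regStack M ha, hs, update_regStack M ha,
      update_inr]
    simp [joinStk]

theorem reach_move_out {b : ℕ} (hb : b ≤ R) {l₀ l₁ : Λ}
    (h₀ : m l₀ = .pop (.inr M.tm.k₁) (fun v o => (v.1, o.map M.outputAlphabet))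
      (.branch (fun v => v.2.isSome)
        (.push (regStack M R b) (fun v => v.2.getD false) (.goto fun _ => l₀))
        (.goto fun _ => l₁))) (w : List Bool) :
    ∀ (s : State) (o : Option Bool),
    Reach (step m) (w.length + 1)
      ⟨some l₀, (M.tm.initialState, o),
        joinStk M R s (update (fun _ => []) M.tm.k₁ (w.map M.outputAlphabet.symm))⟩
      (some ⟨some l₁, (M.tm.initialState, none),
        joinStk M R (update s b (w.reverse ++ s b)) (fun _ => [])⟩) := by
  induction w with
  | nil =>
    intro s o
    refine Reach.single ?_
    have e : ((fun _ => []) : ∀ k, List (M.tm.Γ k)) = update (fun _ => []) M.tm.k₁ [] := by simp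
    simp [step, h₀, stepAux, joinStk, update_inr]
  | cons c w ih =>
    intro s o
    have h := ih (update s b (c :: s b)) (some c)
    have e₁ : w.reverse ++ update s b (c :: s b) b = (c :: w).reverse ++ s b := by simp
    rw [update_idem, e₁] at h
    refine Reach.head ?_ h
    simp only [step, h₀, stepAux, update_inr, joinStk_regStack M hb, update_regStack M hb]
    simp [joinStk]

theorem Run.reach {p : Prog} {s s' : State} {t : ℕ} (h : Run M p s t s') (hR : p.maxReg ≤ R) :
    ∀ (e : p.Lab M → Λ) (x : Λ), (∀ l, m (e l) = p.code M R e x l) → ∀ o, ∃ o',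
      Reach (step m) t
        ⟨some (e (p.entry M)), (M.tm.initialState, o), joinStk M R s fun _ => []⟩
        (some ⟨some x, (M.tm.initialState, o'), joinStk M R s' fun _ => []⟩) := by
  induction h with
  | skip s =>
    intro e x hm o
    refine ⟨o, Reach.single ?_⟩
    simp [hm, Prog.code]
  | push s r b =>
    intro e x hm o
    simp only [Prog.maxReg] at hR
    refine ⟨o, Reach.single ?_⟩
    simp [hm, Prog.code, joinStk_regStack M hR, update_regStack M hR]
  | @seq p q _ _ _ _ _ _ _ ih₁ ih₂ =>
    intro e x hm o
    simp only [Prog.maxReg, max_le_iff] at hR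
    obtain ⟨o₁, h₁⟩ := ih₁ hR.1 (fun l => e (Sum.inl l)) (e (Sum.inr (q.entry M)))
      (fun l => hm (Sum.inl l)) o
    obtain ⟨o₂, h₂⟩ := ih₂ hR.2 (fun l => e (Sum.inr l)) x (fun l => hm (Sum.inr l)) o₁
    exact ⟨o₂, h₁.trans h₂⟩
  | @case_nil r p q₀ q₁ s t s' hs _ ih =>
    intro e x hm o
    simp only [Prog.maxReg, max_le_iff] at hR
    obtain ⟨o₁, h₁⟩ := ih hR.2.1 (fun l => e (some (.inl l))) x
      (fun l => hm (some (.inl l))) none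
    exact ⟨o₁, Reach.head (step_popTo_nil hR.1 (hm none) hs _ _ _) h₁⟩
  | @case_cons r p q₀ q₁ s t s' b l hs _ ih =>
    intro e x hm o
    simp only [Prog.maxReg, max_le_iff] at hR
    cases b
    · obtain ⟨o₁, h₁⟩ := ih hR.2.2.1 (fun l => e (some (.inr (.inl l)))) x
        (fun l => hm (some (.inr (.inl l)))) (some false)
      exact ⟨o₁, Reach.head (step_popTo_cons hR.1 (hm none) hs _ _ _) h₁⟩
    · obtain ⟨o₁, h₁⟩ := ih hR.2.2.2 (fun l => e (some (.inr (.inr l)))) x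
        (fun l => hm (some (.inr (.inr l)))) (some true)
      exact ⟨o₁, Reach.head (step_popTo_cons hR.1 (hm none) hs _ _ _) h₁⟩
  | @loop_nil r q₀ q₁ s hs =>
    intro e x hm o
    simp only [Prog.maxReg, max_le_iff] at hR
    exact ⟨none, Reach.single (step_popTo_nil hR.1 (hm none) hs _ _ _)⟩
  | @loop_cons r q₀ q₁ s t s' t' s'' b l hs _ _ ih ih' =>
    intro e x hm o
    have hR' := hR
    simp only [Prog.maxReg, max_le_iff] at hR
    cases b
    · obtain ⟨o₁, h₁⟩ := ih hR.2.1 (fun l => e (some (.inl l))) (e (none : Option _))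
        (fun l => hm (some (.inl l))) (some false)
      obtain ⟨o₂, h₂⟩ := ih' hR' e x hm o₁
      exact ⟨o₂, Reach.head (step_popTo_cons hR.1 (hm none) hs _ _ _) (h₁.trans h₂)⟩
    · obtain ⟨o₁, h₁⟩ := ih hR.2.2 (fun l => e (some (.inr l))) (e (none : Option _))
        (fun l => hm (some (.inr l))) (some true)
      obtain ⟨o₂, h₂⟩ := ih' hR' e x hm o₁
      exact ⟨o₂, Reach.head (step_popTo_cons hR.1 (hm none) hs _ _ _) (h₁.trans h₂)⟩
  | @scan_nil r q s hs =>
    intro e x hm o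
    simp only [Prog.maxReg, max_le_iff] at hR
    exact ⟨none, Reach.single (step_popTo_nil hR.1 (hm none) hs _ _ _)⟩
  | @scan_false r q s l hs =>
    intro e x hm o
    simp only [Prog.maxReg, max_le_iff] at hR
    exact ⟨some false, Reach.single (step_popTo_cons hR.1 (hm none) hs _ _ _)⟩
  | @scan_true r q s t s' t' s'' l hs _ _ ih ih' =>
    intro e x hm o
    have hR' := hR
    simp only [Prog.maxReg, max_le_iff] at hR
    obtain ⟨o₁, h₁⟩ := ih hR.2 (fun l => e (some l)) (e (none : Option _))
      (fun l => hm (some l)) (some true)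
    obtain ⟨o₂, h₂⟩ := ih' hR' e x hm o₁
    exact ⟨o₂, Reach.head (step_popTo_cons hR.1 (hm none) hs _ _ _) (h₁.trans h₂)⟩
  | @call a b s y t hy =>
    intro e x hm o
    simp only [Prog.maxReg, max_le_iff] at hR
    have h₁ := reach_move_in hR.1 (hm none) (s a) s [] o rfl
    have e₀ : update (fun _ => []) M.tm.k₀ [] = ((fun _ => []) : ∀ k, List (M.tm.Γ k)) :=
      update_eq_self _ _
    have h₂ := reach_liftCfg M R (fun l => e (some l)) (update s a []) none m
      (fun l => hm (some (some l))) ((haltsWithin_iff M _ _ _).1 hy)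
    have h₃ := reach_move_out hR.2 (hm (some none)) y (update s a []) none
    rw [initList_eq, haltList_eq] at h₂
    rw [List.append_nil, List.map_nil, e₀] at h₁
    exact ⟨none, (h₁.trans h₂).trans h₃⟩

end Correctness

/-- The machine for a program, with input register `0` and output register `1`. -/
def Prog.machine (M : Machine) (p : Prog) : Machine :=
  letI := M.tm.kDecidableEq
  letI := M.tm.kFin
  letI := M.tm.σFin
  letI := p.labFintype M
  { tm :=
    { K := Fin (p.maxReg + 1 + 1) ⊕ M.tm.K
      k₀ := regStack M (p.maxReg + 1) 0
      k₁ := regStack M (p.maxReg + 1) 1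
      Γ := StackSym M (p.maxReg + 1)
      Λ := Option (p.Lab M)
      main := some (p.entry M)
      σ := Control M
      initialState := (M.tm.initialState, none)
      Γk₀Fin := inferInstanceAs (Fintype Bool)
      m := fun l => match l with
        | none => .load (fun v => (v.1, none)) .halt
        | some l => p.code M (p.maxReg + 1) some none l }
    inputAlphabet := Equiv.refl Bool
    outputAlphabet := Equiv.refl Bool }

/-- The state in which only the register `r` is nonempty. -/
def single (r : ℕ) (x : List Bool) : State := update (fun _ => []) r x

theorem joinStk_single (M : Machine) {R r : ℕ} (hr : r ≤ R) (x : List Bool) :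
    joinStk M R (single r x) (fun _ => []) =
      update (β := fun k => List (StackSym M R k)) (fun _ => []) (regStack M R r) x := by
  rw [single, ← update_regStack M hr]
  congr 1
  funext k
  rcases k with i | k <;> rfl

theorem Run.haltsWithin {M : Machine} {p : Prog} {x y : List Bool} {t : ℕ}
    (h : Run M p (single 0 x) t (single 1 y)) : (p.machine M).HaltsWithin x y (t + 1) := by
  rw [haltsWithin_iff, initList_eq, haltList_eq]
  obtain ⟨o, ho⟩ := h.reach (R := p.maxReg + 1) (m := (p.machine M).tm.m) (Nat.le_succ _)
    some none (fun l => rfl) none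
  rw [joinStk_single M (Nat.zero_le _), joinStk_single M (by omega)] at ho
  have hx : ∀ x : List Bool, List.map (p.machine M).inputAlphabet.symm x = x := List.map_id
  have hy : ∀ x : List Bool, List.map (p.machine M).outputAlphabet.symm x = x := List.map_id
  rw [hx, hy]
  exact ho.trans (Reach.single rfl)

/-- The number of push instructions in a statement. -/
def pushCount {K : Type} {Γ : K → Type} {Λ σ : Type} : Stmt Γ Λ σ → ℕ
  | .push _ _ q => pushCount q + 1
  | .peek _ _ q => pushCount q
  | .pop _ _ q => pushCount q
  | .load _ q => pushCount q
  | .branch _ q₁ q₂ => max (pushCount q₁) (pushCount q₂)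
  | .goto _ => 0
  | .halt => 0

theorem length_stepAux_le {K : Type} [DecidableEq K] {Γ : K → Type} {Λ σ : Type}
    (q : Stmt Γ Λ σ) (v : σ) (S : ∀ k, List (Γ k)) (k : K) :
    ((stepAux q v S).stk k).length ≤ (S k).length + pushCount q := by
  induction q generalizing v S with
  | push k' f q ih =>
    refine (ih _ _).trans ?_
    by_cases h : k = k'
    · subst h; simp [pushCount]; omega
    · simp [pushCount, update_of_ne h]
  | peek k' f q ih => exact ih _ _
  | pop k' f q ih =>
    refine (ih _ _).trans ?_
    by_cases h : k = k'
    · subst h; simp [pushCount]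
    · simp [pushCount, update_of_ne h]
  | load f q ih => exact ih _ _
  | branch f q₁ q₂ ih₁ ih₂ =>
    have h₁ := ih₁ v S
    have h₂ := ih₂ v S
    simp only [stepAux, pushCount]
    cases f v <;> simp only [cond_true, cond_false] <;> omega
  | goto f => simp [pushCount]
  | halt => simp [pushCount]

theorem Machine.exists_length_le (M : Machine) :
    ∃ B, ∀ x y t, M.HaltsWithin x y t → y.length ≤ x.length + B * t := by
  let _ := M.tm.ΛFin
  let B := Finset.univ.sup fun l => pushCount (M.tm.m l)
  have key : ∀ n t, n ≤ t → ∀ c c' : M.tm.Cfg, (flip bind M.tm.step)^[n] (some c) = some c' →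
      (c'.stk M.tm.k₁).length ≤ (c.stk M.tm.k₁).length + B * n := by
    intro n
    induction n with
    | zero =>
      rintro t - c c' h
      cases h
      simp
    | succ n ih =>
      intro t ht c c' h
      rw [iterate_succ_apply] at h
      obtain ⟨l, v, S⟩ := c
      cases l with
      | none =>
        have h0 : flip bind M.tm.step (some ⟨none, v, S⟩) = none := rfl
        rw [h0, iterate_bind_none] at h
        cases h
      | some l =>
        have h1 : flip bind M.tm.step (some ⟨some l, v, S⟩) = some (stepAux (M.tm.m l) v S) := rfl
        rw [h1] at h
        have h2 := ih t (by omega) _ _ h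
        have h3 := length_stepAux_le (M.tm.m l) v S M.tm.k₁
        have h4 : pushCount (M.tm.m l) ≤ B :=
          Finset.le_sup (f := fun l => pushCount (M.tm.m l)) (Finset.mem_univ l)
        rw [mul_add_one]
        exact h2.trans (by simp only; omega)
  refine ⟨B, fun x y t h => ?_⟩
  rw [haltsWithin_iff, initList_eq, haltList_eq] at h
  obtain ⟨n, hn, h⟩ := h
  have h1 := key n n le_rfl _ _ h
  have h2 : (update (β := fun k => List (M.tm.Γ k)) (fun _ => []) M.tm.k₀
      (x.map M.inputAlphabet.symm) M.tm.k₁).length ≤ x.length := by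
    by_cases h : M.tm.k₁ = M.tm.k₀
    · have : ∀ k, M.tm.k₀ = k → (update (β := fun k => List (M.tm.Γ k)) (fun _ => []) M.tm.k₀
        (x.map M.inputAlphabet.symm) k).length ≤ x.length := by
        rintro k rfl
        simp
      exact this _ h.symm
    · simp [update_of_ne h]
  simp only [update_self, List.length_map] at h1
  have := Nat.mul_le_mul_left B hn
  omega

end ParamSetCover

namespace ParamSetCover

open Function

/-! ### Polynomially bounded functions -/

/-- `f` is bounded by a polynomial. -/
def PolyBdd (f : ℕ → ℕ) : Prop := ∃ C d, ∀ W, f W ≤ C * (W + 1) ^ d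

namespace PolyBdd

variable {f g : ℕ → ℕ}

theorem mono (hg : PolyBdd g) (h : ∀ W, f W ≤ g W) : PolyBdd f := by
  obtain ⟨C, d, hg⟩ := hg
  exact ⟨C, d, fun W => (h W).trans (hg W)⟩

theorem const (c : ℕ) : PolyBdd fun _ => c := ⟨c, 0, fun W => by simp⟩

theorem id : PolyBdd fun W => W := ⟨1, 1, fun W => by simp⟩

theorem add (hf : PolyBdd f) (hg : PolyBdd g) : PolyBdd fun W => f W + g W := by
  obtain ⟨C, d, hf⟩ := hf
  obtain ⟨C', d', hg⟩ := hg
  refine ⟨C + C', d + d', fun W => (add_le_add (hf W) (hg W)).trans ?_⟩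
  rw [add_mul]
  gcongr <;> omega

theorem mul (hf : PolyBdd f) (hg : PolyBdd g) : PolyBdd fun W => f W * g W := by
  obtain ⟨C, d, hf⟩ := hf
  obtain ⟨C', d', hg⟩ := hg
  refine ⟨C * C', d + d', fun W => (Nat.mul_le_mul (hf W) (hg W)).trans (le_of_eq ?_)⟩
  ring

theorem pow (hf : PolyBdd f) (n : ℕ) : PolyBdd fun W => f W ^ n := by
  induction n with
  | zero => simpa using const 1
  | succ n ih => simpa [pow_succ] using ih.mul hf

theorem comp (hf : PolyBdd f) (hg : PolyBdd g) : PolyBdd fun W => f (g W) := by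
  obtain ⟨C, d, hf⟩ := hf
  exact ((const C).mul ((hg.add (const 1)).pow d)).mono fun W => hf (g W)

end PolyBdd

/-! ### Running programs -/

/-- Started in `s`, the program `p` ends in `s'` after at most `T` steps. -/
def Runs (M : Machine) (p : Prog) (s s' : State) (T : ℕ) : Prop := ∃ t ≤ T, Run M p s t s'

namespace Runs

variable {M : Machine} {p q q₀ q₁ : Prog} {s s' s'' : State} {T T' : ℕ} {r : ℕ}

theorem mono (h : Runs M p s s' T) (hT : T ≤ T') : Runs M p s s' T' := by
  obtain ⟨t, ht, h⟩ := h
  exact ⟨t, ht.trans hT, h⟩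

theorem congr (h : Runs M p s s' T) (hs : s' = s'') : Runs M p s s'' T := hs ▸ h

theorem skip : Runs M .skip s s 1 := ⟨1, le_rfl, .skip s⟩

theorem push (b : Bool) : Runs M (.push r b) s (update s r (b :: s r)) 1 :=
  ⟨1, le_rfl, .push s r b⟩

theorem seq (h : Runs M p s s' T) (h' : Runs M q s' s'' T') :
    Runs M (.seq p q) s s'' (T + T') := by
  obtain ⟨t, ht, h⟩ := h
  obtain ⟨t', ht', h'⟩ := h'
  exact ⟨t + t', add_le_add ht ht', .seq h h'⟩

theorem case_nil (hs : s r = []) (h : Runs M p s s' T) :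
    Runs M (.case r p q₀ q₁) s s' (T + 1) := by
  obtain ⟨t, ht, h⟩ := h
  exact ⟨t + 1, by omega, .case_nil hs h⟩

theorem case_cons {b : Bool} {l : List Bool} (hs : s r = b :: l)
    (h : Runs M (cond b q₁ q₀) (update s r l) s' T) : Runs M (.case r p q₀ q₁) s s' (T + 1) := by
  obtain ⟨t, ht, h⟩ := h
  exact ⟨t + 1, by omega, .case_cons hs h⟩

theorem loop_nil (hs : s r = []) : Runs M (.loop r q₀ q₁) s s 1 := ⟨1, le_rfl, .loop_nil hs⟩

theorem loop_cons {b : Bool} {l : List Bool} (hs : s r = b :: l)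
    (h : Runs M (cond b q₁ q₀) (update s r l) s' T) (h' : Runs M (.loop r q₀ q₁) s' s'' T') :
    Runs M (.loop r q₀ q₁) s s'' (T + T' + 1) := by
  obtain ⟨t, ht, h⟩ := h
  obtain ⟨t', ht', h'⟩ := h'
  exact ⟨t + t' + 1, by omega, .loop_cons hs h h'⟩

/-- The rule for a loop over a list of bits: `f l` is the state when `l` is left. -/
theorem loop_list (f : List Bool → State) (w : List Bool) (hf : ∀ l, l <:+ w → f l r = l)
    (h : ∀ b l, (b :: l) <:+ w → Runs M (cond b q₁ q₀) (update (f (b :: l)) r l) (f l) T) :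
    Runs M (.loop r q₀ q₁) (f w) (f []) (w.length * (T + 1) + 1) := by
  induction w with
  | nil => exact (loop_nil (hf [] List.suffix_rfl)).mono (by simp)
  | cons b w ih =>
    have ih := ih (fun l hl => hf l (hl.trans (List.suffix_cons _ _)))
      fun b l hl => h b l (hl.trans (List.suffix_cons _ _))
    refine (loop_cons (hf _ List.suffix_rfl) (h b w List.suffix_rfl) ih).mono ?_
    simp only [List.length_cons]
    linarith

/-- The rule for a loop over a number in unary: `f i j` is the state when `i` is left, after `j`
rounds. -/
theorem loop_unary (f : ℕ → ℕ → State) (n : ℕ) (hf : ∀ i j, f i j r = List.replicate i true)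
    (h : ∀ i j, i + 1 + j = n →
      Runs M q₁ (update (f (i + 1) j) r (List.replicate i true)) (f i (j + 1)) T) :
    Runs M (.loop r q₀ q₁) (f n 0) (f 0 n) (n * (T + 1) + 1) := by
  have key : ∀ i j, i + j = n → Runs M (.loop r q₀ q₁) (f i j) (f 0 n) (i * (T + 1) + 1) := by
    intro i
    induction i with
    | zero =>
      rintro j hj
      obtain rfl : j = n := by omega
      exact (loop_nil (hf 0 j)).mono (by simp)
    | succ i ih =>
      intro j hj
      have hs : f (i + 1) j r = true :: List.replicate i true := hf _ _
      refine (loop_cons hs (h i j hj) (ih (j + 1) (by omega))).mono ?_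
      linarith
  exact key n 0 rfl

end Runs

/-- Move the bits of a register to another one, in reverse order. -/
def Prog.move (r d : ℕ) : Prog := .loop r (.push d false) (.push d true)

theorem Runs.move {M : Machine} {s : State} {r d : ℕ} (h : r ≠ d) :
    Runs M (.move r d) s (update (update s r []) d ((s r).reverse ++ s d))
      ((s r).length * 2 + 1) := by
  have key : ∀ (w : List Bool) (s : State), s r = w →
      Runs M (.move r d) s (update (update s r []) d (w.reverse ++ s d)) (w.length * 2 + 1) := by
    intro w
    induction w with
    | nil =>
      intro s hs
      have : update (update s r []) d ([].reverse ++ s d) = s := by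
        rw [← hs, update_eq_self]
        simp [hs]
      rw [this]
      exact (Runs.loop_nil hs).mono (by simp)
    | cons b w ih =>
      intro s hs
      have h1 : Runs M (cond b (.push d true) (.push d false)) (update s r w)
          (update (update s r w) d (b :: s d)) 1 := by
        have : s d = update s r w d := by simp [h.symm]
        rw [this]
        cases b <;> exact Runs.push _
      have h2 := ih (update (update s r w) d (b :: s d)) (by simp [h])
      have e : update (update (update (update s r w) d (b :: s d)) r []) d
          (w.reverse ++ update (update s r w) d (b :: s d) d) =
          update (update s r []) d ((b :: w).reverse ++ s d) := by
        funext i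
        simp only [update_apply]
        split_ifs <;> simp_all
      rw [e] at h2
      exact (Runs.loop_cons hs h1 h2).mono (by simp; omega)
  exact key _ s rfl

/-- Empty a register. -/
def Prog.clear (r : ℕ) : Prog := .loop r .skip .skip

theorem Runs.clear {M : Machine} {s : State} {r : ℕ} :
    Runs M (.clear r) s (update s r []) ((s r).length * 2 + 1) := by
  have := Runs.loop_list (M := M) (q₀ := .skip) (q₁ := .skip) (r := r) (T := 1)
    (fun l => update s r l) (s r) (by simp) (fun b l _ => by cases b <;> simpa using Runs.skip)
  simpa [Prog.clear] using this

/-! ### Registers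

The registers `0` and `1` hold the input and the output, `2` is for temporary use, `3` is the stack
of truth values, `4` and `5` hold bit strings to which formulas refer. -/

/-- The registers for the bit strings to which formulas refer. -/
def bitReg (a : Bool) : ℕ := cond a 5 4
/-- The register for a variable. -/
def varReg (i : ℕ) : ℕ := 2 * i + 10
/-- The registers for the evaluation of terms. -/
def auxReg (j : ℕ) : ℕ := 2 * j + 11

@[simp] theorem varReg_inj {i j : ℕ} : varReg i = varReg j ↔ i = j := by
  unfold varReg; omega
@[simp] theorem auxReg_inj {i j : ℕ} : auxReg i = auxReg j ↔ i = j := by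
  unfold auxReg; omega
@[simp] theorem varReg_ne_auxReg {i j : ℕ} : varReg i ≠ auxReg j := by
  unfold varReg auxReg; omega
@[simp] theorem auxReg_ne_varReg {i j : ℕ} : auxReg i ≠ varReg j := by
  unfold varReg auxReg; omega
@[simp] theorem varReg_ne {i n : ℕ} (h : n < 10) : varReg i ≠ n := by
  unfold varReg; omega
@[simp] theorem ne_varReg {i n : ℕ} (h : n < 10) : n ≠ varReg i := by
  unfold varReg; omega
@[simp] theorem auxReg_ne {i n : ℕ} (h : n < 10) : auxReg i ≠ n := by
  unfold auxReg; omega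
@[simp] theorem ne_auxReg {i n : ℕ} (h : n < 10) : n ≠ auxReg i := by
  unfold auxReg; omega
@[simp] theorem bitReg_lt (a : Bool) : bitReg a < 10 := by cases a <;> simp [bitReg]
@[simp] theorem bitReg_ne_two (a : Bool) : bitReg a ≠ 2 := by cases a <;> simp [bitReg]
@[simp] theorem bitReg_ne_three (a : Bool) : bitReg a ≠ 3 := by cases a <;> simp [bitReg]
@[simp] theorem two_ne_bitReg (a : Bool) : 2 ≠ bitReg a := by cases a <;> simp [bitReg]
@[simp] theorem three_ne_bitReg (a : Bool) : 3 ≠ bitReg a := by cases a <;> simp [bitReg]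

/-- The numbers in the variable registers are given by `e`, and the auxiliary registers from `j` on
are empty. -/
structure State.Holds (s : State) (e : ℕ → ℕ) (j : ℕ) : Prop where
  var : ∀ i, s (varReg i) = List.replicate (e i) true
  aux : ∀ i ≥ j, s (auxReg i) = []
  tmp : s 2 = []

namespace State.Holds

variable {s : State} {e : ℕ → ℕ} {j : ℕ}

theorem mono {j' : ℕ} (h : s.Holds e j) (hj : j ≤ j') : s.Holds e j' :=
  ⟨h.var, fun i hi => h.aux i (by omega), h.tmp⟩

theorem update_aux {d : ℕ} (h : s.Holds e j) (hd : d < j) (l : List Bool) :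
    State.Holds (update s (auxReg d) l) e j := by
  refine ⟨fun i => ?_, fun i hi => ?_, ?_⟩
  · simp [h.var]
  · rw [update_of_ne (by simp; omega), h.aux i hi]
  · simp [h.tmp]

theorem update_small {r : ℕ} (h : s.Holds e j) (hr : r < 10) (hr' : r ≠ 2) (l : List Bool) :
    State.Holds (update s r l) e j := by
  refine ⟨fun i => ?_, fun i hi => ?_, ?_⟩
  · simp [h.var, hr]
  · simp [h.aux i hi, hr]
  · simp [h.tmp, hr'.symm]

theorem update_var {i : ℕ} (h : s.Holds e j) (v : ℕ) :
    State.Holds (update s (varReg i) (List.replicate v true)) (update e i v) j := by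
  refine ⟨fun i' => ?_, fun i' hi' => ?_, ?_⟩
  · by_cases hi : i' = i
    · subst hi; simp
    · simp [h.var, hi]
  · simp [h.aux i' hi']
  · simp [h.tmp]

end State.Holds

/-! ### Terms -/

/-- Arithmetical terms. -/
inductive Tm
  | var (i : ℕ)
  | const (c : ℕ)
  | add (t u : Tm)
  | mul (t u : Tm)

namespace Tm

instance : Add Tm := ⟨add⟩
instance : Mul Tm := ⟨mul⟩

/-- The value of a term. -/
def eval (e : ℕ → ℕ) : Tm → ℕ
  | var i => e i
  | const c => c
  | add t u => t.eval e + u.eval e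
  | mul t u => t.eval e * u.eval e

@[simp] theorem eval_var (e : ℕ → ℕ) (i : ℕ) : (var i).eval e = e i := rfl
@[simp] theorem eval_const (e : ℕ → ℕ) (c : ℕ) : (const c).eval e = c := rfl
@[simp] theorem eval_add (e : ℕ → ℕ) (t u : Tm) : (t + u).eval e = t.eval e + u.eval e := rfl
@[simp] theorem eval_mul (e : ℕ → ℕ) (t u : Tm) : (t * u).eval e = t.eval e * u.eval e := rfl

/-- Powers with a fixed exponent. -/
def pow (t : Tm) : ℕ → Tm
  | 0 => const 1
  | n + 1 => t.pow n * t

@[simp] theorem eval_pow (e : ℕ → ℕ) (t : Tm) (n : ℕ) : (t.pow n).eval e = t.eval e ^ n := by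
  induction n with
  | zero => rfl
  | succ n ih => simp [pow, ih, pow_succ]

/-- The largest value of a term for arguments up to `W`. -/
def bound (t : Tm) (W : ℕ) : ℕ := t.eval fun _ => W

theorem eval_le_bound {e : ℕ → ℕ} {W : ℕ} (he : ∀ i, e i ≤ W) (t : Tm) : t.eval e ≤ t.bound W := by
  induction t with
  | var i => exact he i
  | const c => exact le_rfl
  | add t u iht ihu => exact add_le_add iht ihu
  | mul t u iht ihu => exact Nat.mul_le_mul iht ihu

theorem polyBdd_bound (t : Tm) : PolyBdd t.bound := by
  induction t with
  | var i => exact PolyBdd.id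
  | const c => exact PolyBdd.const c
  | add t u iht ihu => exact iht.add ihu
  | mul t u iht ihu => exact iht.mul ihu

/-- Add the value of a term to the auxiliary register `d`, using the auxiliary registers from `j`
on. -/
def prog : Tm → ℕ → ℕ → Prog
  | var i, _, d => .seq (.loop (varReg i) .skip (.seq (.push 2 true) (.push (auxReg d) true)))
      (.loop 2 .skip (.push (varReg i) true))
  | const c, _, d => c.rec .skip fun _ p => .seq p (.push (auxReg d) true)
  | add t u, j, d => .seq (t.prog j d) (u.prog j d)
  | mul t u, j, d => .seq (t.prog (j + 1) j) (.loop (auxReg j) .skip (u.prog (j + 1) d))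

/-- A bound for the time needed to evaluate a term. -/
def cost : Tm → ℕ → ℕ
  | var _, W => 5 * W + 2
  | const c, _ => c + 1
  | add t u, W => t.cost W + u.cost W
  | mul t u, W => t.cost W + (t.bound W * (u.cost W + 1) + 1)

theorem polyBdd_cost (t : Tm) : PolyBdd t.cost := by
  induction t with
  | var i => exact ((PolyBdd.const 5).mul PolyBdd.id).add (PolyBdd.const 2)
  | const c => exact PolyBdd.const (c + 1)
  | add t u iht ihu => exact iht.add ihu
  | mul t u iht ihu =>
    exact iht.add ((t.polyBdd_bound.mul (ihu.add (PolyBdd.const 1))).add (PolyBdd.const 1))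

theorem runs_prog (M : Machine) {e : ℕ → ℕ} {W : ℕ} (he : ∀ i, e i ≤ W) (t : Tm) :
    ∀ {j d : ℕ} {s : State}, d < j → s.Holds e j → Runs M (t.prog j d) s
      (update s (auxReg d) (List.replicate (t.eval e) true ++ s (auxReg d))) (t.cost W) := by
  induction t with
  | var i =>
    intro j d s hd hs
    have h1 := Runs.loop_unary (M := M) (r := varReg i) (q₀ := .skip)
      (q₁ := .seq (.push 2 true) (.push (auxReg d) true)) (T := 2)
      (fun v w => update (update (update s (varReg i) (List.replicate v true))
        2 (List.replicate w true)) (auxReg d) (List.replicate w true ++ s (auxReg d))) (e i)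
      (fun v w => by simp)
      (by
        rintro v w -
        refine Runs.congr ((Runs.push true).seq (Runs.push true)) ?_
        funext r
        by_cases h1 : r = auxReg d
        · subst h1; simp [List.replicate_succ]
        by_cases h2 : r = 2
        · subst h2; simp [List.replicate_succ]
        by_cases h3 : r = varReg i
        · subst h3; simp
        simp [h1, h2, h3])
    have h2 := Runs.loop_unary (M := M) (r := 2) (q₀ := .skip) (q₁ := .push (varReg i) true) (T := 1)
      (fun v w => update (update (update s (varReg i) (List.replicate w true))
        2 (List.replicate v true)) (auxReg d) (List.replicate (e i) true ++ s (auxReg d))) (e i)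
      (fun v w => by simp)
      (by
        rintro v w -
        refine Runs.congr (Runs.push true) ?_
        funext r
        simp only [update_apply, List.replicate_succ]
        split_ifs <;> simp_all)
    have e1 : update (update (update s (varReg i) (List.replicate (e i) true))
        2 (List.replicate 0 true)) (auxReg d) (List.replicate 0 true ++ s (auxReg d)) = s := by
      funext r
      simp only [update_apply, List.replicate_zero, List.nil_append]
      split_ifs <;> simp_all [hs.tmp, hs.var]
    rw [e1] at h1
    refine ((h1.seq h2).congr ?_).mono ?_
    · funext r
      simp only [update_apply, List.replicate_zero, eval_var]
      split_ifs <;> simp_all [hs.tmp, hs.var]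
    · have := he i
      simp only [cost]
      omega
  | const c =>
    intro j d s hd hs
    induction c with
    | zero => simpa [prog, eval, cost] using Runs.skip
    | succ c ih =>
      have := ih.seq (Runs.push (r := auxReg d) true)
      simpa [prog, eval, cost, List.replicate_succ] using this
  | add t u iht ihu =>
    intro j d s hd hs
    have h1 := iht hd hs
    have h2 := ihu hd (hs.update_aux hd (List.replicate (t.eval e) true ++ s (auxReg d)))
    have := h1.seq h2
    rw [update_idem, update_self, ← List.append_assoc, ← List.replicate_add, add_comm] at this
    exact this
  | mul t u iht ihu =>
    intro j d s hd hs
    have h1 := iht (Nat.lt_succ_self j) (hs.mono (Nat.le_succ j))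
    rw [hs.aux j le_rfl, List.append_nil] at h1
    have h2 := Runs.loop_unary (M := M) (r := auxReg j) (q₀ := .skip)
      (q₁ := u.prog (j + 1) d) (T := u.cost W)
      (fun v w => update (update s (auxReg j) (List.replicate v true)) (auxReg d)
        (List.replicate (w * u.eval e) true ++ s (auxReg d))) (t.eval e)
      (fun v w => by simp [hd.ne'])
      (by
        rintro v w -
        refine Runs.congr (ihu (by omega) (((((hs.mono (Nat.le_succ j)).update_aux
          (Nat.lt_succ_self j) _).update_aux (Nat.lt_succ_of_lt hd) _).update_aux
          (Nat.lt_succ_self j) _))) ?_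
        have hjd : auxReg j ≠ auxReg d := by simp [hd.ne']
        have hsum : (w + 1) * u.eval e = u.eval e + w * u.eval e := by ring
        funext r
        by_cases h1 : r = auxReg d
        · subst h1
          rw [update_self, update_of_ne hjd.symm, update_self, update_self, hsum,
            List.replicate_add, List.append_assoc]
        by_cases h2 : r = auxReg j
        · subst h2; simp [hd.ne']
        simp [h1, h2])
    have e1 : update (update s (auxReg j) (List.replicate (t.eval e) true)) (auxReg d)
        (List.replicate (0 * u.eval e) true ++ s (auxReg d)) =
        update s (auxReg j) (List.replicate (t.eval e) true) := by
      have hjd : auxReg d ≠ auxReg j := by simp [hd.ne]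
      rw [update_eq_self_iff]
      simp [hjd]
    rw [e1] at h2
    refine ((h1.seq h2).congr ?_).mono ?_
    · have h0 := hs.aux j le_rfl
      funext r
      by_cases h1 : r = auxReg d
      · subst h1; simp [eval]
      by_cases h2 : r = auxReg j
      · subst h2; simp [hd.ne', h0]
      simp [h1, h2]
    · have := Nat.mul_le_mul_right (u.cost W + 1) (t.eval_le_bound he)
      simp only [cost]
      omega

end Tm

/-! ### Formulas -/

/-- Formulas with bounded quantifiers. In a formula of level `n`, the quantified variable has index
`n`; its scope is a formula of level `n + 1`. -/
inductive Fm
  | lt (t u : Tm)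
  /-- The bit at the position given by a term of one of two bit strings is `1`. -/
  | bit (a : Bool) (t : Tm)
  | neg (φ : Fm)
  | and (φ ψ : Fm)
  /-- There is a number less than the value of `t` with the property `φ`. -/
  | ex (t : Tm) (φ : Fm)

namespace Fm

/-- Truth of a formula of level `n`. -/
def Sat (o : Bool → List Bool) : ℕ → (ℕ → ℕ) → Fm → Prop
  | _, e, lt t u => t.eval e < u.eval e
  | _, e, bit a t => (o a)[t.eval e]? = some true
  | n, e, neg φ => ¬ φ.Sat o n e
  | n, e, and φ ψ => φ.Sat o n e ∧ ψ.Sat o n e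
  | n, e, ex t φ => ∃ v < t.eval e, φ.Sat o (n + 1) (update e n v)

open Classical in
/-- The truth value of a proposition. -/
noncomputable def _root_.ParamSetCover.bval (P : Prop) : Bool := decide P

@[simp] theorem _root_.ParamSetCover.bval_true : bval True = true := by simp [bval]
@[simp] theorem _root_.ParamSetCover.bval_false : bval False = false := by simp [bval]
@[simp] theorem _root_.ParamSetCover.bval_eq_true {P : Prop} : bval P = true ↔ P := by simp [bval]

/-- Push the truth value of a formula of level `n` to the register `3`. -/
def prog : Fm → ℕ → Prog
  | lt t u, _ => .seq (t.prog 2 0) <| .seq (u.prog 2 1) <|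
      .seq (.loop (auxReg 0) .skip (.case (auxReg 1) .skip .skip .skip)) <|
      .seq (.case (auxReg 1) (.push 3 false) (.push 3 true) (.push 3 true)) (.clear (auxReg 1))
  | bit a t, _ => .seq (t.prog 1 0) <|
      .seq (.loop (auxReg 0) .skip (.case (bitReg a) .skip (.push 2 false) (.push 2 true))) <|
      .seq (.case (bitReg a) (.push 3 false) (.seq (.push (bitReg a) false) (.push 3 false))
        (.seq (.push (bitReg a) true) (.push 3 true))) (.move 2 (bitReg a))
  | neg φ, n => .seq (φ.prog n) (.case 3 .skip (.push 3 true) (.push 3 false))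
  | and φ ψ, n => .seq (φ.prog n) <| .seq (ψ.prog n) <|
      .case 3 .skip (.case 3 .skip (.push 3 false) (.push 3 false)) .skip
  | ex t φ, n => .seq (t.prog 1 0) <| .seq (.move (auxReg 0) (varReg n)) <| .seq (.push 3 false) <|
      .loop (varReg n) .skip (.seq (φ.prog (n + 1))
        (.case 3 .skip .skip (.case 3 .skip (.push 3 true) (.push 3 true))))

/-- A bound for the time needed to evaluate a formula. -/
def cost : Fm → ℕ → ℕ
  | lt t u, W => t.cost W + (u.cost W + (t.bound W * 3 + 1 + (2 + (u.bound W * 2 + 1))))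
  | bit _ t, W => t.cost W + (t.bound W * 3 + 1 + (3 + (t.bound W * 2 + 1)))
  | neg φ, W => φ.cost W + 2
  | and φ ψ, W => φ.cost W + (ψ.cost W + 3)
  | ex t φ, W => t.cost W + (t.bound W * 2 + 1 + (1 +
      (t.bound W * (φ.cost (W + t.bound W) + 3 + 1) + 1)))

theorem polyBdd_cost (φ : Fm) : PolyBdd φ.cost := by
  induction φ with
  | lt t u =>
    exact t.polyBdd_cost.add (u.polyBdd_cost.add (((t.polyBdd_bound.mul (.const 3)).add (.const 1)).add
      ((PolyBdd.const 2).add ((u.polyBdd_bound.mul (.const 2)).add (.const 1)))))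
  | bit a t =>
    exact t.polyBdd_cost.add (((t.polyBdd_bound.mul (.const 3)).add (.const 1)).add
      ((PolyBdd.const 3).add ((t.polyBdd_bound.mul (.const 2)).add (.const 1))))
  | neg φ ih => exact ih.add (.const 2)
  | and φ ψ ih₁ ih₂ => exact ih₁.add (ih₂.add (.const 3))
  | ex t φ ih =>
    exact t.polyBdd_cost.add (((t.polyBdd_bound.mul (.const 2)).add (.const 1)).add
      ((PolyBdd.const 1).add ((t.polyBdd_bound.mul (((ih.comp
        (PolyBdd.id.add t.polyBdd_bound)).add (.const 3)).add (.const 1))).add (.const 1))))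

theorem runs_prog (M : Machine) (o : Bool → List Bool) (φ : Fm) :
    ∀ {n : ℕ} {e : ℕ → ℕ} {W : ℕ} {s : State}, (∀ i, e i ≤ W) → (∀ i ≥ n, e i = 0) →
      s.Holds e 0 → (∀ a, s (bitReg a) = o a) →
      Runs M (φ.prog n) s (update s 3 (bval (φ.Sat o n e) :: s 3)) (φ.cost W) := by
  induction φ with
  | lt t u =>
    intro n e W s he hn hs ho
    have h1 := t.runs_prog M he (j := 2) (d := 0) (by omega) (hs.mono (by omega))
    have h2 := u.runs_prog M he (j := 2) (d := 1) (by omega)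
      ((hs.mono (by omega)).update_aux (d := 0) (by omega)
        (List.replicate (t.eval e) true))
    rw [hs.aux 0 (le_refl _), List.append_nil] at h1
    rw [update_of_ne (by simp), hs.aux 1 (by omega), List.append_nil] at h2
    have h3 := Runs.loop_unary (M := M) (r := auxReg 0) (q₀ := .skip)
      (q₁ := .case (auxReg 1) .skip .skip .skip) (T := 2)
      (fun v w => update (update s (auxReg 0) (List.replicate v true)) (auxReg 1)
        (List.replicate (u.eval e - w) true)) (t.eval e)
      (fun v w => by simp)
      (by
        rintro v w -
        by_cases hw : u.eval e ≤ w
        · have e1 : u.eval e - w = 0 := by omega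
          have e2 : u.eval e - (w + 1) = 0 := by omega
          refine (Runs.case_nil (by simp [e1]) Runs.skip).congr ?_
          rw [update_comm (by simp), update_idem, e1, e2]
        · have e1 : u.eval e - w = u.eval e - (w + 1) + 1 := by omega
          refine (Runs.case_cons (b := true) (l := List.replicate (u.eval e - (w + 1)) true)
            (by simp [e1, List.replicate_succ]) Runs.skip).congr ?_
          rw [update_comm (by simp), update_idem, update_comm (by simp), update_idem])
    rw [Nat.sub_zero] at h3
    have h45 : Runs M (.seq (.case (auxReg 1) (.push 3 false) (.push 3 true) (.push 3 true))
        (.clear (auxReg 1)))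
        (update (update s (auxReg 0) (List.replicate 0 true)) (auxReg 1)
        (List.replicate (u.eval e - t.eval e) true))
        (update s 3 (bval (t.eval e < u.eval e) :: s 3)) (2 + (u.bound W * 2 + 1)) := by
      have hu := u.eval_le_bound he
      by_cases hlt : t.eval e < u.eval e
      · have e1 : u.eval e - t.eval e = u.eval e - t.eval e - 1 + 1 := by omega
        refine (((Runs.case_cons (b := true)
          (l := List.replicate (u.eval e - t.eval e - 1) true) (by
            rw [update_self, e1, List.replicate_succ, ← e1]) (Runs.push _)).seq Runs.clear).congr ?_).mono ?_
        · funext r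
          have h0 := hs.aux 0 (le_refl _)
          have h0' := hs.aux 1 (by omega)
          by_cases h1 : r = auxReg 1
          · subst h1; simp [h0']
          by_cases h2 : r = auxReg 0
          · subst h2; simp [h0]
          by_cases h3 : r = 3
          · subst h3; simp [hlt]
          simp [h1, h2, h3]
        · simp; omega
      · have e1 : u.eval e - t.eval e = 0 := by omega
        refine (((Runs.case_nil (by simp [e1]) (Runs.push _)).seq Runs.clear).congr ?_).mono ?_
        · funext r
          have h0 := hs.aux 0 (le_refl _)
          have h0' := hs.aux 1 (by omega)
          by_cases h1 : r = auxReg 1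
          · subst h1; simp [h0']
          by_cases h2 : r = auxReg 0
          · subst h2; simp [h0]
          by_cases h3 : r = 3
          · subst h3; simp [hlt]
          simp [h1, h2, h3]
        · simp [e1]
          omega
    refine (h1.seq (h2.seq (h3.seq h45))).mono ?_
    have := t.eval_le_bound he
    simp only [cost]
    omega
  | bit a t =>
    intro n e W s he hn hs ho
    have h1 := t.runs_prog M he (j := 1) (d := 0) (by omega) (hs.mono (by omega))
    rw [hs.aux 0 (le_refl _), List.append_nil] at h1
    have h2 := Runs.loop_unary (M := M) (r := auxReg 0) (q₀ := .skip)
      (q₁ := .case (bitReg a) .skip (.push 2 false) (.push 2 true)) (T := 2)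
      (fun v w => update (update (update s (auxReg 0) (List.replicate v true)) (bitReg a)
        ((o a).drop w)) 2 ((o a).take w).reverse) (t.eval e)
      (fun v w => by simp)
      (by
        rintro v w -
        by_cases hw : (o a).length ≤ w
        · refine (Runs.case_nil (by simp [List.drop_eq_nil_of_le hw]) Runs.skip).congr ?_
          rw [List.drop_eq_nil_of_le hw, List.drop_eq_nil_of_le (by omega), List.take_of_length_le hw,
            List.take_of_length_le (by omega)]
          funext r
          by_cases h1 : r = 2
          · subst h1; simp
          by_cases h2 : r = bitReg a
          · subst h2; simp
          by_cases h3 : r = auxReg 0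
          · subst h3; simp
          simp [h1, h2, h3]
        · push Not at hw
          refine (Runs.case_cons (b := (o a)[w]) (l := (o a).drop (w + 1))
            (by simp) (T := 1)
            (s' := update (update (update s (auxReg 0) (List.replicate v true)) (bitReg a)
              ((o a).drop (w + 1))) 2 ((o a).take (w + 1)).reverse) ?_)
          have : ∀ b, cond b (Prog.push 2 true) (Prog.push 2 false) = .push 2 b := by
            intro b; cases b <;> rfl
          rw [this]
          refine (Runs.push _).congr ?_
          have hrev : ((o a).take (w + 1)).reverse = (o a)[w] :: ((o a).take w).reverse := by
            rw [List.take_succ_eq_append_getElem hw, List.reverse_append]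
            rfl
          rw [hrev]
          funext r
          by_cases h1 : r = 2
          · subst h1; simp
          by_cases h2 : r = bitReg a
          · subst h2; simp
          by_cases h3 : r = auxReg 0
          · subst h3; simp
          simp [h1, h2, h3])
    have e0 : update (update (update s (auxReg 0) (List.replicate (t.eval e) true)) (bitReg a)
        ((o a).drop 0)) 2 ((o a).take 0).reverse =
        update s (auxReg 0) (List.replicate (t.eval e) true) := by
      have hoa := ho a
      have ht := hs.tmp
      funext r
      by_cases h1 : r = 2
      · subst h1; simp [ht]
      by_cases h2 : r = bitReg a
      · subst h2; simp [hoa]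
      simp [h1, h2]
    rw [e0] at h2
    have h34 : Runs M (.seq (.case (bitReg a) (.push 3 false)
        (.seq (.push (bitReg a) false) (.push 3 false))
        (.seq (.push (bitReg a) true) (.push 3 true))) (.move 2 (bitReg a)))
        (update (update (update s (auxReg 0) (List.replicate 0 true)) (bitReg a)
        ((o a).drop (t.eval e))) 2 ((o a).take (t.eval e)).reverse)
        (update s 3 (bval ((o a)[t.eval e]? = some true) :: s 3))
        (3 + (t.bound W * 2 + 1)) := by
      have ht := t.eval_le_bound he
      have h0 := hs.aux 0 (le_refl _)
      have hoa := ho a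
      have htm := hs.tmp
      by_cases hw : (o a).length ≤ t.eval e
      · refine (((Runs.case_nil (by simp [List.drop_eq_nil_of_le hw]) (Runs.push _)).seq
          (Runs.move (by simp))).congr ?_).mono ?_
        · funext r
          by_cases h1 : r = 2
          · subst h1; simp [htm]
          by_cases h2 : r = bitReg a
          · subst h2; simp [hoa]
          by_cases h3 : r = auxReg 0
          · subst h3; simp [h0]
          by_cases h4 : r = 3
          · subst h4; simp [hw]
          simp [h1, h2, h3, h4]
        · simp; omega
      · push Not at hw
        have h5 : Runs M (cond (o a)[t.eval e] (.seq (.push (bitReg a) true) (.push 3 true))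
            (.seq (.push (bitReg a) false) (.push 3 false)))
          (update (update (update (update s (auxReg 0) (List.replicate 0 true)) (bitReg a)
            ((o a).drop (t.eval e))) 2 ((o a).take (t.eval e)).reverse) (bitReg a)
            ((o a).drop (t.eval e + 1)))
          (update (update (update (update s (auxReg 0) []) (bitReg a)
            ((o a).drop (t.eval e))) 2 ((o a).take (t.eval e)).reverse) 3
            (bval ((o a)[t.eval e]? = some true) :: s 3)) 2 := by
          have : ∀ b, cond b (Prog.seq (.push (bitReg a) true) (.push 3 true))
            (.seq (.push (bitReg a) false) (.push 3 false)) =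
              .seq (.push (bitReg a) b) (.push 3 b) := by
            intro b; cases b <;> rfl
          rw [this]
          refine ((Runs.push _).seq (Runs.push _)).congr ?_
          funext r
          by_cases h4 : r = 3
          · subst h4
            cases h : (o a)[t.eval e] <;> simp [hw, h]
          by_cases h1 : r = 2
          · subst h1; simp
          by_cases h2 : r = bitReg a
          · subst h2; simp
          simp [h1, h2, h4]
        refine (((Runs.case_cons (by simp) h5).seq (Runs.move (by simp))).congr ?_).mono ?_
        · funext r
          by_cases h1 : r = 2
          · subst h1; simp [htm]
          by_cases h2 : r = bitReg a
          · subst h2; simp [hoa]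
          by_cases h3 : r = auxReg 0
          · subst h3; simp [h0]
          by_cases h4 : r = 3
          · subst h4; simp
          simp [h1, h2, h3, h4]
        · simp; omega
    refine (h1.seq (h2.seq h34)).mono ?_
    have := t.eval_le_bound he
    simp only [cost]
    omega
  | neg φ ih =>
    intro n e W s he hn hs ho
    have h1 := ih he hn hs ho
    have h2 : Runs M (.case 3 .skip (.push 3 true) (.push 3 false))
        (update s 3 (bval (φ.Sat o n e) :: s 3)) (update s 3 (bval (¬ φ.Sat o n e) :: s 3)) 2 := by
      refine Runs.case_cons (update_self _ _ _) ?_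
      by_cases h : φ.Sat o n e
      · simpa [h] using Runs.push (M := M) (r := 3) (s := s) false
      · simpa [h] using Runs.push (M := M) (r := 3) (s := s) true
    exact h1.seq h2
  | and φ ψ ih₁ ih₂ =>
    intro n e W s he hn hs ho
    have h1 := ih₁ he hn hs ho
    have h2 := ih₂ he hn (hs.update_small (r := 3) (by omega) (by omega)
      (bval (φ.Sat o n e) :: s 3)) (fun a => by simp [ho])
    rw [update_idem, update_self] at h2
    have h3 : Runs M (.case 3 .skip (.case 3 .skip (.push 3 false) (.push 3 false)) .skip)
        (update s 3 (bval (ψ.Sat o n e) :: bval (φ.Sat o n e) :: s 3))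
        (update s 3 (bval (φ.Sat o n e ∧ ψ.Sat o n e) :: s 3)) 3 := by
      refine Runs.case_cons (update_self _ _ _) ?_
      by_cases h : ψ.Sat o n e
      · simpa [h] using (Runs.skip (M := M)).mono (by omega)
      · simp only [h, bval_false, cond_false, and_false]
        refine Runs.case_cons (by rw [update_idem, update_self]) ?_
        have : ∀ b : Bool, cond b (Prog.push 3 false) (.push 3 false) = .push 3 false := by
          intro b; cases b <;> rfl
        rw [this]
        simpa using Runs.push (M := M) (r := 3) (s := s) false
    exact h1.seq (h2.seq h3)
  | ex t φ ih =>
    intro n e W s he hn hs ho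
    have ht := t.eval_le_bound he
    have h1 := t.runs_prog M he (j := 1) (d := 0) (by omega) (hs.mono (by omega))
    rw [hs.aux 0 (le_refl _), List.append_nil] at h1
    have h2 : Runs M (.move (auxReg 0) (varReg n)) 
      (update s (auxReg 0) (List.replicate (t.eval e) true))
      (update s (varReg n) (List.replicate (t.eval e) true)) (t.bound W * 2 + 1) := by
      refine ((Runs.move (by simp)).congr ?_).mono ?_
      · have h0 := hs.aux 0 (le_refl _)
        have h0' := hs.var n
        rw [hn n le_rfl] at h0'
        funext r
        by_cases h1 : r = varReg n
        · subst h1; simp [h0']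
        by_cases h2 : r = auxReg 0
        · subst h2; simp [h0]
        simp [h1, h2]
      · simp; omega
    have h3 : Runs M (.push 3 false) (update s (varReg n) (List.replicate (t.eval e) true))
      (update (update s (varReg n) (List.replicate (t.eval e) true)) 3
        (bval (∃ v < t.eval e, t.eval e ≤ v ∧ φ.Sat o (n + 1) (update e n v)) :: s 3)) 1 := by
      refine (Runs.push false).congr ?_
      have : ¬ ∃ v < t.eval e, t.eval e ≤ v ∧ φ.Sat o (n + 1) (update e n v) := by
        rintro ⟨v, hv, hv', -⟩
        omega
      simp [this]
    have h4 := Runs.loop_unary (M := M) (r := varReg n) (q₀ := .skip)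
      (q₁ := .seq (φ.prog (n + 1))
        (.case 3 .skip .skip (.case 3 .skip (.push 3 true) (.push 3 true))))
      (T := φ.cost (W + t.bound W) + 3)
      (fun v w => update (update s (varReg n) (List.replicate v true)) 3
        (bval (∃ v' < t.eval e, v ≤ v' ∧ φ.Sat o (n + 1) (update e n v')) :: s 3)) (t.eval e)
      (fun v w => by simp)
      (by
        intro v w hvw
        have e1 : update (update (update s (varReg n) (List.replicate (v + 1) true)) 3
          (bval (∃ v' < t.eval e, v + 1 ≤ v' ∧ φ.Sat o (n + 1) (update e n v')) :: s 3))
          (varReg n) (List.replicate v true) =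
          update (update s (varReg n) (List.replicate v true)) 3
          (bval (∃ v' < t.eval e, v + 1 ≤ v' ∧ φ.Sat o (n + 1) (update e n v')) :: s 3) := by
          rw [update_comm (by simp), update_idem]
        rw [e1]
        have h5 := ih (n := n + 1) (e := update e n v) (W := W + t.bound W)
          (fun i => by
            by_cases h : i = n
            · subst h; simp; omega
            · simp [h]; exact (he i).trans (by omega))
          (fun i hi => by rw [update_of_ne (by omega), hn i (by omega)])
          ((hs.update_var (i := n) v).update_small (r := 3) (by omega) (by omega)
            (bval (∃ v' < t.eval e, v + 1 ≤ v' ∧ φ.Sat o (n + 1) (update e n v')) :: s 3))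
          (fun a => by simp [ho])
        refine h5.seq ?_
        rw [update_idem, update_self]
        refine Runs.case_cons (update_self _ _ _) ?_
        by_cases h : φ.Sat o (n + 1) (update e n v)
        · simp only [h, bval_true, cond_true]
          refine Runs.case_cons (by rw [update_idem, update_self]) ?_
          have : ∀ b : Bool, cond b (Prog.push 3 true) (.push 3 true) = .push 3 true := by
            intro b; cases b <;> rfl
          rw [this]
          refine (Runs.push true).congr ?_
          have : ∃ v' < t.eval e, v ≤ v' ∧ φ.Sat o (n + 1) (update e n v') :=
            ⟨v, by omega, le_rfl, h⟩
          simp [this]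
        · simp only [h, bval_false, cond_false]
          refine (Runs.skip.congr ?_).mono (by omega)
          rw [update_idem]
          congr 3
          refine propext ⟨?_, ?_⟩
          · rintro ⟨v', h1, h2, h3⟩
            exact ⟨v', h1, by omega, h3⟩
          · rintro ⟨v', h1, h2, h3⟩
            refine ⟨v', h1, ?_, h3⟩
            rcases h2.eq_or_lt with rfl | h2
            · exact absurd h3 h
            · exact h2)
    refine ((h1.seq (h2.seq (h3.seq h4))).congr ?_).mono ?_
    · have h0' := hs.var n
      rw [hn n le_rfl] at h0'
      funext r
      by_cases h1 : r = 3
      · subst h1; simp [Sat]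
      by_cases h2 : r = varReg n
      · subst h2; simp [h0']
      simp [h1, h2]
    · have := Nat.mul_le_mul_right (φ.cost (W + t.bound W) + 3 + 1) ht
      simp only [cost]
      omega

end Fm

end ParamSetCover

namespace ParamSetCover

open Function

/-! ### The gap producing reduction -/

theorem Instance.opt_le_iff (Γ : Instance) (k : ℕ) :
    Γ.opt ≤ k ↔ ∃ C, Γ.IsCover C ∧ C.card ≤ k := by
  constructor
  · intro h
    have h' : Γ.opt < (k + 1 : ℕ) := lt_of_le_of_lt h (by exact_mod_cast Nat.lt_succ_self k)
    simp only [Instance.opt, iInf_lt_iff] at h'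
    obtain ⟨C, hC, h'⟩ := h'
    refine ⟨C, hC, ?_⟩
    have : C.card < k + 1 := by exact_mod_cast h'
    omega
  · rintro ⟨C, hC, h⟩
    exact (iInf₂_le C hC).trans (by exact_mod_cast h)

/-- Adjacency of elements given by their indices. -/
def Instance.Adj (Γ : Instance) (s u : ℕ) : Prop :=
  ∃ (hs : s < Γ.numS) (hu : u < Γ.numU), Γ.adj ⟨s, hs⟩ ⟨u, hu⟩ = true

/-- The digits of a number. -/
def digit (V x r : ℕ) : ℕ := x / V ^ r % V

theorem digit_lt {V : ℕ} (hV : 0 < V) (x r : ℕ) : digit V x r < V := Nat.mod_lt _ hV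

theorem exists_digit_eq {V : ℕ} (N : ℕ) (d : ℕ → ℕ) (hd : ∀ r, d r < V) :
    ∃ x < V ^ N, ∀ r < N, digit V x r = d r := by
  have hV : 0 < V := (Nat.zero_le _).trans_lt (hd 0)
  induction N generalizing d with
  | zero => exact ⟨0, by simp, by simp⟩
  | succ N ih =>
    obtain ⟨x, hx, h⟩ := ih (fun r => d (r + 1)) fun r => hd _
    refine ⟨x * V + d 0, ?_, fun r hr => ?_⟩
    · have := hd 0
      rw [pow_succ]
      nlinarith
    · cases r with
      | zero => simp [digit, Nat.mod_eq_of_lt (hd 0)]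
      | succ r =>
        rw [← h r (by omega)]
        unfold digit
        rw [pow_succ', ← Nat.div_div_eq_div_mul, mul_comm x V, Nat.mul_add_div hV,
          Nat.div_eq_of_lt (hd 0), add_zero]

/-- The moduli. -/
def modulus (D i : ℕ) : ℕ := 1 + (i + 1) * D

theorem modulus_pos (D i : ℕ) : 0 < modulus D i := by unfold modulus; omega

theorem modulus_mono (D : ℕ) : Monotone (modulus D) := fun i j h => by
  unfold modulus
  gcongr

theorem coprime_modulus {D a : ℕ} (hD : ∀ d < a, d + 1 ∣ D) {i j : ℕ} (hij : i < j) (hj : j < a) :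
    (modulus D i).Coprime (modulus D j) := by
  refine Nat.Coprime.symm (Nat.coprime_of_dvd fun p hp h₁ h₂ => ?_)
  unfold modulus at h₁ h₂
  have h3 : p ∣ (j - i) * D := by
    have := Nat.dvd_sub h₁ h₂
    have e : 1 + (j + 1) * D - (1 + (i + 1) * D) = (j - i) * D := by
      rw [Nat.sub_mul]
      have : (j + 1) * D = j * D + D := by ring
      have : (i + 1) * D = i * D + D := by ring
      omega
    rwa [e] at this
  have h4 : p ∣ D := by
    rcases (Nat.Prime.dvd_mul hp).1 h3 with h | h
    · have := hD (j - i - 1) (by omega)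
      rw [show j - i - 1 + 1 = j - i by omega] at this
      exact h.trans this
    · exact h
  have h5 : p ∣ 1 := (Nat.dvd_add_left (h4.mul_left _)).1 h₁
  exact hp.one_lt.ne' (Nat.dvd_one.1 h5)

/-- The properties of `D` that the reduction needs. -/
def GoodModuli (k n m V D : ℕ) : Prop :=
  (∀ d < m + k, d + 1 ∣ D) ∧ (¬ ∃ b < n, ∀ r < k + 1, modulus D r ∣ b + 1) ∧
    ∃ b < V, 0 < b ∧ ∀ r < k, modulus D (m + r) ∣ b

theorem prod_range_le_prod_of_monotone {f : ℕ → ℕ} (hf : Monotone f) (T : Finset ℕ) :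
    ∏ r ∈ Finset.range T.card, f r ≤ ∏ i ∈ T, f i := by
  induction T using Finset.induction_on_max with
  | empty => simp
  | insert a T ha ih =>
    have hT : a ∉ T := fun h => lt_irrefl _ (ha a h)
    rw [Finset.card_insert_of_notMem hT, Finset.prod_range_succ, Finset.prod_insert hT, mul_comm]
    refine Nat.mul_le_mul (hf ?_) ih
    have : T ⊆ Finset.range a := fun x hx => Finset.mem_range.2 (ha x hx)
    simpa using Finset.card_le_card this

theorem GoodModuli.card_le {k n m V D : ℕ} (h : GoodModuli k n m V D) {s s' : ℕ} (hs : s < n)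
    (hs' : s' < n) (hne : s ≠ s') :
    ((Finset.range m).filter fun i => s % modulus D i = s' % modulus D i).card ≤ k := by
  wlog hlt : s < s' generalizing s s'
  · have := this hs' hs hne.symm (by omega)
    simpa only [eq_comm] using this
  by_contra! hcard
  obtain ⟨T, hT, hTc⟩ := Finset.exists_subset_card_eq (Nat.succ_le_of_lt hcard)
  have hT' : ∀ i ∈ T, i < m ∧ s % modulus D i = s' % modulus D i := fun i hi => by
    simpa using hT hi
  have hcop : (T : Set ℕ).Pairwise fun i j => (modulus D i).Coprime (modulus D j) := by
    intro i hi j hj hij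
    rcases lt_or_gt_of_ne hij with h' | h'
    · exact coprime_modulus h.1 h' (by have := (hT' j hj).1; omega)
    · exact (coprime_modulus h.1 h' (by have := (hT' i hi).1; omega)).symm
  have hdvd : ∏ i ∈ T, modulus D i ∣ s' - s := by
    refine Finset.prod_dvd_of_isRelPrime ?_ fun i hi => ?_
    · exact fun i hi j hj hij => Nat.coprime_iff_isRelPrime.1 (hcop hi hj hij)
    · exact (Nat.modEq_iff_dvd' hlt.le).1 (hT' i hi).2
  have hle := Nat.le_of_dvd (by omega) hdvd
  have hprod := prod_range_le_prod_of_monotone (modulus_mono D) T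
  rw [hTc, Nat.succ_eq_add_one] at hprod
  refine h.2.1 ⟨∏ r ∈ Finset.range (k + 1), modulus D r - 1, by omega, fun r hr => ?_⟩
  rw [Nat.sub_add_cancel (Finset.prod_pos fun i _ => modulus_pos D i)]
  exact Finset.dvd_prod_of_mem _ (Finset.mem_range.2 hr)

theorem GoodModuli.exists_residues {k n m V D : ℕ} (h : GoodModuli k n m V D) (i : ℕ) (hi : i < m)
    (c : ℕ → ℕ) : ∃ b < V, ∀ r < k, b % modulus D (m + r) = c r % modulus D i := by
  have hcop : Set.Pairwise (Finset.range k : Set ℕ)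
      (Nat.Coprime.onFun fun r => modulus D (m + r)) := by
    intro r hr r' hr' hne
    simp only [Finset.coe_range, Set.mem_Iio] at hr hr'
    rcases lt_or_gt_of_ne hne with h' | h'
    · exact coprime_modulus h.1 (by omega) (by omega)
    · exact (coprime_modulus h.1 (by omega : m + r' < m + r) (by omega)).symm
  obtain ⟨b₀, hb₀, hb₀', hdvd⟩ := h.2.2
  have hprod : ∏ r ∈ Finset.range k, modulus D (m + r) ∣ b₀ := by
    refine Finset.prod_dvd_of_isRelPrime ?_ fun r hr => hdvd r (Finset.mem_range.1 hr)
    exact fun i hi j hj hij => Nat.coprime_iff_isRelPrime.1 (hcop hi hj hij)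
  have hne : ∀ r ∈ Finset.range k, modulus D (m + r) ≠ 0 := fun r _ => (modulus_pos D _).ne'
  let x := Nat.chineseRemainderOfFinset (fun r => c r % modulus D i) (fun r => modulus D (m + r))
    (Finset.range k) hne hcop
  have hx := Nat.chineseRemainderOfFinset_lt_prod (fun r => c r % modulus D i)
    (fun r => modulus D (m + r)) hne hcop
  refine ⟨x, (hx.trans_le (Nat.le_of_dvd hb₀' hprod)).trans hb₀, fun r hr => ?_⟩
  have := x.2 r (Finset.mem_range.2 hr)
  rw [this]
  refine Nat.mod_eq_of_lt ((Nat.mod_lt _ (modulus_pos D i)).trans_le (modulus_mono D (by omega)))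

theorem exists_goodModuli {k n m V : ℕ} (hm : 0 < m)
    (hV : (4 * (m + k) * (m + k).factorial) ^ (k + 1) * (n + 1) < V) :
    ∃ D < V, GoodModuli k n m V D := by
  have hN : ∃ N, n < N ^ (k + 1) := ⟨n + 1, by
    calc n < n + 1 := Nat.lt_succ_self n
      _ ≤ (n + 1) ^ (k + 1) := Nat.le_self_pow (by omega) _⟩
  classical
  obtain ⟨N, hN, hmin⟩ : ∃ N, n < N ^ (k + 1) ∧ ∀ N' < N, N' ^ (k + 1) ≤ n :=
    ⟨Nat.find hN, Nat.find_spec hN, fun N' h => not_lt.1 (Nat.find_min hN h)⟩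
  have hN0 : 0 < N := by
    rcases Nat.eq_zero_or_pos N with rfl | h
    · simp at hN
    · exact h
  set a := m + k with ha
  set F := a.factorial with hF
  have hF0 : 0 < F := Nat.factorial_pos _
  have hN2 : ∃ N₁, N ≤ 2 * N₁ ∧ N₁ ^ (k + 1) ≤ n + 1 ∧ 0 < N₁ := by
    rcases Nat.lt_or_ge 1 N with h | h
    · exact ⟨N - 1, by omega, (hmin (N - 1) (by omega)).trans (Nat.le_succ n), by omega⟩
    · exact ⟨1, by omega, by simp, one_pos⟩
  obtain ⟨N₁, hN1, hN1', hN10⟩ := hN2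
  have hg : ∀ i < a, modulus (F * N) i ≤ 4 * a * F * N₁ := by
    intro i hi
    unfold modulus
    have h1 : (i + 1) * (F * N) ≤ a * (F * (2 * N₁)) := by gcongr; omega
    have h2 : 1 ≤ a * (F * (2 * N₁)) := Nat.mul_pos (by omega) (Nat.mul_pos hF0 (by omega))
    calc 1 + (i + 1) * (F * N) ≤ a * (F * (2 * N₁)) + a * (F * (2 * N₁)) := add_le_add h2 h1
      _ = 4 * a * F * N₁ := by ring
  have hbase : 1 ≤ 4 * a * F := Nat.mul_pos (by omega) hF0
  have hbound : ∀ j ≤ k + 1, (4 * a * F * N₁) ^ j < V := by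
    intro j hj
    calc (4 * a * F * N₁) ^ j ≤ (4 * a * F * N₁) ^ (k + 1) :=
          Nat.pow_le_pow_right (Nat.mul_pos hbase hN10) hj
      _ = (4 * a * F) ^ (k + 1) * N₁ ^ (k + 1) := mul_pow _ _ _
      _ ≤ (4 * a * F) ^ (k + 1) * (n + 1) := Nat.mul_le_mul_left _ hN1'
      _ < V := hV
  refine ⟨F * N, ?_, ?_, ?_, ?_⟩
  · have h0 := hg 0 (by omega)
    have h1 := hbound 1 (by omega)
    unfold modulus at h0
    rw [pow_one] at h1
    omega
  · intro d hd
    exact (Nat.dvd_factorial (Nat.succ_pos d) hd).mul_right _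
  · rintro ⟨b, hb, h⟩
    have hcop : Set.Pairwise (Finset.range (k + 1) : Set ℕ)
        (Nat.Coprime.onFun fun r => modulus (F * N) r) := by
      intro r hr r' hr' hne
      simp only [Finset.coe_range, Set.mem_Iio] at hr hr'
      have hd : ∀ d < a, d + 1 ∣ F * N := fun d hd =>
        (Nat.dvd_factorial (Nat.succ_pos d) hd).mul_right _
      rcases lt_or_gt_of_ne hne with h' | h'
      · exact coprime_modulus hd h' (by omega)
      · exact (coprime_modulus hd h' (by omega)).symm
    have hprod : ∏ r ∈ Finset.range (k + 1), modulus (F * N) r ∣ b + 1 := by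
      refine Finset.prod_dvd_of_isRelPrime ?_ fun r hr => h r (Finset.mem_range.1 hr)
      exact fun i hi j hj hij => Nat.coprime_iff_isRelPrime.1 (hcop hi hj hij)
    have h1 := Nat.le_of_dvd (Nat.succ_pos b) hprod
    have h2 : N ^ (k + 1) ≤ ∏ r ∈ Finset.range (k + 1), modulus (F * N) r := by
      have : ∀ r ∈ Finset.range (k + 1), N ≤ modulus (F * N) r := by
        intro r _
        unfold modulus
        have : 1 * (1 * N) ≤ (r + 1) * (F * N) := by gcongr <;> omega
        omega
      simpa using Finset.prod_le_prod (fun _ _ => Nat.zero_le _) this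
    omega
  · refine ⟨∏ r ∈ Finset.range k, modulus (F * N) (m + r), ?_, 
      Finset.prod_pos fun i _ => modulus_pos _ _, fun r hr =>
        Finset.dvd_prod_of_mem (fun r => modulus (F * N) (m + r)) (Finset.mem_range.2 hr)⟩
    refine lt_of_le_of_lt ?_ (hbound k (Nat.le_succ k))
    have : ∀ r ∈ Finset.range k, modulus (F * N) (m + r) ≤ 4 * a * F * N₁ := fun r hr =>
      hg _ (by have := Finset.mem_range.1 hr; omega)
    simpa using Finset.prod_le_prod (fun _ _ => Nat.zero_le _) this

end ParamSetCover

namespace ParamSetCover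

open Function

/-- The number of copies of the original sets in the reduction. -/
def copies (c k : ℕ) : ℕ := 8 * c ^ 2 * (k + 1) ^ 2

/-- The number of positions at which a label has to be chosen. -/
def positions (c k : ℕ) : ℕ := copies c k * (k + 1)

theorem copies_pos {c : ℕ} (hc : 0 < c) (k : ℕ) : 0 < copies c k := by
  unfold copies; positivity

theorem positions_pos {c : ℕ} (hc : 0 < c) (k : ℕ) : 0 < positions c k :=
  Nat.mul_pos (copies_pos hc k) (Nat.succ_pos k)

/-- Adjacency in the gap instance. A set with the digits `y, x` in base `V` is the label `y` at
position `x` if `x` is a position, and the original set `y` in copy `j` if `x` is `j` plus the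
number of positions. An element consists of a position, a copy, and `4 c` pairs of a label and an
original element. -/
def GapAdj (Γ : Instance) (c k V D s u : ℕ) : Prop :=
  (positions c k ≤ digit V u 0 ∨ copies c k ≤ digit V u 1 ∨
    ∃ p < 4 * c, Γ.numU ≤ digit V u (3 + 2 * p)) ∨
  (digit V s 1 < positions c k ∧ digit V s 1 = digit V u 0 ∧
    ¬ ∃ p < 4 * c, digit V u (2 + 2 * p) = digit V s 0) ∨
  (digit V s 1 = positions c k + digit V u 1 ∧ ∃ p < 4 * c,
    Γ.Adj (digit V s 0) (digit V u (3 + 2 * p)) ∧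
    ∃ r < k, digit V u (2 + 2 * p) % modulus D (positions c k + r) =
      digit V s 0 % modulus D (digit V u 0))

/-- The instance that the reduction produces. -/
noncomputable def gapInstance (Γ : Instance) (c k V D : ℕ) : Instance where
  numS := V ^ 2
  numU := V ^ (2 + 8 * c)
  adj s u := bval (GapAdj Γ c k V D s u)

theorem mul_add_lt_sq {V x y : ℕ} (hx : x < V) (hy : y < V) : x * V + y < V ^ 2 := by
  nlinarith

theorem digit_zero_mul_add {V x y : ℕ} (hy : y < V) : digit V (x * V + y) 0 = y := by
  simp [digit, Nat.mod_eq_of_lt hy]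

theorem digit_one_mul_add {V x y : ℕ} (hx : x < V) (hy : y < V) : digit V (x * V + y) 1 = x := by
  simp [digit, mul_comm x V, Nat.mul_add_div (by omega : V > 0), Nat.div_eq_of_lt hy,
    Nat.mod_eq_of_lt hx]

theorem digit_one_mul_add_digit_zero {V s : ℕ} (hs : s < V ^ 2) :
    digit V s 1 * V + digit V s 0 = s := by
  have : s / V < V := Nat.div_lt_of_lt_mul (by rwa [← sq])
  simp [digit, Nat.mod_eq_of_lt this, Nat.div_add_mod']

theorem gapInstance_opt_le {Γ : Instance} {c k V D : ℕ} (hc : 0 < c)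
    (hD : GoodModuli k Γ.numS (positions c k) V D) (hV : positions c k + copies c k ≤ V)
    (hn : Γ.numS ≤ V) (h : Γ.opt ≤ k) :
    (gapInstance Γ c k V D).opt ≤ (2 * positions c k : ℕ) := by
  classical
  obtain ⟨C, hC, hCk⟩ := (Γ.opt_le_iff k).1 h
  set m := positions c k with hm
  set w := copies c k with hw
  have hm0 : 0 < m := positions_pos hc k
  let cs : ℕ → ℕ := fun r => ((C.toList[r]?).map Fin.val).getD 0
  have hcs : ∀ s ∈ C, ∃ r < k, cs r = s := by
    intro s hs
    obtain ⟨r, hr, h⟩ := List.getElem_of_mem (Finset.mem_toList.2 hs)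
    have hr' : r < C.card := by simpa using hr
    exact ⟨r, hr'.trans_le hCk, by simp [cs, List.getElem?_eq_getElem hr, h]⟩
  have hb : ∀ i, ∃ b < V, i < m → ∀ r < k, b % modulus D (m + r) = cs r % modulus D i := by
    intro i
    by_cases hi : i < m
    · obtain ⟨b, hb, h⟩ := hD.exists_residues i hi cs
      exact ⟨b, hb, fun _ => h⟩
    · exact ⟨0, by omega, fun h => absurd h hi⟩
  choose b hbV hb using hb
  have hlab : ∀ i < m, i * V + b i < V ^ 2 := fun i hi => mul_add_lt_sq (by omega) (hbV i)
  have hset : ∀ j < w, ∀ s : Fin Γ.numS, (m + j) * V + s < V ^ 2 := fun j hj s =>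
    mul_add_lt_sq (by omega) (by omega)
  let X₁ : Finset (Fin (V ^ 2)) :=
    Finset.univ.image fun i : Fin m => ⟨i * V + b i, hlab i i.2⟩
  let X₂ : Finset (Fin (V ^ 2)) :=
    (Finset.univ ×ˢ C).image fun p : Fin w × Fin Γ.numS =>
      ⟨(m + p.1) * V + p.2, hset p.1 p.1.2 p.2⟩
  refine ((gapInstance Γ c k V D).opt_le_iff _).2 ⟨X₁ ∪ X₂, ?_, ?_⟩
  · intro u
    by_cases hinv : m ≤ digit V u 0 ∨ w ≤ digit V u 1 ∨
      ∃ p < 4 * c, Γ.numU ≤ digit V u (3 + 2 * p)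
    · refine ⟨⟨0 * V + b 0, hlab 0 hm0⟩, Finset.mem_union_left _
        (Finset.mem_image.2 ⟨⟨0, hm0⟩, Finset.mem_univ _, rfl⟩), ?_⟩
      exact bval_eq_true.2 (Or.inl hinv)
    · have hinv' := hinv
      push Not at hinv'
      obtain ⟨hi, hj, hu⟩ := hinv'
      set i := digit V u 0 with hidef
      set j := digit V u 1 with hjdef
      by_cases hp : ∃ p < 4 * c, digit V u (2 + 2 * p) = b i
      · obtain ⟨p, hp, hpb⟩ := hp
        obtain ⟨s, hsC, hsu⟩ := hC ⟨digit V u (3 + 2 * p), hu p hp⟩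
        obtain ⟨r, hr, hrs⟩ := hcs s hsC
        refine ⟨⟨(m + j) * V + s, hset j hj s⟩, Finset.mem_union_right _
          (Finset.mem_image.2 ⟨(⟨j, hj⟩, s), by simp [hsC], rfl⟩), ?_⟩
        refine bval_eq_true.2 (Or.inr (Or.inr ⟨?_, p, hp, ?_, r, hr, ?_⟩))
        · exact digit_one_mul_add (by omega) (by omega)
        · rw [digit_zero_mul_add (by omega)]
          exact ⟨s.2, hu p hp, hsu⟩
        · rw [digit_zero_mul_add (by omega), hpb, hb i hi r hr, hrs]
      · refine ⟨⟨i * V + b i, hlab i hi⟩, Finset.mem_union_left _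
          (Finset.mem_image.2 ⟨⟨i, hi⟩, Finset.mem_univ _, rfl⟩), ?_⟩
        refine bval_eq_true.2 (Or.inr (Or.inl ⟨?_, ?_, ?_⟩))
        · rwa [digit_one_mul_add (by omega) (hbV i)]
        · rw [digit_one_mul_add (by omega) (hbV i)]
        · rwa [digit_zero_mul_add (hbV i)]
  · have h₁ : X₁.card ≤ m := Finset.card_image_le.trans (by simp)
    have h₂ : X₂.card ≤ w * C.card := Finset.card_image_le.trans (by simp)
    have h₃ : w * C.card ≤ w * (k + 1) := Nat.mul_le_mul_left _ (by omega)
    have h₄ : w * (k + 1) = m := rfl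
    have h₅ : (X₁ ∪ X₂).card ≤ 2 * m := (Finset.card_union_le X₁ X₂).trans (by omega)
    exact h₅

theorem gapInstance_lt_opt {Γ : Instance} {c k V D : ℕ} (hc : 0 < c)
    (hD : GoodModuli k Γ.numS (positions c k) V D) (hV : positions c k + copies c k ≤ V)
    (hn : Γ.numS ≤ V) (hU : Γ.numU ≤ V) (h : ¬ Γ.opt ≤ k) :
    ¬ (gapInstance Γ c k V D).opt ≤ (c * (2 * positions c k) : ℕ) := by
  classical
  intro hopt
  obtain ⟨X, hX, hXc⟩ := ((gapInstance Γ c k V D).opt_le_iff _).1 hopt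
  set m := positions c k with hm
  set w := copies c k with hw
  have hm0 : 0 < m := positions_pos hc k
  have hw0 : 0 < w := copies_pos hc k
  have hV0 : 0 < V := by omega
  change Finset (Fin (V ^ 2)) at X
  let X' : Finset ℕ := X.image Fin.val
  have hX' : X'.card ≤ c * (2 * m) := Finset.card_image_le.trans hXc
  -- the original sets in a copy, and the labels at a position
  let Y : ℕ → Finset ℕ := fun j => (Finset.range Γ.numS).filter fun s => (m + j) * V + s ∈ X'
  let L : ℕ → Finset ℕ := fun i => (Finset.range V).filter fun b => i * V + b ∈ X'
  have hsum : ∀ (N : ℕ) (Z : ℕ → Finset ℕ) (f : ℕ → ℕ), Injective f → (∀ j < N, ∀ s ∈ Z j, s < V ∧ f j * V + s ∈ X') →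
      ∑ j ∈ Finset.range N, (Z j).card ≤ X'.card := by
    intro N Z f hf hZ
    rw [← Finset.card_sigma]
    refine Finset.card_le_card_of_injOn (fun p => f p.1 * V + p.2) ?_ ?_
    · rintro ⟨j, s⟩ hp
      simp only [Finset.coe_sigma, Set.mem_sigma_iff, Finset.coe_range, Set.mem_Iio,
        Finset.mem_coe] at hp
      exact (hZ j hp.1 s hp.2).2
    · rintro ⟨j, s⟩ hp ⟨j', s'⟩ hp' heq
      simp only [Finset.coe_sigma, Set.mem_sigma_iff, Finset.coe_range, Set.mem_Iio,
        Finset.mem_coe] at hp hp'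
      have h1 := (hZ j hp.1 s hp.2).1
      have h2 := (hZ j' hp'.1 s' hp'.2).1
      simp only at heq
      have e1 : s = s' := by
        have := congrArg (· % V) heq
        simpa [Nat.mul_add_mod', Nat.mod_eq_of_lt h1, Nat.mod_eq_of_lt h2] using this
      subst e1
      have e2 : f j = f j' := Nat.eq_of_mul_eq_mul_right hV0 (by omega)
      rw [hf e2]
  have hYsum := hsum w Y (fun j => m + j) (fun a b h => by simpa using h) (fun j _ s hs => by
    simp only [Y, Finset.mem_filter, Finset.mem_range] at hs
    exact ⟨by omega, hs.2⟩)
  have hLsum := hsum m L id injective_id (fun j _ s hs => by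
    simpa only [L, Finset.mem_filter, Finset.mem_range, id] using hs)
  obtain ⟨j, hj, hYj⟩ : ∃ j < w, (Y j).card ≤ 2 * c * (k + 1) := by
    by_contra! hcon
    have : ∑ j ∈ Finset.range w, (2 * c * (k + 1) + 1) ≤ ∑ j ∈ Finset.range w, (Y j).card :=
      Finset.sum_le_sum fun j hj => hcon j (Finset.mem_range.1 hj)
    simp only [Finset.sum_const, Finset.card_range, smul_eq_mul] at this
    have e : c * (2 * m) = w * (2 * c * (k + 1)) := by rw [hm, positions]; ring
    have := Nat.mul_lt_mul_of_pos_left (Nat.lt_succ_self (2 * c * (k + 1))) hw0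
    simp only [Nat.succ_eq_add_one] at this
    omega
  let B₁ := (Finset.range m).filter fun i => 4 * c < (L i).card
  let B₂ := (Y j).offDiag.biUnion fun p =>
    (Finset.range m).filter fun i => p.1 % modulus D i = p.2 % modulus D i
  have hB₁ : 2 * B₁.card < m := by
    have h1 : ∑ i ∈ B₁, (4 * c + 1) ≤ ∑ i ∈ Finset.range m, (L i).card :=
      (Finset.sum_le_sum fun i hi => (Finset.mem_filter.1 hi).2).trans
        (Finset.sum_le_sum_of_subset (Finset.filter_subset _ _))
    simp only [Finset.sum_const, smul_eq_mul] at h1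
    by_contra! hcon
    have h2 : m * (4 * c + 1) ≤ 2 * B₁.card * (4 * c + 1) := Nat.mul_le_mul_right _ hcon
    nlinarith
  have hB₂ : 2 * B₂.card ≤ m := by
    have h1 : B₂.card ≤ (Y j).offDiag.card * k := by
      refine Finset.card_biUnion_le_card_mul _ _ _ fun p hp => ?_
      simp only [Finset.mem_offDiag, Y, Finset.mem_filter, Finset.mem_range] at hp
      exact hD.card_le hp.1.1 hp.2.1.1 hp.2.2
    have h2 : (Y j).offDiag.card ≤ (Y j).card * (Y j).card := by
      rw [Finset.offDiag_card]; omega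
    have h3 : (Y j).offDiag.card * k ≤ (2 * c * (k + 1)) * (2 * c * (k + 1)) * (k + 1) :=
      Nat.mul_le_mul (h2.trans (Nat.mul_le_mul hYj hYj)) (Nat.le_succ k)
    have h4 : m = 2 * ((2 * c * (k + 1)) * (2 * c * (k + 1)) * (k + 1)) := by
      rw [hm, positions, copies]; ring
    omega
  obtain ⟨i, hi, hi₁, hi₂⟩ : ∃ i < m, i ∉ B₁ ∧ i ∉ B₂ := by
    by_contra! hcon
    have : Finset.range m ⊆ B₁ ∪ B₂ := fun i hi => by
      by_cases h : i ∈ B₁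
      · exact Finset.mem_union_left _ h
      · exact Finset.mem_union_right _ (hcon i (Finset.mem_range.1 hi) h)
    have h1 := Finset.card_le_card this
    have h2 := Finset.card_union_le B₁ B₂
    rw [Finset.card_range] at h1
    omega
  have hLi : (L i).card ≤ 4 * c := by
    by_contra! hcon
    exact hi₁ (Finset.mem_filter.2 ⟨Finset.mem_range.2 hi, hcon⟩)
  have hinj : ∀ s ∈ Y j, ∀ s' ∈ Y j, s % modulus D i = s' % modulus D i → s = s' := by
    intro s hs s' hs' heq
    by_contra hne
    exact hi₂ (Finset.mem_biUnion.2 ⟨(s, s'), Finset.mem_offDiag.2 ⟨hs, hs', hne⟩,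
      Finset.mem_filter.2 ⟨Finset.mem_range.2 hi, heq⟩⟩)
  -- an element of the original instance that is not covered with the label `b`
  have hu : ∀ b, ∃ u < Γ.numU, ∀ s ∈ Y j, (∃ r < k, b % modulus D (m + r) = s % modulus D i) →
      ¬ Γ.Adj s u := by
    intro b
    let N : Finset (Fin Γ.numS) := Finset.univ.filter fun s : Fin Γ.numS =>
      (s : ℕ) ∈ Y j ∧ ∃ r < k, b % modulus D (m + r) = s % modulus D i
    have hN : N.card ≤ k := by
      have : N.card ≤ ((Finset.range k).image fun r => b % modulus D (m + r)).card := by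
        refine Finset.card_le_card_of_injOn (fun s : Fin Γ.numS => (s : ℕ) % modulus D i) ?_ ?_
        · intro s hs
          obtain ⟨r, hr, h⟩ := (Finset.mem_filter.1 hs).2.2
          exact Finset.mem_image.2 ⟨r, Finset.mem_range.2 hr, h⟩
        · intro s hs s' hs' heq
          exact Fin.ext (hinj s (Finset.mem_filter.1 hs).2.1 s' (Finset.mem_filter.1 hs').2.1 heq)
      exact this.trans (Finset.card_image_le.trans (by simp))
    have hNc : ¬ Γ.IsCover N := fun hc => h ((Γ.opt_le_iff k).2 ⟨N, hc, hN⟩)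
    simp only [Instance.IsCover, not_forall, not_exists, not_and] at hNc
    obtain ⟨u, hu⟩ := hNc
    refine ⟨u, u.2, fun s hs hr => ?_⟩
    rintro ⟨hs', hu', hadj⟩
    exact hu ⟨s, hs'⟩ (Finset.mem_filter.2 ⟨Finset.mem_univ _, hs, hr⟩) hadj
  choose uf hufU huf using hu
  let bf : ℕ → ℕ := fun p => ((L i).toList[p]?).getD 0
  have hbf : ∀ p, bf p < V := by
    intro p
    by_cases hp : p < (L i).toList.length
    · have : (L i).toList[p] ∈ L i := Finset.mem_toList.1 (List.getElem_mem hp)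
      simp only [bf, List.getElem?_eq_getElem hp, Option.getD_some]
      exact Finset.mem_range.1 (Finset.mem_filter.1 this).1
    · simp only [bf, List.getElem?_eq_none (not_lt.1 hp), Option.getD_none]
      exact hV0
  obtain ⟨u, hu, hud⟩ := exists_digit_eq (V := V) (2 + 8 * c)
    (fun r => if r = 0 then i else if r = 1 then j else
      if r % 2 = 0 then bf ((r - 2) / 2) else uf (bf ((r - 3) / 2)))
    (fun r => by
      split_ifs
      · omega
      · omega
      · exact hbf _
      · exact (hufU _).trans_le hU)
  have hd0 : digit V u 0 = i := by rw [hud 0 (by omega)]; simp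
  have hd1 : digit V u 1 = j := by rw [hud 1 (by omega)]; simp
  have hdb : ∀ p < 4 * c, digit V u (2 + 2 * p) = bf p := by
    intro p hp
    rw [hud _ (by omega), if_neg (by omega), if_neg (by omega), if_pos (by omega)]
    congr 1
    omega
  have hdu : ∀ p < 4 * c, digit V u (3 + 2 * p) = uf (bf p) := by
    intro p hp
    rw [hud _ (by omega), if_neg (by omega), if_neg (by omega), if_neg (by omega)]
    congr 2
    omega
  obtain ⟨s, hsX, hs⟩ := hX ⟨u, hu⟩
  have hsX' : (s : ℕ) ∈ X' := Finset.mem_image.2 ⟨s, hsX, rfl⟩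
  have hs2 := digit_one_mul_add_digit_zero s.2
  have hdig0 := digit_lt hV0 s 0
  rcases bval_eq_true.1 hs with (h1 | h1 | ⟨p, hp, h1⟩) | ⟨-, h1, h2⟩ | ⟨h1, p, hp, h2, h3⟩
  · rw [hd0] at h1; omega
  · rw [hd1] at h1; omega
  · rw [hdu p hp] at h1
    have := hufU (bf p)
    omega
  · rw [hd0] at h1
    rw [h1] at hs2
    have hmem : digit V s 0 ∈ L i :=
      Finset.mem_filter.2 ⟨Finset.mem_range.2 hdig0, by rwa [hs2]⟩
    obtain ⟨p, hp, hp'⟩ := List.getElem_of_mem (Finset.mem_toList.2 hmem)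
    have hp4 : p < 4 * c := lt_of_lt_of_le (by simpa using hp) hLi
    refine h2 ⟨p, hp4, ?_⟩
    rw [hdb p hp4, ← hp']
    simp [bf, List.getElem?_eq_getElem hp]
  · rw [hd1] at h1
    rw [h1] at hs2
    rw [hdu p hp] at h2
    rw [hdb p hp, hd0] at h3
    refine huf (bf p) (digit V s 0) ?_ h3 h2
    exact Finset.mem_filter.2 ⟨Finset.mem_range.2 h2.1, by rwa [hs2]⟩

end ParamSetCover

namespace ParamSetCover

open Function (update update_self update_of_ne update_idem)

/-! ### The reduction as a formula -/

/-- All variables of a term have an index below `l`. -/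
def Tm.Below (l : ℕ) : Tm → Prop
  | .var i => i < l
  | .const _ => True
  | .add t u => t.Below l ∧ u.Below l
  | .mul t u => t.Below l ∧ u.Below l

namespace Tm

@[simp] theorem below_var {l i : ℕ} : (var i).Below l ↔ i < l := Iff.rfl
@[simp] theorem below_const {l c : ℕ} : (const c).Below l := trivial
@[simp] theorem below_add {l : ℕ} {t u : Tm} : (t + u).Below l ↔ t.Below l ∧ u.Below l := Iff.rfl
@[simp] theorem below_mul {l : ℕ} {t u : Tm} : (t * u).Below l ↔ t.Below l ∧ u.Below l := Iff.rfl

theorem below_pow {l : ℕ} {t : Tm} (h : t.Below l) (n : ℕ) : (t.pow n).Below l := by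
  induction n with
  | zero => trivial
  | succ n ih => exact ⟨ih, h⟩

theorem eval_update {l i : ℕ} {t : Tm} (h : t.Below l) (hi : l ≤ i) (e : ℕ → ℕ) (v : ℕ) :
    t.eval (update e i v) = t.eval e := by
  induction t with
  | var j =>
    have : j < l := h
    exact update_of_ne (by omega) _ _
  | const c => rfl
  | add t u iht ihu => exact congrArg₂ (· + ·) (iht h.1) (ihu h.2)
  | mul t u iht ihu => exact congrArg₂ (· * ·) (iht h.1) (ihu h.2)

end Tm

namespace Fm

open Tm

variable {o : Bool → List Bool} {l : ℕ} {e : ℕ → ℕ}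

@[simp] theorem sat_lt {t u : Tm} : (lt t u).Sat o l e ↔ t.eval e < u.eval e := Iff.rfl
@[simp] theorem sat_bit {a : Bool} {t : Tm} :
    (bit a t).Sat o l e ↔ (o a)[t.eval e]? = some true := Iff.rfl
@[simp] theorem sat_neg {φ : Fm} : (neg φ).Sat o l e ↔ ¬ φ.Sat o l e := Iff.rfl
@[simp] theorem sat_and {φ ψ : Fm} : (and φ ψ).Sat o l e ↔ φ.Sat o l e ∧ ψ.Sat o l e := Iff.rfl
@[simp] theorem sat_ex {t : Tm} {φ : Fm} :
    (ex t φ).Sat o l e ↔ ∃ v < t.eval e, φ.Sat o (l + 1) (update e l v) := Iff.rfl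

/-- Disjunction. -/
def or (φ ψ : Fm) : Fm := neg (and (neg φ) (neg ψ))

@[simp] theorem sat_or {φ ψ : Fm} : (or φ ψ).Sat o l e ↔ φ.Sat o l e ∨ ψ.Sat o l e := by
  simp only [or, sat_neg, sat_and]; tauto

/-- Bounded universal quantification. -/
def all (t : Tm) (φ : Fm) : Fm := neg (ex t (neg φ))

@[simp] theorem sat_all {t : Tm} {φ : Fm} :
    (all t φ).Sat o l e ↔ ∀ v < t.eval e, φ.Sat o (l + 1) (update e l v) := by
  simp [all]

/-- `t ≤ u` -/
def le (t u : Tm) : Fm := neg (lt u t)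

@[simp] theorem sat_le {t u : Tm} : (le t u).Sat o l e ↔ t.eval e ≤ u.eval e := by
  simp [le]

/-- `t = u` -/
def eq (t u : Tm) : Fm := and (le t u) (le u t)

@[simp] theorem sat_eq {t u : Tm} : (eq t u).Sat o l e ↔ t.eval e = u.eval e := by
  simp only [eq, sat_and, sat_le]; omega

/-- The disjunction of `f p` for `p < n`. -/
def orRange : ℕ → (ℕ → Fm) → Fm
  | 0, _ => lt (const 0) (const 0)
  | n + 1, f => or (orRange n f) (f n)

@[simp] theorem sat_orRange {n : ℕ} {f : ℕ → Fm} :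
    (orRange n f).Sat o l e ↔ ∃ p < n, (f p).Sat o l e := by
  induction n with
  | zero => simp [orRange]
  | succ n ih =>
    simp only [orRange, sat_or, ih]
    constructor
    · rintro (⟨p, hp, h⟩ | h)
      · exact ⟨p, by omega, h⟩
      · exact ⟨n, by omega, h⟩
    · rintro ⟨p, hp, h⟩
      rcases Nat.lt_succ_iff_lt_or_eq.1 hp with hp | rfl
      · exact Or.inl ⟨p, hp, h⟩
      · exact Or.inr h

/-- `t` divides `u`, at level `l`. -/
def dvd (l : ℕ) (t u : Tm) : Fm := ex (u + const 1) (eq u (t * var l))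

theorem sat_dvd {t u : Tm} (ht : t.Below l) (hu : u.Below l) :
    (dvd l t u).Sat o l e ↔ t.eval e ∣ u.eval e := by
  simp only [dvd, sat_ex, sat_eq, eval_mul, eval_update hu le_rfl, eval_update ht le_rfl,
    eval_var, update_self, eval_add, eval_const]
  constructor
  · rintro ⟨v, -, h⟩
    exact ⟨v, h⟩
  · rintro ⟨v, h⟩
    rcases Nat.eq_zero_or_pos (t.eval e) with h0 | h0
    · exact ⟨0, by omega, by simp [h, h0]⟩
    · refine ⟨v, ?_, h⟩
      have := Nat.le_mul_of_pos_left v h0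
      omega

/-- The remainders of `t` modulo `u` and of `t'` modulo `u'` agree, at level `l`. -/
def modEq (l : ℕ) (t u t' u' : Tm) : Fm :=
  ex u <| and (lt (var l) u') <| and (ex (t + const 1) (eq t (u * var (l + 1) + var l)))
    (ex (t' + const 1) (eq t' (u' * var (l + 1) + var l)))

theorem exists_eq_mul_add {a b r : ℕ} (hr : r < b) :
    (∃ q < a + 1, a = b * q + r) ↔ a % b = r := by
  constructor
  · rintro ⟨q, -, rfl⟩
    rw [Nat.mul_add_mod, Nat.mod_eq_of_lt hr]
  · rintro rfl
    exact ⟨a / b, Nat.lt_succ_of_le (Nat.div_le_self a b), (Nat.div_add_mod a b).symm⟩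

theorem sat_modEq {t u t' u' : Tm} (ht : t.Below l) (hu : u.Below l) (ht' : t'.Below l)
    (hu' : u'.Below l) (h0 : 0 < u.eval e) (h0' : 0 < u'.eval e) :
    (modEq l t u t' u').Sat o l e ↔ t.eval e % u.eval e = t'.eval e % u'.eval e := by
  simp only [modEq, sat_ex, sat_and, sat_lt, sat_eq, eval_add, eval_mul, eval_const, eval_var,
    eval_update ht le_rfl, eval_update hu le_rfl, eval_update ht' le_rfl, eval_update hu' le_rfl,
    eval_update ht (Nat.le_succ l), eval_update hu (Nat.le_succ l), eval_update ht' (Nat.le_succ l),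
    eval_update hu' (Nat.le_succ l), update_self, update_of_ne (Nat.succ_ne_self l).symm]
  constructor
  · rintro ⟨r, hr, hr', h, h'⟩
    rw [(exists_eq_mul_add hr).1 h, (exists_eq_mul_add hr').1 h']
  · intro h
    have h1 := Nat.mod_lt (t.eval e) h0
    have h2 := Nat.mod_lt (t'.eval e) h0'
    refine ⟨_, h1, h ▸ h2, (exists_eq_mul_add h1).2 rfl, (exists_eq_mul_add (h ▸ h2)).2 h.symm⟩

/-- Bind the variable `l` to the digit `r` of `t` in base `u`, at level `l`. -/
def letDigit (l : ℕ) (u t : Tm) (r : ℕ) (φ : Fm) : Fm :=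
  ex u <| and (ex (t + const 1) <| ex (u.pow r) <|
    eq t ((u * var (l + 1) + var l) * u.pow r + var (l + 2))) φ

theorem sat_letDigit {t u : Tm} {r : ℕ} {φ : Fm} (ht : t.Below l) (hu : u.Below l)
    (h0 : 0 < u.eval e) : (letDigit l u t r φ).Sat o l e ↔
      φ.Sat o (l + 1) (update e l (digit (u.eval e) (t.eval e) r)) := by
  have hp := below_pow hu r
  simp only [letDigit, sat_ex, sat_and, sat_eq, eval_add, eval_mul, eval_const, eval_var,
    eval_update ht le_rfl, eval_update hu le_rfl,
    eval_update ht (Nat.le_succ l), eval_update hu (Nat.le_succ l),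
    eval_update ht (by omega : l ≤ l + 1 + 1), eval_update hu (by omega : l ≤ l + 1 + 1), eval_pow,
    update_self, update_of_ne (by omega : l ≠ l + 1), update_of_ne (by omega : l ≠ l + 1 + 1),
    update_of_ne (by omega : l + 1 ≠ l + 1 + 1)]
  have key : ∀ v < u.eval e, (∃ w < t.eval e + 1, ∃ w' < u.eval e ^ r,
      t.eval e = (u.eval e * w + v) * u.eval e ^ r + w') ↔ v = digit (u.eval e) (t.eval e) r := by
    intro v hv
    have hpos : 0 < u.eval e ^ r := Nat.pow_pos h0
    constructor
    · rintro ⟨w, -, w', hw', h⟩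
      rw [digit, h, mul_comm _ (u.eval e ^ r), Nat.mul_add_div hpos, Nat.div_eq_of_lt hw', add_zero,
        Nat.mul_add_mod, Nat.mod_eq_of_lt hv]
    · rintro rfl
      refine ⟨t.eval e / u.eval e ^ r / u.eval e, ?_, t.eval e % u.eval e ^ r,
        Nat.mod_lt _ hpos, ?_⟩
      · exact Nat.lt_succ_of_le ((Nat.div_le_self _ _).trans (Nat.div_le_self _ _))
      · rw [digit, Nat.div_add_mod, Nat.div_add_mod']
  constructor
  · rintro ⟨v, hv, h, hφ⟩
    rwa [(key v hv).1 h] at hφ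
  · intro hφ
    exact ⟨_, digit_lt h0 _ _, (key _ (digit_lt h0 _ _)).2 rfl, hφ⟩

end Fm

open Tm Fm

/-- The term for `copies`. -/
def copiesTm (c : ℕ) : Tm := const (8 * c ^ 2) * (var 0 + const 1).pow 2
/-- The term for `positions`. -/
def positionsTm (c : ℕ) : Tm := copiesTm c * (var 0 + const 1)
/-- The term for `modulus`. -/
def modulusTm (D i : Tm) : Tm := const 1 + (i + const 1) * D

@[simp] theorem eval_copiesTm (c : ℕ) (e : ℕ → ℕ) : (copiesTm c).eval e = copies c (e 0) := by
  simp [copiesTm, copies]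
@[simp] theorem eval_positionsTm (c : ℕ) (e : ℕ → ℕ) :
    (positionsTm c).eval e = positions c (e 0) := by
  simp [positionsTm, positions]
@[simp] theorem eval_modulusTm (D i : Tm) (e : ℕ → ℕ) :
    (modulusTm D i).eval e = modulus (D.eval e) (i.eval e) := by
  simp [modulusTm, modulus]

theorem below_positionsTm (c : ℕ) {l : ℕ} (hl : 0 < l) : (positionsTm c).Below l := by
  have : (var 0 + const 1).Below l := by simpa using hl
  simp [positionsTm, copiesTm, below_pow this, hl]

theorem below_modulusTm {D i : Tm} {l : ℕ} (hD : D.Below l) (hi : i.Below l) :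
    (modulusTm D i).Below l := by
  simp [modulusTm, hD, hi]

/-- The formula for `GoodModuli` at level `l`. Here and below, the variables `0`, `1`, `2`, `3` are
the parameter, the sizes of the two sides of the instance, and the base. -/
def goodFm (c l : ℕ) (D : Tm) : Fm :=
  .and (all (positionsTm c + var 0) (Fm.dvd (l + 1) (var l + const 1) D)) <|
  .and (.neg (.ex (var 1) (all (var 0 + const 1)
    (Fm.dvd (l + 2) (modulusTm D (var (l + 1))) (var l + const 1)))))
  (.ex (var 3) (.and (.lt (const 0) (var l)) (all (var 0)
    (Fm.dvd (l + 2) (modulusTm D (positionsTm c + var (l + 1))) (var l)))))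

theorem sat_goodFm {o : Bool → List Bool} {c l : ℕ} {e : ℕ → ℕ} {D : Tm} (hl : 3 < l)
    (hD : D.Below l) : (goodFm c l D).Sat o l e ↔
      GoodModuli (e 0) (e 1) (positions c (e 0)) (e 3) (D.eval e) := by
  have hD' : ∀ i, D.Below (l + i) := fun i => by
    clear hl
    induction D with
    | var j => exact Nat.lt_add_right i hD
    | const c => trivial
    | add t u iht ihu => exact ⟨iht hD.1, ihu hD.2⟩
    | mul t u iht ihu => exact ⟨iht hD.1, ihu hD.2⟩
  have h1 : ∀ v, (Fm.dvd (l + 1) (var l + const 1) D).Sat o (l + 1) (update e l v) ↔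
      v + 1 ∣ D.eval e := by
    intro v
    rw [sat_dvd (by simp) (hD' 1), eval_update hD le_rfl]
    simp
  have h2 : ∀ b r, (Fm.dvd (l + 2) (modulusTm D (var (l + 1))) (var l + const 1)).Sat o (l + 2)
      (update (update e l b) (l + 1) r) ↔ modulus (D.eval e) r ∣ b + 1 := by
    intro b r
    rw [sat_dvd (below_modulusTm (hD' 2) (by simp)) (by simp)]
    simp [eval_update (hD' 1) le_rfl, eval_update hD le_rfl]
  have h3 : ∀ b r, (Fm.dvd (l + 2) (modulusTm D (positionsTm c + var (l + 1))) (var l)).Sat o (l + 2)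
      (update (update e l b) (l + 1) r) ↔
        modulus (D.eval e) (positions c (e 0) + r) ∣ b := by
    intro b r
    rw [sat_dvd (below_modulusTm (hD' 2) (by simp [below_positionsTm])) (by simp)]
    simp [eval_update (hD' 1) le_rfl, eval_update hD le_rfl, update_of_ne (by omega : (0 : ℕ) ≠ l)]
  simp only [goodFm, sat_and, sat_all, sat_neg, sat_ex, h1, sat_lt, eval_var, eval_add, eval_const,
    update_self, update_of_ne (by omega : (0 : ℕ) ≠ l), h2, h3, eval_positionsTm, GoodModuli]

/-- The formula at level `8` for adjacency in the gap instance, of the set and the element given by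
the variables `6` and `7`. -/
def edgeFm (c : ℕ) : Fm :=
  .ex (var 3) <| .and (.and (goodFm c 9 (var 8)) (all (var 8) (.neg (goodFm c 10 (var 9))))) <|
  letDigit 9 (var 3) (var 7) 0 <| letDigit 10 (var 3) (var 7) 1 <|
  letDigit 11 (var 3) (var 6) 1 <| letDigit 12 (var 3) (var 6) 0 <|
  .or (.or (le (positionsTm c) (var 9)) <| .or (le (copiesTm c) (var 10)) <|
    orRange (4 * c) fun p => letDigit 13 (var 3) (var 7) (3 + 2 * p) (le (var 2) (var 13))) <|
  .or (.and (.lt (var 11) (positionsTm c)) <| .and (.eq (var 11) (var 9)) <| .neg <|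
    orRange (4 * c) fun p => letDigit 13 (var 3) (var 7) (2 + 2 * p) (.eq (var 13) (var 12)))
  (.and (.eq (var 11) (positionsTm c + var 10)) <|
    orRange (4 * c) fun p => letDigit 13 (var 3) (var 7) (2 + 2 * p) <|
      letDigit 14 (var 3) (var 7) (3 + 2 * p) <|
      .and (.and (.lt (var 12) (var 1)) <| .and (.lt (var 14) (var 2)) <|
        .bit false (var 12 * var 2 + var 14)) <|
      .ex (var 0) <| modEq 16 (var 13) (modulusTm (var 8) (positionsTm c + var 15))
        (var 12) (modulusTm (var 8) (var 9)))

/-- The rows of the adjacency matrix one after the other. -/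
def Instance.matrix (Γ : Instance) : List Bool :=
  (List.ofFn fun s => List.ofFn fun u => Γ.adj s u).flatten

theorem Instance.matrix_eq (Γ : Instance) : Γ.matrix = List.ofFn
    fun i : Fin (Γ.numS * Γ.numU) => Γ.adj i.divNat i.modNat := by
  rw [List.ofFn_mul]
  unfold Instance.matrix
  congr 2
  funext s
  congr 1
  funext u
  have hU : 0 < Γ.numU := (Nat.zero_le _).trans_lt u.2
  congr 1 <;> ext
  · simp [Fin.divNat, mul_comm _ Γ.numU, Nat.mul_add_div hU, Nat.div_eq_of_lt u.2]
  · simp [Fin.modNat, Nat.mod_eq_of_lt u.2]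

theorem Instance.adj_iff_matrix (Γ : Instance) (s u : ℕ) :
    Γ.Adj s u ↔ s < Γ.numS ∧ u < Γ.numU ∧ Γ.matrix[s * Γ.numU + u]? = some true := by
  rw [Γ.matrix_eq]
  constructor
  · rintro ⟨hs, hu, h⟩
    refine ⟨hs, hu, ?_⟩
    have hlt : s * Γ.numU + u < Γ.numS * Γ.numU := by
      calc s * Γ.numU + u < s * Γ.numU + Γ.numU := by omega
        _ = (s + 1) * Γ.numU := by ring
        _ ≤ _ := Nat.mul_le_mul_right _ hs
    rw [List.getElem?_ofFn, dif_pos hlt, Option.some_inj, ← h]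
    have hU : 0 < Γ.numU := by omega
    congr 1 <;> ext
    · simp [Fin.divNat, mul_comm _ Γ.numU, Nat.mul_add_div hU, Nat.div_eq_of_lt hu]
    · simp [Fin.modNat, Nat.mod_eq_of_lt hu]
  · rintro ⟨hs, hu, h⟩
    refine ⟨hs, hu, ?_⟩
    rw [List.getElem?_ofFn] at h
    split_ifs at h with hlt
    rw [Option.some_inj] at h
    rw [← h]
    have hU : 0 < Γ.numU := by omega
    congr 1 <;> ext
    · simp [Fin.divNat, mul_comm _ Γ.numU, Nat.mul_add_div hU, Nat.div_eq_of_lt hu]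
    · simp [Fin.modNat, Nat.mod_eq_of_lt hu]

theorem sat_edgeFm {Γ : Instance} {o : Bool → List Bool} (ho : o false = Γ.matrix) {c : ℕ}
    {e : ℕ → ℕ} (h1 : e 1 = Γ.numS) (h2 : e 2 = Γ.numU) (h3 : 0 < e 3) :
    (edgeFm c).Sat o 8 e ↔ ∃ D < e 3, (GoodModuli (e 0) Γ.numS (positions c (e 0)) (e 3) D ∧
      ∀ D' < D, ¬ GoodModuli (e 0) Γ.numS (positions c (e 0)) (e 3) D') ∧
      GapAdj Γ c (e 0) (e 3) D (e 6) (e 7) := by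
  have hmod : ∀ D i, 0 < modulus D i := modulus_pos
  simp only [edgeFm, sat_ex, sat_and, eval_var]
  refine exists_congr fun D => and_congr_right fun hD => and_congr ?_ ?_
  · rw [sat_goodFm (by omega) (by simp), sat_all]
    refine and_congr (by simp [h1]) ?_
    refine forall_congr' fun D' => ?_
    rw [sat_neg, sat_goodFm (by omega) (by simp)]
    simp [h1]
  · rw [sat_letDigit (by simp) (by simp) (by simpa), sat_letDigit (by simp) (by simp) (by simpa),
      sat_letDigit (by simp) (by simp) (by simpa), sat_letDigit (by simp) (by simp) (by simpa)]
    simp only [sat_or, sat_le, sat_lt, sat_and, sat_eq, sat_neg, sat_orRange, GapAdj]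
    refine or_congr (or_congr (by simp) (or_congr (by simp) ?_)) (or_congr ?_ ?_)
    · refine exists_congr fun p => and_congr_right fun hp => ?_
      rw [sat_letDigit (by simp) (by simp) (by simpa)]
      simp [h2]
    · refine and_congr (by simp) (and_congr (by simp) (not_congr ?_))
      refine exists_congr fun p => and_congr_right fun hp => ?_
      rw [sat_letDigit (by simp) (by simp) (by simpa)]
      simp
    · refine and_congr (by simp) ?_
      refine exists_congr fun p => and_congr_right fun hp => ?_
      rw [sat_letDigit (by simp) (by simp) (by simpa), sat_letDigit (by simp) (by simp) (by simpa),
        sat_and, sat_ex]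
      refine and_congr ?_ ?_
      · rw [Γ.adj_iff_matrix, ← ho]
        simp [h1, h2]
      · refine exists_congr fun r => and_congr (by simp) ?_
        rw [sat_modEq (by simp) (below_modulusTm (by simp) (by simp [below_positionsTm])) (by simp)
          (below_modulusTm (by simp) (by simp)) (by simp [hmod]) (by simp [hmod])]
        simp

end ParamSetCover

namespace ParamSetCover

open Function (update update_self update_of_ne update_idem update_comm update_eq_self update_apply)

/-! ### Programs on pairs of an instance and a parameter -/

/-- The state in which the variables have the values `e` and the registers below `10` the contents
`g`. -/
def conf (e : ℕ → ℕ) (g : State) : State := fun r =>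
  if r < 10 then g r else if r % 2 = 0 then List.replicate (e ((r - 10) / 2)) true else []

@[simp] theorem conf_varReg (e : ℕ → ℕ) (g : State) (i : ℕ) :
    conf e g (varReg i) = List.replicate (e i) true := by
  simp [conf, varReg]

@[simp] theorem conf_auxReg (e : ℕ → ℕ) (g : State) (i : ℕ) : conf e g (auxReg i) = [] := by
  have : (2 * i + 11) % 2 = 1 := by omega
  simp [conf, auxReg, this]

theorem conf_of_lt (e : ℕ → ℕ) (g : State) {r : ℕ} (hr : r < 10) : conf e g r = g r := if_pos hr

theorem register_cases (r : ℕ) : r < 10 ∨ (∃ i, r = varReg i) ∨ ∃ i, r = auxReg i := by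
  by_cases h : r < 10
  · exact Or.inl h
  · rcases Nat.mod_two_eq_zero_or_one r with h' | h'
    · exact Or.inr (Or.inl ⟨(r - 10) / 2, by unfold varReg; omega⟩)
    · exact Or.inr (Or.inr ⟨(r - 11) / 2, by unfold auxReg; omega⟩)

theorem update_conf_var (e : ℕ → ℕ) (g : State) (i v : ℕ) :
    update (conf e g) (varReg i) (List.replicate v true) = conf (update e i v) g := by
  funext r
  rcases register_cases r with h | ⟨j, rfl⟩ | ⟨j, rfl⟩
  · simp [conf_of_lt, h]
  · by_cases hj : j = i
    · subst hj; simp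
    · simp [hj]
  · simp

theorem update_conf_of_lt (e : ℕ → ℕ) (g : State) {r : ℕ} (hr : r < 10) (l : List Bool) :
    update (conf e g) r l = conf e (update g r l) := by
  funext r'
  rcases register_cases r' with h | ⟨j, rfl⟩ | ⟨j, rfl⟩
  · by_cases hr' : r' = r
    · subst hr'; simp [conf_of_lt, h]
    · simp [conf_of_lt, h, hr']
  · simp [hr]
  · simp [hr]

theorem conf_holds {e : ℕ → ℕ} {g : State} (hg : g 2 = []) : (conf e g).Holds e 0 :=
  ⟨fun i => conf_varReg e g i, fun i _ => conf_auxReg e g i, by rw [conf_of_lt _ _ (by omega), hg]⟩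

theorem single_eq_conf {r : ℕ} (hr : r < 10) (x : List Bool) :
    single r x = conf (fun _ => 0) (single r x) := by
  funext r'
  rcases register_cases r' with h | ⟨j, rfl⟩ | ⟨j, rfl⟩
  · rw [conf_of_lt _ _ h]
  · simp [single, hr]
  · simp [single, hr]

theorem conf_congr {e e' : ℕ → ℕ} {g g' : State} (he : ∀ i, e i = e' i)
    (hg : ∀ r < 10, g r = g' r) : conf e g = conf e' g' := by
  funext r
  rcases register_cases r with h | ⟨j, rfl⟩ | ⟨j, rfl⟩
  · rw [conf_of_lt _ _ h, conf_of_lt _ _ h, hg r h]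
  · simp [he]
  · simp

section

variable {M : Machine} {e : ℕ → ℕ} {g : State}

theorem Runs.push_conf {r : ℕ} (hr : r < 10) (b : Bool) :
    Runs M (.push r b) (conf e g) (conf e (update g r (b :: g r))) 1 := by
  have := Runs.push (M := M) (s := conf e g) (r := r) b
  rwa [update_conf_of_lt _ _ hr, conf_of_lt _ _ hr] at this

theorem Runs.push_conf_var {i : ℕ} :
    Runs M (.push (varReg i) true) (conf e g) (conf (update e i (e i + 1)) g) 1 := by
  have := Runs.push (M := M) (s := conf e g) (r := varReg i) true
  rwa [conf_varReg, ← List.replicate_succ, update_conf_var] at this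

theorem Runs.move_conf {r d : ℕ} (hr : r < 10) (hd : d < 10) (h : r ≠ d) :
    Runs M (.move r d) (conf e g) (conf e (update (update g r []) d ((g r).reverse ++ g d)))
      ((g r).length * 2 + 1) := by
  have := Runs.move (M := M) (s := conf e g) h
  rwa [update_conf_of_lt _ _ hr, update_conf_of_lt _ _ hd, conf_of_lt _ _ hr,
    conf_of_lt _ _ hd] at this

theorem Runs.clear_conf {r : ℕ} (hr : r < 10) :
    Runs M (.clear r) (conf e g) (conf e (update g r [])) ((g r).length * 2 + 1) := by
  have := Runs.clear (M := M) (s := conf e g) (r := r)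
  rwa [update_conf_of_lt _ _ hr, conf_of_lt _ _ hr] at this

theorem Runs.clear_conf_var {i : ℕ} :
    Runs M (.clear (varReg i)) (conf e g) (conf (update e i 0) g) (e i * 2 + 1) := by
  have := Runs.clear (M := M) (s := conf e g) (r := varReg i)
  rwa [conf_varReg, List.length_replicate, ← List.replicate_zero, update_conf_var] at this

/-- Read a number in unary from the input. -/
def Prog.readUnary (i : ℕ) : Prog := .scan 0 (.push (varReg i) true)

theorem Runs.readUnary {i a : ℕ} {x : List Bool} (hg : g 0 = List.replicate a true ++ false :: x) :
    Runs M (.readUnary i) (conf e g) (conf (update e i (e i + a)) (update g 0 x)) (a * 2 + 1) := by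
  induction a generalizing e g with
  | zero =>
    have h0 : conf e g 0 = false :: x := by rw [conf_of_lt _ _ (by omega), hg]; rfl
    refine ⟨1, by simp, ?_⟩
    have := Run.scan_false (M := M) (q := .push (varReg i) true) h0
    rw [update_conf_of_lt _ _ (by omega)] at this
    simpa [Prog.readUnary] using this
  | succ a ih =>
    have h0 : conf e g 0 = true :: (List.replicate a true ++ false :: x) := by
      rw [conf_of_lt _ _ (by omega), hg]; rfl
    have h1 := Runs.push_conf_var (M := M) (e := e)
      (g := update g 0 (List.replicate a true ++ false :: x)) (i := i)
    have h2 := ih (e := update e i (e i + 1))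
      (g := update g 0 (List.replicate a true ++ false :: x)) (update_self _ _ _)
    rw [← update_conf_of_lt _ _ (by omega)] at h1
    rw [update_self, update_idem, update_idem, add_assoc, add_comm 1 a] at h2
    obtain ⟨t1, ht1, h1⟩ := h1
    obtain ⟨t2, ht2, h2⟩ := h2
    exact ⟨t1 + t2 + 1, by omega, Run.scan_true h0 h1 h2⟩

/-- Read an instance and a parameter: the parameter and the sizes of the two sides become the values
of the variables `0`, `1` and `2`, and the adjacency matrix goes to the register `4`. -/
def Prog.readInput : Prog :=
  .seq (.readUnary 0) <| .seq (.readUnary 1) <| .seq (.readUnary 2) <| .seq (.move 0 2) (.move 2 4)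

/-- The values of the variables after an instance and a parameter have been read. -/
def inputVars (Γ : Instance) (k : ℕ) : ℕ → ℕ :=
  update (update (update (fun _ => 0) 0 k) 1 Γ.numS) 2 Γ.numU

theorem encode_eq (Γ : Instance) (k : ℕ) : encode (Γ, k) = List.replicate k true ++ false ::
    (List.replicate Γ.numS true ++ false :: (List.replicate Γ.numU true ++ false :: Γ.matrix)) :=
  rfl

theorem length_encode (Γ : Instance) (k : ℕ) :
    (encode (Γ, k)).length = k + Γ.numS + Γ.numU + Γ.matrix.length + 3 := by
  rw [encode_eq]
  simp
  omega

theorem Runs.readInput {Γ : Instance} {k : ℕ} (h0 : g 0 = encode (Γ, k)) (h2 : g 2 = [])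
    (h4 : g 4 = []) : Runs M .readInput (conf (fun _ => 0) g)
      (conf (inputVars Γ k) (update (update g 0 []) 4 Γ.matrix)) ((encode (Γ, k)).length * 4 + 5) := by
  have h1 := Runs.readUnary (M := M) (e := fun _ => 0) (i := 0) (h0.trans (encode_eq Γ k))
  have h2' := Runs.readUnary (M := M) (e := update (fun _ => 0) 0 k) (i := 1)
    (g := update g 0 (List.replicate Γ.numS true ++
      false :: (List.replicate Γ.numU true ++ false :: Γ.matrix))) (update_self _ _ _)
  have h3 := Runs.readUnary (M := M) (e := update (update (fun _ => 0) 0 k) 1 Γ.numS) (i := 2)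
    (g := update g 0 (List.replicate Γ.numU true ++ false :: Γ.matrix)) (update_self _ _ _)
  have h4' := Runs.move_conf (M := M) (e := inputVars Γ k) (g := update g 0 Γ.matrix) (r := 0)
    (d := 2) (by omega) (by omega) (by omega)
  have h5 := Runs.move_conf (M := M) (e := inputVars Γ k)
    (g := update (update g 0 []) 2 Γ.matrix.reverse) (r := 2)
    (d := 4) (by omega) (by omega) (by omega)
  simp only [update_idem, zero_add, update_self, update_of_ne (by omega : (1 : ℕ) ≠ 0),
    update_of_ne (by omega : (2 : ℕ) ≠ 0), update_of_ne (by omega : (2 : ℕ) ≠ 1), h2,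
    List.append_nil, List.reverse_reverse] at h1 h2' h3 h4' h5
  refine ((h1.seq (h2'.seq (h3.seq (h4'.seq h5)))).congr ?_).mono ?_
  · refine conf_congr (fun _ => rfl) fun r hr => ?_
    interval_cases r <;> simp [h2, h4]
  · rw [length_encode]
    simp only [List.length_reverse]
    omega

/-- Push the value of a term in unary to a register. -/
def Prog.pushTm (t : Tm) (r : ℕ) : Prog := .seq (t.prog 1 0) (.move (auxReg 0) r)

/-- A bound for the time needed by `pushTm`. -/
def pushCost (t : Tm) (W : ℕ) : ℕ := t.cost W + (t.bound W * 2 + 1)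

theorem polyBdd_pushCost (t : Tm) : PolyBdd (pushCost t) :=
  t.polyBdd_cost.add ((t.polyBdd_bound.mul (.const 2)).add (.const 1))

theorem Runs.pushTm_aux {W : ℕ} (he : ∀ i, e i ≤ W) (hg : g 2 = []) (t : Tm) {r : ℕ}
    (hr : r ≠ auxReg 0) : Runs M (.pushTm t r) (conf e g)
      (update (conf e g) r (List.replicate (t.eval e) true ++ conf e g r)) (pushCost t W) := by
  have h1 := t.runs_prog M he (j := 1) (d := 0) (by omega) ((conf_holds (e := e) hg).mono (by omega))
  rw [conf_auxReg, List.append_nil] at h1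
  refine ((h1.seq (Runs.move hr.symm)).congr ?_).mono ?_
  · rw [update_self, update_idem, update_of_ne hr, List.reverse_replicate]
    congr 1
    rw [Function.update_eq_self_iff]
    simp
  · have := t.eval_le_bound he
    simp only [update_self, List.length_replicate, pushCost]
    omega

theorem Runs.pushTm {W : ℕ} (he : ∀ i, e i ≤ W) (hg : g 2 = []) (t : Tm) {r : ℕ} (hr : r < 10) :
    Runs M (.pushTm t r) (conf e g)
      (conf e (update g r (List.replicate (t.eval e) true ++ g r))) (pushCost t W) := by
  have := Runs.pushTm_aux (M := M) he hg t (r := r) (by simp [hr])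
  rwa [update_conf_of_lt _ _ hr, conf_of_lt _ _ hr] at this

theorem Runs.pushTm_var {W : ℕ} (he : ∀ i, e i ≤ W) (hg : g 2 = []) (t : Tm) {i : ℕ} (hi : e i = 0) :
    Runs M (.pushTm t (varReg i)) (conf e g) (conf (update e i (t.eval e)) g) (pushCost t W) := by
  have := Runs.pushTm_aux (M := M) he hg t (r := varReg i) (by simp)
  rw [conf_varReg, hi, List.replicate_zero, List.append_nil, update_conf_var] at this
  exact this

/-- Replace the value `a` of the variable `i` by `2 ^ a`, using the variable `j`. -/
def Prog.exp (i j : ℕ) : Prog := .seq (.push (varReg j) true) <|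
  .seq (.loop (varReg i) .skip (.seq (.move (varReg j) 2)
    (.loop 2 .skip (.seq (.push (varReg j) true) (.push (varReg j) true))))) <|
  .move (varReg j) (varReg i)

theorem Runs.exp {i j : ℕ} (hij : i ≠ j) (hg : g 2 = []) (hj : e j = 0) {W : ℕ}
    (hW : 2 ^ e i ≤ W) : Runs M (.exp i j) (conf e g) (conf (update e i (2 ^ e i)) g)
      (W * (W * 5 + 4) + W * 2 + 3) := by
  have hle : e i ≤ 2 ^ e i := Nat.lt_two_pow_self.le
  have h1 := Runs.push_conf_var (M := M) (e := e) (g := g) (i := j)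
  rw [hj, zero_add] at h1
  have h2 := Runs.loop_unary (M := M) (r := varReg i) (q₀ := .skip)
    (q₁ := .seq (.move (varReg j) 2)
      (.loop 2 .skip (.seq (.push (varReg j) true) (.push (varReg j) true))))
    (T := W * 2 + 1 + (W * 3 + 1))
    (fun v w => conf (update (update e j (2 ^ (min w (e i)))) i v) g) (e i)
    (fun v w => by simp)
    (by
      intro v w hvw
      have hw : 2 ^ w ≤ W := (Nat.pow_le_pow_right two_pos (by omega)).trans hW
      rw [update_conf_var, update_idem, Nat.min_eq_left (by omega), Nat.min_eq_left (by omega)]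
      have h3 : Runs M (.move (varReg j) 2) (conf (update (update e j (2 ^ w)) i v) g)
          (conf (update (update e j 0) i v) (update g 2 (List.replicate (2 ^ w) true)))
          (W * 2 + 1) := by
        refine ((Runs.move (by simp)).congr ?_).mono ?_
        · rw [conf_varReg, conf_of_lt _ _ (by omega), hg, update_of_ne hij.symm, update_self,
            List.append_nil, List.reverse_replicate, ← List.replicate_zero, update_conf_var,
            update_conf_of_lt _ _ (by omega), update_comm hij, update_idem]
        · rw [conf_varReg, List.length_replicate, update_of_ne hij.symm, update_self]
          omega
      have h4 := Runs.loop_unary (M := M) (r := 2) (q₀ := .skip)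
        (q₁ := .seq (.push (varReg j) true) (.push (varReg j) true)) (T := 2)
        (fun a b => conf (update (update e j (2 * b)) i v) (update g 2 (List.replicate a true)))
        (2 ^ w) (fun a b => by rw [conf_of_lt _ _ (by omega), update_self])
        (by
          intro a b _
          rw [update_conf_of_lt _ _ (by omega), update_idem]
          refine (Runs.push_conf_var.seq Runs.push_conf_var).congr ?_
          rw [update_self, update_idem, update_of_ne hij.symm, update_self, update_comm hij,
            update_idem]
          rfl)
      rw [List.replicate_zero, ← hg, update_eq_self, mul_zero, ← pow_succ'] at h4
      refine (h3.seq h4).mono ?_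
      omega)
  rw [Nat.min_eq_left (Nat.zero_le _), pow_zero, Nat.min_self] at h2
  have e1 : update (update e j 1) i (e i) = update e j 1 := by
    rw [Function.update_eq_self_iff, update_of_ne hij]
  rw [e1] at h2
  have h5 : Runs M (.move (varReg j) (varReg i)) (conf (update (update e j (2 ^ e i)) i 0) g)
      (conf (update e i (2 ^ e i)) g) (W * 2 + 1) := by
    refine ((Runs.move (by simpa using hij.symm)).congr ?_).mono ?_
    · rw [conf_varReg, conf_varReg, update_self, update_of_ne hij.symm, update_self,
        List.reverse_replicate, List.replicate_zero, List.append_nil, ← List.replicate_zero,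
        update_conf_var, update_conf_var]
      refine conf_congr (fun a => ?_) fun _ _ => rfl
      by_cases ha : a = i
      · subst ha; rw [update_self, update_self]
      by_cases hb : a = j
      · subst hb; rw [update_of_ne ha, update_self, update_of_ne ha, hj]
      rw [update_of_ne ha, update_of_ne hb, update_of_ne ha, update_of_ne hb, update_of_ne ha]
    · rw [conf_varReg, List.length_replicate, update_of_ne hij.symm, update_self]
      omega
  refine (h1.seq (h2.seq h5)).mono ?_
  have h6 : e i * (W * 2 + 1 + (W * 3 + 1) + 1 + 1) ≤ W * (W * 5 + 4) :=
    Nat.mul_le_mul (hle.trans hW) (by omega)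
  have : e i * (W * 2 + 1 + (W * 3 + 1) + 1) + e i ≤ W * (W * 5 + 4) := by
    linarith
  omega

end

end ParamSetCover

namespace ParamSetCover

open Function (update update_self update_of_ne update_idem update_comm update_eq_self update_apply)

/-! ### Time bounds -/

/-- A function of the parameter and the length of the input that is bounded as required of the
running time of an FPT algorithm. -/
def FPTBdd (T : ℕ → ℕ → ℕ) : Prop :=
  ∃ (f : ℕ → ℕ) (d : ℕ), Computable f ∧ ∀ k L, T k L ≤ f k * (L + 1) ^ d

namespace FPTBdd

variable {T T' : ℕ → ℕ → ℕ}

theorem param {f : ℕ → ℕ} (hf : Computable f) : FPTBdd fun k _ => f k :=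
  ⟨f, 0, hf, fun k L => by simp⟩

theorem const (a : ℕ) : FPTBdd fun _ _ => a := param (Computable.const a)

theorem length : FPTBdd fun _ L => L := ⟨fun _ => 1, 1, Computable.const 1, fun k L => by simp⟩

theorem add (h : FPTBdd T) (h' : FPTBdd T') : FPTBdd fun k L => T k L + T' k L := by
  obtain ⟨f, d, hf, h⟩ := h
  obtain ⟨f', d', hf', h'⟩ := h'
  refine ⟨fun k => f k + f' k, d + d', Primrec.nat_add.to_comp.comp hf hf',
    fun k L => (add_le_add (h k L) (h' k L)).trans ?_⟩
  rw [add_mul]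
  gcongr <;> omega

theorem mul (h : FPTBdd T) (h' : FPTBdd T') : FPTBdd fun k L => T k L * T' k L := by
  obtain ⟨f, d, hf, h⟩ := h
  obtain ⟨f', d', hf', h'⟩ := h'
  refine ⟨fun k => f k * f' k, d + d', Primrec.nat_mul.to_comp.comp hf hf',
    fun k L => (Nat.mul_le_mul (h k L) (h' k L)).trans (le_of_eq ?_)⟩
  ring

theorem pow (h : FPTBdd T) (n : ℕ) : FPTBdd fun k L => T k L ^ n := by
  induction n with
  | zero => simpa using const 1
  | succ n ih => simpa [pow_succ] using ih.mul h

theorem polyBdd {P : ℕ → ℕ} (hP : PolyBdd P) (h : FPTBdd T) : FPTBdd fun k L => P (T k L) := by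
  obtain ⟨C, d, hP⟩ := hP
  obtain ⟨f, d', hf, h'⟩ := (const C).mul ((h.add (const 1)).pow d)
  exact ⟨f, d', hf, fun k L => (hP _).trans (h' k L)⟩

theorem exists_mul_pow (h : FPTBdd T) :
    ∃ (f : ℕ → ℕ) (d : ℕ), Computable f ∧ ∀ k L, 0 < L → T k L ≤ f k * L ^ d := by
  obtain ⟨f, d, hf, h⟩ := h
  refine ⟨fun k => f k * 2 ^ d, d, Primrec.nat_mul.to_comp.comp hf (Computable.const _),
    fun k L hL => (h k L).trans ?_⟩
  rw [mul_assoc, ← mul_pow]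
  gcongr
  omega

end FPTBdd

theorem Machine.HaltsWithin.mono {M : Machine} {x y : List Bool} {t t' : ℕ}
    (h : M.HaltsWithin x y t) (ht : t ≤ t') : M.HaltsWithin x y t' := by
  obtain ⟨⟨h, hn⟩⟩ := h
  exact ⟨⟨h, hn.trans ht⟩⟩

theorem Runs.haltsWithin {M : Machine} {p : Prog} {x y : List Bool} {T : ℕ}
    (h : Runs M p (single 0 x) (single 1 y) T) : (p.machine M).HaltsWithin x y (T + 1) := by
  obtain ⟨t, ht, h⟩ := h
  exact h.haltsWithin.mono (by omega)

theorem FPTBdd.hasFPTDecider {yes no : Instance → ℕ → Prop} {N : Machine} {T : ℕ → ℕ → ℕ}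
    (hT : FPTBdd T)
    (hyes : ∀ Γ k, yes Γ k →
      N.HaltsWithin (encode (Γ, k)) [true] (T k (encode (Γ, k)).length))
    (hno : ∀ Γ k, no Γ k →
      N.HaltsWithin (encode (Γ, k)) [false] (T k (encode (Γ, k)).length)) :
    HasFPTDecider yes no := by
  obtain ⟨f, d, hf, h⟩ := hT.exists_mul_pow
  have hpos : ∀ Γ k, 0 < (encode (Γ, k)).length := fun Γ k => by rw [length_encode]; omega
  exact ⟨N, f, d, hf, fun Γ k => ⟨fun hx => (hyes Γ k hx).mono (h _ _ (hpos Γ k)),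
    fun hx => (hno Γ k hx).mono (h _ _ (hpos Γ k))⟩⟩

section

variable {M : Machine} {e : ℕ → ℕ} {g : State}

theorem Runs.call_conf {a b : ℕ} (ha : a < 10) (hb : b < 10) (hba : b ≠ a) (hg : g b = [])
    {y : List Bool} {t : ℕ} (h : M.HaltsWithin (g a).reverse y t) :
    Runs M (.call a b) (conf e g) (conf e (update (update g a []) b y.reverse))
      ((g a).length + 1 + t + (y.length + 1)) := by
  refine ⟨_, le_rfl, ?_⟩
  have := Run.call (M := M) (s := conf e g) (a := a) (b := b) (y := y) (t := t)
    (by rwa [conf_of_lt _ _ ha])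
  rwa [conf_of_lt _ _ ha, update_conf_of_lt _ _ ha, update_conf_of_lt _ _ hb, conf_of_lt _ _ hb,
    update_of_ne hba, hg, List.append_nil] at this

theorem Runs.fm_conf {W n : ℕ} (he : ∀ i, e i ≤ W) (hn : ∀ i ≥ n, e i = 0) (hg : g 2 = [])
    (φ : Fm) : Runs M (φ.prog n) (conf e g)
      (conf e (update g 3 (bval (φ.Sat (fun a => g (bitReg a)) n e) :: g 3))) (φ.cost W) := by
  have := φ.runs_prog M (fun a => g (bitReg a)) he hn (conf_holds (e := e) hg)
    fun a => conf_of_lt _ _ (by simp)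
  rwa [update_conf_of_lt _ _ (by omega), conf_of_lt _ _ (by omega)] at this

/-- Copy the bits of the register `r` to the register `d`, in reverse order. -/
def Prog.copy (r d : ℕ) : Prog :=
  .seq (.loop r (.seq (.push 2 false) (.push d false)) (.seq (.push 2 true) (.push d true)))
    (.move 2 r)

theorem Runs.copy_loop {r d : ℕ} (hr : r < 10) (hd : d < 10) (hrd : r ≠ d) (hr2 : r ≠ 2)
    (hd2 : d ≠ 2) (w : List Bool) : ∀ {g : State}, g r = w →
    Runs M (.loop r (.seq (.push 2 false) (.push d false)) (.seq (.push 2 true) (.push d true)))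
      (conf e g) (conf e (update (update (update g r []) 2 (w.reverse ++ g 2)) d
        (w.reverse ++ g d))) (w.length * 3 + 1) := by
  induction w with
  | nil =>
    intro g hg
    refine ((Runs.loop_nil (by rwa [conf_of_lt _ _ hr])).congr ?_).mono (by simp)
    rw [← hg, update_eq_self]
    simp [hg]
  | cons b w ih =>
    intro g hg
    have h1 : Runs M (cond b (.seq (.push 2 true) (.push d true))
        (.seq (.push 2 false) (.push d false))) (update (conf e g) r w)
        (conf e (update (update (update g r w) 2 (b :: g 2)) d (b :: g d))) 2 := by
      rw [update_conf_of_lt _ _ hr]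
      have := (Runs.push_conf (M := M) (e := e) (g := update g r w) (r := 2) (by omega) b).seq
        (Runs.push_conf hd b)
      rw [update_of_ne hr2.symm, update_of_ne hd2, update_of_ne hrd.symm] at this
      cases b <;> exact this
    have h2 := ih (g := update (update (update g r w) 2 (b :: g 2)) d (b :: g d))
      (by simp [hrd, hr2])
    refine ((Runs.loop_cons (by rw [conf_of_lt _ _ hr, hg]) h1 h2).congr ?_).mono ?_
    · congr 1
      funext i
      simp only [update_apply, List.reverse_cons, List.append_assoc, List.singleton_append]
      split_ifs <;> simp_all
    · simp only [List.length_cons]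
      omega

theorem Runs.copy {r d : ℕ} (hr : r < 10) (hd : d < 10) (hrd : r ≠ d) (hr2 : r ≠ 2) (hd2 : d ≠ 2)
    (hg : g 2 = []) : Runs M (.copy r d) (conf e g)
      (conf e (update g d ((g r).reverse ++ g d))) ((g r).length * 5 + 2) := by
  have h1 := Runs.copy_loop (M := M) (e := e) hr hd hrd hr2 hd2 (g r) rfl
  have h2 := Runs.move_conf (M := M) (e := e) (g := update (update (update g r []) 2
    ((g r).reverse ++ g 2)) d ((g r).reverse ++ g d)) (r := 2) (d := r) (by omega) hr hr2.symm
  refine ((h1.seq h2).congr ?_).mono ?_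
  · congr 1
    funext i
    simp only [update_apply]
    split_ifs <;> simp_all
  · rw [update_of_ne hd2.symm, update_self, hg]
    simp only [List.append_nil, List.length_reverse]
    omega

/-- Add the number of ones in the register `5` to the variable `i`, and move the bits to the
register `6`. -/
def Prog.count (i : ℕ) : Prog :=
  .loop 5 (.push 6 false) (.seq (.push 6 true) (.push (varReg i) true))

theorem Runs.count (i : ℕ) (w : List Bool) : ∀ {e : ℕ → ℕ} {g : State}, g 5 = w →
    Runs M (.count i) (conf e g) (conf (update e i (e i + w.count true))
      (update (update g 5 []) 6 (w.reverse ++ g 6))) (w.length * 3 + 1) := by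
  induction w with
  | nil =>
    intro e g hg
    refine ((Runs.loop_nil (by rwa [conf_of_lt _ _ (by omega)])).congr ?_).mono (by simp)
    rw [← hg, update_eq_self]
    simp [hg]
  | cons b w ih =>
    intro e g hg
    have h1 : Runs M (cond b (.seq (.push 6 true) (.push (varReg i) true)) (.push 6 false))
        (update (conf e g) 5 w) (conf (update e i (e i + [b].count true))
          (update (update g 5 w) 6 (b :: g 6))) 2 := by
      rw [update_conf_of_lt _ _ (by omega)]
      have := Runs.push_conf (M := M) (e := e) (g := update g 5 w) (r := 6) (by omega) b
      rw [update_of_ne (by omega)] at this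
      cases b
      · simpa using this.mono (by omega)
      · exact this.seq Runs.push_conf_var
    have h2 := ih (e := update e i (e i + [b].count true))
      (g := update (update g 5 w) 6 (b :: g 6)) (by simp)
    refine ((Runs.loop_cons (by rw [conf_of_lt _ _ (by omega), hg]) h1 h2).congr ?_).mono ?_
    · congr 1
      · rw [update_idem, update_self, add_assoc, ← List.count_append]
        rfl
      · funext i
        simp only [update_apply, List.reverse_cons, List.append_assoc, List.singleton_append]
        split_ifs <;> simp_all
    · simp only [List.length_cons]
      omega

end

end ParamSetCover

namespace ParamSetCover

open Function (update update_self update_of_ne update_idem update_comm update_eq_self update_apply)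

/-! ### An approximation algorithm solves the gap problem -/

theorem count_true (y : List Bool) :
    y.count true = ((Finset.range y.length).filter fun i => y[i]? = some true).card := by
  induction y using List.reverseRecOn with
  | nil => rfl
  | append_singleton y b ih =>
    have h : ((Finset.range y.length).filter fun i => (y ++ [b])[i]? = some true) =
        (Finset.range y.length).filter fun i => y[i]? = some true :=
      Finset.filter_congr fun i hi => by
        rw [List.getElem?_append_left (Finset.mem_range.1 hi)]
    rw [List.count_append, List.length_append, List.length_singleton, Finset.range_add_one,
      Finset.filter_insert, h, ih]
    cases b <;> simp

theorem encodeSet_getElem? {n : ℕ} (C : Finset (Fin n)) (i : ℕ) :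
    (encodeSet C)[i]? = some true ↔ ∃ h : i < n, (⟨i, h⟩ : Fin n) ∈ C := by
  rw [encodeSet, List.getElem?_ofFn]
  split_ifs with h <;> simp [h]

theorem card_eq_count_encodeSet {n : ℕ} (C : Finset (Fin n)) :
    (encodeSet C).count true = C.card := by
  rw [count_true, ← Finset.card_map Fin.valEmbedding]
  congr 1
  ext i
  simp only [Finset.mem_filter, Finset.mem_range, encodeSet_getElem?, Finset.mem_map,
    Fin.valEmbedding_apply]
  constructor
  · rintro ⟨-, h, hi⟩
    exact ⟨_, hi, rfl⟩
  · rintro ⟨j, hj, rfl⟩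
    exact ⟨by simp [encodeSet], j.2, hj⟩

/-- The bit string `y` describes a solution of size at most `b`. -/
def Accepts (Γ : Instance) (b : ℕ) (y : List Bool) : Prop :=
  y.count true ≤ b ∧ ∀ u < Γ.numU, ∃ s < Γ.numS,
    y[s]? = some true ∧ Γ.matrix[s * Γ.numU + u]? = some true

theorem Instance.IsCover.accepts {Γ : Instance} {C : Finset (Fin Γ.numS)} (hC : Γ.IsCover C)
    {b : ℕ} (hb : C.card ≤ b) : Accepts Γ b (encodeSet C) := by
  refine ⟨by rwa [card_eq_count_encodeSet], fun u hu => ?_⟩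
  obtain ⟨s, hs, h⟩ := hC ⟨u, hu⟩
  exact ⟨s, s.2, (encodeSet_getElem? C s).2 ⟨s.2, hs⟩,
    ((Γ.adj_iff_matrix s u).1 ⟨s.2, hu, h⟩).2.2⟩

theorem Accepts.opt_le {Γ : Instance} {b : ℕ} {y : List Bool} (h : Accepts Γ b y) :
    Γ.opt ≤ b := by
  obtain ⟨h1, h2⟩ := h
  let C : Finset (Fin Γ.numS) := Finset.univ.filter fun s => y[(s : ℕ)]? = some true
  have hC : Γ.IsCover C := fun u => by
    obtain ⟨s, hs, hy, hm⟩ := h2 u u.2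
    obtain ⟨_, _, ha⟩ := (Γ.adj_iff_matrix s u).2 ⟨hs, u.2, hm⟩
    exact ⟨⟨s, hs⟩, by simpa [C] using hy, ha⟩
  have hcard : C.card ≤ y.count true := by
    rw [count_true, ← Finset.card_map Fin.valEmbedding]
    refine Finset.card_le_card fun i hi => ?_
    obtain ⟨s, hs, rfl⟩ := Finset.mem_map.1 hi
    have hs : y[(s : ℕ)]? = some true := by simpa [C] using hs
    simpa [hs] using (List.getElem?_eq_some_iff.1 hs).1
  exact (iInf₂_le C hC).trans (by exact_mod_cast hcard.trans h1)

open Tm in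
/-- The formula at level `4` for `Accepts`, where the variables `0`, `1`, `2`, `3` are the parameter,
the sizes of the two sides of the instance, and the number of ones. -/
def coverFm (c : ℕ) : Fm :=
  .and (.le (var 3) (const c * var 0)) <| .all (var 2) <| .ex (var 1) <|
    .and (.bit true (var 5)) (.bit false (var 5 * var 2 + var 4))

theorem sat_coverFm {Γ : Instance} {c : ℕ} {o : Bool → List Bool} (ho : o false = Γ.matrix)
    {e : ℕ → ℕ} (h1 : e 1 = Γ.numS) (h2 : e 2 = Γ.numU) (h3 : e 3 = (o true).count true) :
    (coverFm c).Sat o 4 e ↔ Accepts Γ (c * e 0) (o true) := by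
  simp [coverFm, Accepts, h1, h2, h3, ho]

theorem PolyBdd.exists_monotone {f : ℕ → ℕ} (hf : PolyBdd f) :
    ∃ P, PolyBdd P ∧ Monotone P ∧ ∀ W, f W ≤ P W := by
  obtain ⟨C, d, hf⟩ := hf
  exact ⟨_, ⟨C, d, fun _ => le_rfl⟩, fun _ _ h => by dsimp only; gcongr, hf⟩

/-- Empty the variables below `n`. -/
def Prog.clearVars : ℕ → Prog
  | 0 => .skip
  | n + 1 => .seq (.clear (varReg n)) (clearVars n)

theorem Runs.clearVars {M : Machine} {g : State} {W n : ℕ} : ∀ {e : ℕ → ℕ}, (∀ i, e i ≤ W) →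
    (∀ i ≥ n, e i = 0) →
    Runs M (.clearVars n) (conf e g) (conf (fun _ => 0) g) (n * (W * 2 + 2) + 1) := by
  induction n with
  | zero =>
    intro e he hn
    exact (Runs.skip.congr (conf_congr (fun i => hn i (Nat.zero_le i)) fun _ _ => rfl)).mono (by simp)
  | succ n ih =>
    intro e he hn
    refine (Runs.clear_conf_var.seq (ih (e := update e n 0) (fun i => ?_) fun i hi => ?_)).mono ?_
    · simp only [update_apply]
      split_ifs
      · exact Nat.zero_le _
      · exact he i
    · by_cases h : i = n
      · rw [h, update_self]
      · rw [update_of_ne h, hn i (by omega)]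
    · have := he n
      linarith

/-- Run an approximation algorithm and check its output. -/
def checkProg (c : ℕ) : Prog :=
  .seq (.copy 0 8) <| .seq .readInput <| .seq (.call 8 9) <| .seq (.move 9 5) <|
  .seq (.count 3) <| .seq (.move 6 5) <| .seq ((coverFm c).prog 4) <| .seq (.move 3 1) <|
  .seq (.clear 4) <| .seq (.clear 5) (.clearVars 4)

theorem inputVars_le (Γ : Instance) (k i : ℕ) : inputVars Γ k i ≤ (encode (Γ, k)).length := by
  rw [length_encode]
  simp only [inputVars, update_apply]
  split_ifs <;> omega

theorem inputVars_of_le (Γ : Instance) (k : ℕ) {i : ℕ} (hi : 3 ≤ i) : inputVars Γ k i = 0 := by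
  simp only [inputVars, update_apply]
  split_ifs <;> omega

@[simp] theorem inputVars_zero (Γ : Instance) (k : ℕ) : inputVars Γ k 0 = k := rfl
@[simp] theorem inputVars_one (Γ : Instance) (k : ℕ) : inputVars Γ k 1 = Γ.numS := rfl
@[simp] theorem inputVars_two (Γ : Instance) (k : ℕ) : inputVars Γ k 2 = Γ.numU := rfl

theorem runs_checkProg {M : Machine} {Γ : Instance} {k c : ℕ} {y : List Bool} {t : ℕ}
    (h : M.HaltsWithin (encode (Γ, k)) y t) :
    Runs M (checkProg c) (single 0 (encode (Γ, k))) (single 1 [bval (Accepts Γ (c * k) y)])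
      (((encode (Γ, k)).length + y.length) * 30 + 50 +
        (coverFm c).cost ((encode (Γ, k)).length + y.length) + t) := by
  set x := encode (Γ, k) with hx
  set W := x.length + y.length with hW
  have hmat : Γ.matrix.length ≤ x.length := by rw [hx, length_encode]; omega
  have hvars : ∀ i, inputVars Γ k i ≤ x.length := inputVars_le Γ k
  have hcount : y.count true ≤ y.length := List.count_le_length
  set e := update (inputVars Γ k) 3 (y.count true) with he
  have heW : ∀ i, e i ≤ W := fun i => by
    have := hvars i
    simp only [he, update_apply]
    split_ifs <;> omega
  have he4 : ∀ i ≥ 4, e i = 0 := fun i hi => by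
    rw [he, update_of_ne (by omega), inputVars_of_le _ _ (by omega)]
  let g0 : State := fun _ => []
  have s1 : Runs M (.copy 0 8) (single 0 x) (conf (fun _ => 0) (update (update g0 0 x) 8 x.reverse))
      (x.length * 5 + 2) := by
    rw [single_eq_conf (by omega)]
    refine ((Runs.copy (by omega) (by omega) (by omega) (by omega) (by omega) rfl).congr ?_).mono ?_
    · refine conf_congr (fun _ => rfl) fun r hr => ?_
      interval_cases r <;> simp [single, g0]
    · simp [single]
  have s2 : Runs M .readInput (conf (fun _ => 0) (update (update g0 0 x) 8 x.reverse))
      (conf (inputVars Γ k) (update (update g0 4 Γ.matrix) 8 x.reverse)) (x.length * 4 + 5) := by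
    refine (Runs.readInput (by simp [hx]) rfl rfl).congr ?_
    refine conf_congr (fun _ => rfl) fun r hr => ?_
    interval_cases r <;> simp [g0]
  have s3 : Runs M (.call 8 9) (conf (inputVars Γ k) (update (update g0 4 Γ.matrix) 8 x.reverse))
      (conf (inputVars Γ k) (update (update g0 4 Γ.matrix) 9 y.reverse))
      (x.length + 1 + t + (y.length + 1)) := by
    refine ((Runs.call_conf (y := y) (t := t) (by omega) (by omega) (by omega) rfl
      (by simpa using h)).congr ?_).mono ?_
    · refine conf_congr (fun _ => rfl) fun r hr => ?_
      interval_cases r <;> simp [g0]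
    · simp
  have s4 : Runs M (.move 9 5) (conf (inputVars Γ k) (update (update g0 4 Γ.matrix) 9 y.reverse))
      (conf (inputVars Γ k) (update (update g0 4 Γ.matrix) 5 y)) (y.length * 2 + 1) := by
    refine ((Runs.move_conf (by omega) (by omega) (by omega)).congr ?_).mono ?_
    · refine conf_congr (fun _ => rfl) fun r hr => ?_
      interval_cases r <;> simp [g0]
    · simp
  have s5 : Runs M (.count 3) (conf (inputVars Γ k) (update (update g0 4 Γ.matrix) 5 y))
      (conf e (update (update g0 4 Γ.matrix) 6 y.reverse)) (y.length * 3 + 1) := by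
    refine (Runs.count 3 y (by simp)).congr ?_
    refine conf_congr (fun i => ?_) fun r hr => ?_
    · rw [inputVars_of_le _ _ le_rfl, zero_add]
    · interval_cases r <;> simp [g0]
  have s6 : Runs M (.move 6 5) (conf e (update (update g0 4 Γ.matrix) 6 y.reverse))
      (conf e (update (update g0 4 Γ.matrix) 5 y)) (y.length * 2 + 1) := by
    refine ((Runs.move_conf (by omega) (by omega) (by omega)).congr ?_).mono ?_
    · refine conf_congr (fun _ => rfl) fun r hr => ?_
      interval_cases r <;> simp [g0]
    · simp
  have s7 := Runs.fm_conf (M := M) (g := update (update g0 4 Γ.matrix) 5 y) heW he4 rfl (coverFm c)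
  rw [sat_coverFm (Γ := Γ) (by simp [bitReg]) (by simp [he]) (by simp [he]) (by simp [he, bitReg])]
    at s7
  have hy : update (update g0 4 Γ.matrix) 5 y (bitReg true) = y := by simp [bitReg]
  have hk : e 0 = k := by simp [he]
  have h3 : update (update g0 4 Γ.matrix) 5 y 3 = [] := by simp [g0]
  rw [hy, hk, h3] at s7
  generalize bval (Accepts Γ (c * k) y) = b at s7 ⊢
  have s8 : Runs M (.move 3 1) (conf e (update (update (update g0 4 Γ.matrix) 5 y) 3 [b]))
      (conf e (update (update (update g0 4 Γ.matrix) 5 y) 1 [b])) 3 := by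
    refine ((Runs.move_conf (by omega) (by omega) (by omega)).congr ?_).mono ?_
    · refine conf_congr (fun _ => rfl) fun r hr => ?_
      interval_cases r <;> simp [g0]
    · simp
  have s9 : Runs M (.clear 4) (conf e (update (update (update g0 4 Γ.matrix) 5 y) 1 [b]))
      (conf e (update (update g0 5 y) 1 [b])) (Γ.matrix.length * 2 + 1) := by
    refine ((Runs.clear_conf (by omega)).congr ?_).mono ?_
    · refine conf_congr (fun _ => rfl) fun r hr => ?_
      interval_cases r <;> simp [g0]
    · simp
  have s10 : Runs M (.clear 5) (conf e (update (update g0 5 y) 1 [b])) (conf e (single 1 [b]))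
      (y.length * 2 + 1) := by
    refine ((Runs.clear_conf (by omega)).congr ?_).mono ?_
    · refine conf_congr (fun _ => rfl) fun r hr => ?_
      interval_cases r <;> simp [g0, single]
    · simp
  have s11 : Runs M (.clearVars 4) (conf e (single 1 [b])) (single 1 [b]) (4 * (W * 2 + 2) + 1) := by
    rw [single_eq_conf (r := 1) (by omega)]
    refine (Runs.clearVars heW he4).congr ?_
    exact conf_congr (fun _ => rfl) fun r hr => by rw [conf_of_lt _ _ hr]
  refine (s1.seq (s2.seq (s3.seq (s4.seq (s5.seq (s6.seq (s7.seq (s8.seq (s9.seq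
    (s10.seq s11)))))))))).mono ?_
  omega

theorem gapSetCoverFPT_of_hasFPTApproximation {c : ℕ} (h : HasFPTApproximation c) :
    GapSetCoverFPT c := by
  obtain ⟨M, f, d, hf, h⟩ := h
  obtain ⟨B, hB⟩ := M.exists_length_le
  let L : ℕ → ℕ → ℕ := fun k l => l + (l + B * (f k * l ^ d))
  have ht : FPTBdd fun k l => f k * l ^ d := (FPTBdd.param hf).mul (FPTBdd.length.pow d)
  have hL : FPTBdd L := FPTBdd.length.add (FPTBdd.length.add ((FPTBdd.const B).mul ht))
  obtain ⟨P, hP, hmono, hle⟩ := (coverFm c).polyBdd_cost.exists_monotone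
  have key : ∀ (Γ : Instance) (k : ℕ), ∃ y : List Bool, (Γ.opt ≤ (k : ℕ∞) → Accepts Γ (c * k) y) ∧
      ((checkProg c).machine M).HaltsWithin (encode (Γ, k)) [bval (Accepts Γ (c * k) y)]
        (L k (encode (Γ, k)).length * 30 + 50 + P (L k (encode (Γ, k)).length) +
          f k * (encode (Γ, k)).length ^ d + 1) := by
    intro Γ k
    obtain ⟨y, hy, hopt⟩ := h Γ k
    refine ⟨y, fun hk => ?_, (runs_checkProg hy).haltsWithin.mono ?_⟩
    · obtain ⟨C, rfl, hC, hcard⟩ := hopt hk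
      exact hC.accepts (by exact_mod_cast hcard)
    · have h1 : (encode (Γ, k)).length + y.length ≤ L k (encode (Γ, k)).length :=
        Nat.add_le_add_left (hB _ _ _ hy) _
      have h2 := (hle _).trans (hmono h1)
      omega
  refine FPTBdd.hasFPTDecider (((((hL.mul (.const 30)).add (.const 50)).add (hL.polyBdd hP)).add
    ht).add (.const 1)) (N := (checkProg c).machine M) ?_ ?_
  · intro Γ k hk
    obtain ⟨y, hy, hM⟩ := key Γ k
    rwa [bval_eq_true.2 (hy hk)] at hM
  · intro Γ k hk
    obtain ⟨y, -, hM⟩ := key Γ k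
    have hn : ¬ Accepts Γ (c * k) y := fun ha => by
      have h1 : (Γ.opt : ℝ≥0∞) ≤ ((c * k : ℕ) : ℕ∞) := ENat.toENNReal_le.2 ha.opt_le
      refine hk.not_ge (h1.trans (le_of_eq ?_))
      rw [ENat.toENNReal_coe, ← Nat.cast_mul, ENNReal.ofReal_natCast]
    rwa [eq_false hn, bval_false] at hM

end ParamSetCover

namespace ParamSetCover

open Function (update update_self update_of_ne update_idem update_comm update_eq_self update_apply)

/-! ### The base of the gap instance -/

/-- The binary logarithm of the factor by which the base exceeds the size of the instance. -/
def logFactor (c k : ℕ) : ℕ := 324 * c ^ 4 * (k + 1) ^ 7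

/-- The base for the construction of the gap instance. -/
def gapBase (Γ : Instance) (c k : ℕ) : ℕ := 2 ^ logFactor c k * (Γ.numS + Γ.numU + 2)

theorem positions_add_copies_le {c : ℕ} (hc : 0 < c) (k : ℕ) :
    positions c k + copies c k ≤ logFactor c k := by
  have h1 : c ^ 2 ≤ c ^ 4 := Nat.pow_le_pow_right hc (by omega)
  have h2 : (k + 1) ^ 3 ≤ (k + 1) ^ 7 := Nat.pow_le_pow_right (by omega) (by omega)
  have h3 : (k + 1) ^ 2 ≤ (k + 1) ^ 7 := Nat.pow_le_pow_right (by omega) (by omega)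
  have h4 : c ^ 2 * (k + 1) ^ 3 ≤ c ^ 4 * (k + 1) ^ 7 := Nat.mul_le_mul h1 h2
  have h5 : c ^ 2 * (k + 1) ^ 2 ≤ c ^ 4 * (k + 1) ^ 7 := Nat.mul_le_mul h1 h3
  calc positions c k + copies c k = 8 * (c ^ 2 * (k + 1) ^ 3) + 8 * (c ^ 2 * (k + 1) ^ 2) := by
        unfold positions copies; ring
    _ ≤ 324 * (c ^ 4 * (k + 1) ^ 7) := by omega
    _ = logFactor c k := by unfold logFactor; ring

theorem four_mul_mul_factorial_le {a : ℕ} (ha : 0 < a) : 4 * a * a.factorial ≤ 2 ^ (4 * a ^ 2) := by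
  have h1 : a ≤ 2 ^ a := Nat.lt_two_pow_self.le
  have h2 : a.factorial ≤ 2 ^ (a * a) :=
    (Nat.factorial_le_pow a).trans ((Nat.pow_le_pow_left h1 a).trans (by rw [← pow_mul]))
  calc 4 * a * a.factorial ≤ 2 ^ 2 * 2 ^ a * 2 ^ (a * a) := by gcongr; norm_num
    _ = 2 ^ (2 + a + a * a) := by rw [pow_add, pow_add]
    _ ≤ 2 ^ (4 * a ^ 2) := Nat.pow_le_pow_right two_pos (by nlinarith)

theorem lt_gapBase {Γ : Instance} {c : ℕ} (hc : 0 < c) (k : ℕ) :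
    (4 * (positions c k + k) * (positions c k + k).factorial) ^ (k + 1) * (Γ.numS + 1) <
      gapBase Γ c k := by
  have hp := positions_pos hc k
  have h1 := four_mul_mul_factorial_le (a := positions c k + k) (by omega)
  have ha : positions c k + k ≤ 9 * c ^ 2 * (k + 1) ^ 3 := by
    have h3 : 1 * (k + 1) ≤ c ^ 2 * (k + 1) ^ 3 :=
      Nat.mul_le_mul (Nat.pow_pos hc) (Nat.le_self_pow (by omega) _)
    have : positions c k = 8 * (c ^ 2 * (k + 1) ^ 3) := by unfold positions copies; ring
    rw [this, mul_assoc]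
    omega
  have h2 : 4 * (positions c k + k) ^ 2 * (k + 1) ≤ logFactor c k :=
    calc 4 * (positions c k + k) ^ 2 * (k + 1) ≤ 4 * (9 * c ^ 2 * (k + 1) ^ 3) ^ 2 * (k + 1) := by
          gcongr
      _ = logFactor c k := by unfold logFactor; ring
  calc _ ≤ (2 ^ (4 * (positions c k + k) ^ 2)) ^ (k + 1) * (Γ.numS + 1) := by gcongr
    _ ≤ 2 ^ logFactor c k * (Γ.numS + 1) := by
      rw [← pow_mul]
      gcongr
      omega
    _ < gapBase Γ c k := Nat.mul_lt_mul_of_pos_left (by omega) (by positivity)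

theorem le_gapBase (Γ : Instance) (c k : ℕ) : Γ.numS + Γ.numU + 2 ≤ gapBase Γ c k :=
  Nat.le_mul_of_pos_left _ (by positivity)

theorem logFactor_le_gapBase (Γ : Instance) (c k : ℕ) : logFactor c k ≤ gapBase Γ c k :=
  Nat.lt_two_pow_self.le.trans (Nat.le_mul_of_pos_right _ (by omega))

/-- There is a least number providing good moduli; the gap instance is built with it. -/
theorem exists_least_goodModuli (Γ : Instance) {c : ℕ} (hc : 0 < c) (k : ℕ) :
    ∃ D < gapBase Γ c k, GoodModuli k Γ.numS (positions c k) (gapBase Γ c k) D ∧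
      ∀ D' < D, ¬ GoodModuli k Γ.numS (positions c k) (gapBase Γ c k) D' := by
  classical
  obtain ⟨D, hD, h⟩ := exists_goodModuli (positions_pos hc k) (lt_gapBase (Γ := Γ) hc k)
  have hex : ∃ D, GoodModuli k Γ.numS (positions c k) (gapBase Γ c k) D := ⟨D, h⟩
  exact ⟨Nat.find hex, (Nat.find_min' hex h).trans_lt hD, Nat.find_spec hex,
    fun D' hD' => Nat.find_min hex hD'⟩

theorem sat_edgeFm_iff {Γ : Instance} {o : Bool → List Bool} (ho : o false = Γ.matrix) {c k D : ℕ}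
    {e : ℕ → ℕ} (h0 : e 0 = k) (h1 : e 1 = Γ.numS) (h2 : e 2 = Γ.numU) (h3 : e 3 = gapBase Γ c k)
    (hD : D < gapBase Γ c k) (hg : GoodModuli k Γ.numS (positions c k) (gapBase Γ c k) D)
    (hmin : ∀ D' < D, ¬ GoodModuli k Γ.numS (positions c k) (gapBase Γ c k) D') :
    (edgeFm c).Sat o 8 e ↔ GapAdj Γ c k (gapBase Γ c k) D (e 6) (e 7) := by
  have hpos : 0 < e 3 := h3 ▸ (Nat.zero_le _).trans_lt hD
  rw [sat_edgeFm ho h1 h2 hpos, h0, h3]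
  constructor
  · rintro ⟨D', -, ⟨hg', hmin'⟩, h⟩
    obtain rfl : D' = D := by
      rcases lt_trichotomy D' D with hlt | heq | hlt
      · exact absurd hg' (hmin _ hlt)
      · exact heq
      · exact absurd hg (hmin' _ hlt)
    exact h
  · exact fun h => ⟨D, hD, ⟨hg, hmin⟩, h⟩

/-! ### The reduction as a program -/

section

variable {M : Machine} {e : ℕ → ℕ} {g : State}

/-- Push the truth values of a formula of level `8`, for all values of the variables `6` and `7`
less than those of the variables `4` and `5`. -/
def Prog.table (φ : Fm) : Prog :=
  .seq (.pushTm (.var 4) (varReg 6)) <| .loop (varReg 6) .skip <|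
    .seq (.pushTm (.var 5) (varReg 7)) <| .loop (varReg 7) .skip <|
      .seq (φ.prog 8) (.case 3 .skip (.push 6 false) (.push 6 true))

/-- A bound for the time needed by `table`. -/
def tableCost (φ : Fm) (W : ℕ) : ℕ :=
  pushCost (.var 4) W + (W * (pushCost (.var 5) W + (W * (φ.cost W + 2 + 1) + 1) + 1) + 1)

theorem polyBdd_tableCost (φ : Fm) : PolyBdd (tableCost φ) :=
  (polyBdd_pushCost _).add ((PolyBdd.id.mul (((polyBdd_pushCost _).add ((PolyBdd.id.mul
    ((φ.polyBdd_cost.add (.const 2)).add (.const 1))).add (.const 1))).add (.const 1))).add (.const 1))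

theorem drop_range {v n : ℕ} (h : v < n) :
    (List.range n).drop v = v :: (List.range n).drop (v + 1) := by
  rw [List.drop_eq_getElem_cons (by simpa using h), List.getElem_range]

theorem Runs.table {W : ℕ} (he : ∀ i, e i ≤ W) (hn : ∀ i ≥ 6, e i = 0) (h2 : g 2 = [])
    (h3 : g 3 = []) (h6 : g 6 = []) (φ : Fm) (a : ℕ → ℕ → Bool)
    (ha : ∀ s < e 4, ∀ u < e 5,
      bval (φ.Sat (fun b => g (bitReg b)) 8 (update (update e 6 s) 7 u)) = a s u) :
    Runs M (.table φ) (conf e g) (conf e (update g 6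
      ((List.range (e 4)).map fun s => (List.range (e 5)).map (a s)).flatten)) (tableCost φ W) := by
  have hW : ∀ (i : ℕ) {s : ℕ}, s ≤ W → ∀ {e' : ℕ → ℕ}, (∀ i, e' i ≤ W) → ∀ j, update e' i s j ≤ W :=
    fun i s hs e' he' j => by
      simp only [update_apply]
      split_ifs
      · exact hs
      · exact he' j
  have step : ∀ s < e 4, ∀ u < e 5, ∀ l : List Bool,
      Runs M (.seq (φ.prog 8) (.case 3 .skip (.push 6 false) (.push 6 true)))
        (conf (update (update e 6 s) 7 u) (update g 6 l))
        (conf (update (update e 6 s) 7 u) (update g 6 (a s u :: l))) (φ.cost W + 2) := by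
    intro s hs u hu l
    have r1 := Runs.fm_conf (M := M) (g := update g 6 l) (n := 8)
      (hW 7 (hu.le.trans (he 5)) (hW 6 (hs.le.trans (he 4)) he))
      (fun i hi => by
        rw [update_of_ne (by omega), update_of_ne (by omega), hn i (by omega)]) (by simpa using h2) φ
    have ho : (fun b => update g 6 l (bitReg b)) = fun b => g (bitReg b) := by
      funext b
      cases b <;> simp [bitReg]
    rw [ho, ha s hs u hu, update_of_ne (by omega), h3] at r1
    refine r1.seq (Runs.case_cons (b := a s u) (l := []) (by
      rw [conf_of_lt _ _ (by omega), update_self]) ?_)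
    rw [update_conf_of_lt _ _ (by omega), update_idem]
    have r2 := Runs.push_conf (M := M) (e := update (update e 6 s) 7 u)
      (g := update (update g 6 l) 3 []) (r := 6) (by omega) (a s u)
    have hg : update (update (update g 6 l) 3 []) 6
        (a s u :: update (update g 6 l) 3 [] 6) = update g 6 (a s u :: l) := by
      funext i
      simp only [update_apply]
      split_ifs <;> simp_all
    rw [hg] at r2
    cases h : a s u <;> rw [h] at r2 <;> exact r2
  have inner : ∀ s < e 4, ∀ l : List Bool,
      Runs M (.seq (.pushTm (.var 5) (varReg 7)) <| .loop (varReg 7) .skip <|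
        .seq (φ.prog 8) (.case 3 .skip (.push 6 false) (.push 6 true)))
        (conf (update e 6 s) (update g 6 l))
        (conf (update e 6 s) (update g 6 ((List.range (e 5)).map (a s) ++ l)))
        (pushCost (.var 5) W + (W * (φ.cost W + 2 + 1) + 1)) := by
    intro s hs l
    have r1 := Runs.pushTm_var (M := M) (g := update g 6 l) (hW 6 (hs.le.trans (he 4)) he)
      (by simpa using h2) (.var 5) (i := 7) (by rw [update_of_ne (by omega), hn 7 (by omega)])
    have r2 := Runs.loop_unary (M := M) (r := varReg 7) (q₀ := .skip)
      (q₁ := .seq (φ.prog 8) (.case 3 .skip (.push 6 false) (.push 6 true))) (T := φ.cost W + 2)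
      (fun v _ => conf (update (update e 6 s) 7 v)
        (update g 6 (((List.range (e 5)).drop v).map (a s) ++ l))) (e 5) (fun v w => by simp)
      (by
        intro v w hv
        rw [update_conf_var, update_idem, drop_range (by omega : v < e 5)]
        exact step s hs v (by omega) _)
    have hend : update (update e 6 s) 7 0 = update e 6 s := by
      rw [Function.update_eq_self_iff, update_of_ne (by omega), hn 7 (by omega)]
    rw [List.drop_eq_nil_of_le (by simp), hend] at r2
    refine (r1.seq r2).mono ?_
    have := Nat.mul_le_mul_right (φ.cost W + 2 + 1) (he 5)
    omega
  have r1 := Runs.pushTm_var (M := M) (g := g) he h2 (.var 4) (i := 6) (hn 6 le_rfl)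
  have r2 := Runs.loop_unary (M := M) (r := varReg 6) (q₀ := .skip)
    (q₁ := .seq (.pushTm (.var 5) (varReg 7)) <| .loop (varReg 7) .skip <|
      .seq (φ.prog 8) (.case 3 .skip (.push 6 false) (.push 6 true)))
    (T := pushCost (.var 5) W + (W * (φ.cost W + 2 + 1) + 1))
    (fun v _ => conf (update e 6 v) (update g 6
      (((List.range (e 4)).drop v).map fun s => (List.range (e 5)).map (a s)).flatten)) (e 4)
    (fun v w => by simp)
    (by
      intro v w hv
      rw [update_conf_var, update_idem, drop_range (by omega : v < e 4)]
      exact inner v (by omega) _)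
  have hbegin : update g 6 [] = g := by rw [← h6, update_eq_self]
  have hend : update e 6 0 = e := by rw [← hn 6 le_rfl, update_eq_self]
  rw [List.drop_eq_nil_of_le (by simp), hend, List.map_nil, List.flatten_nil, hbegin] at r2
  refine (r1.seq r2).mono ?_
  have := Nat.mul_le_mul_right (pushCost (.var 5) W + (W * (φ.cost W + 2 + 1) + 1) + 1) (he 4)
  unfold tableCost
  omega

end

theorem ofFn_eq_map_range {α : Type*} (n : ℕ) (f : ℕ → α) :
    List.ofFn (fun i : Fin n => f i) = (List.range n).map f :=
  List.ext_getElem (by simp) (by simp)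

theorem gapInstance_matrix (Γ : Instance) (c k V D : ℕ) : (gapInstance Γ c k V D).matrix =
    ((List.range (V ^ 2)).map fun s =>
      (List.range (V ^ (2 + 8 * c))).map fun u => bval (GapAdj Γ c k V D s u)).flatten := by
  rw [← ofFn_eq_map_range]
  simp only [← ofFn_eq_map_range]
  rfl

end ParamSetCover

namespace ParamSetCover

open Function (update update_self update_of_ne update_idem update_comm update_eq_self update_apply)

open Tm in
/-- Read an instance and a parameter, and compute the base, the second power of the base and the
number of elements of the gap instance. -/
def setupProg (c : ℕ) : Prog :=
  .seq .readInput <| .seq (.pushTm (const (324 * c ^ 4) * (var 0 + const 1).pow 7) (varReg 3)) <|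
  .seq (.exp 3 4) <| .seq (.pushTm (var 3 * (var 1 + var 2 + const 2)) (varReg 4)) <|
  .seq (.clear (varReg 3)) <| .seq (.pushTm (var 4) (varReg 3)) <| .seq (.clear (varReg 4)) <|
  .seq (.pushTm ((var 3).pow 2) (varReg 4)) (.pushTm ((var 3).pow (2 + 8 * c)) (varReg 5))

open Tm in
/-- A bound for the time needed by `setupProg`. -/
def setupCost (c W : ℕ) : ℕ :=
  W * 4 + 5 + (pushCost (const (324 * c ^ 4) * (var 0 + const 1).pow 7) W +
    (W * (W * 5 + 4) + W * 2 + 3 + (pushCost (var 3 * (var 1 + var 2 + const 2)) W +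
      (W * 2 + 1 + (pushCost (var 4) W + (W * 2 + 1 + (pushCost ((var 3).pow 2) W +
        pushCost ((var 3).pow (2 + 8 * c)) W)))))))

theorem polyBdd_linear (a b : ℕ) : PolyBdd fun W => W * a + b :=
  (PolyBdd.id.mul (.const a)).add (.const b)

theorem polyBdd_setupCost (c : ℕ) : PolyBdd (setupCost c) :=
  (polyBdd_linear 4 5).add ((polyBdd_pushCost _).add ((((PolyBdd.id.mul (polyBdd_linear 5 4)).add
    (PolyBdd.id.mul (.const 2))).add (.const 3)).add ((polyBdd_pushCost _).add
      ((polyBdd_linear 2 1).add ((polyBdd_pushCost _).add ((polyBdd_linear 2 1).add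
        ((polyBdd_pushCost _).add (polyBdd_pushCost _))))))))

/-- The values of the variables after `setupProg`. -/
def gapVars (Γ : Instance) (c k : ℕ) : ℕ → ℕ :=
  update (update (update (inputVars Γ k) 3 (gapBase Γ c k)) 4 (gapBase Γ c k ^ 2)) 5
    (gapBase Γ c k ^ (2 + 8 * c))

section

variable {M : Machine} {g : State} {Γ : Instance} {c k R : ℕ}

theorem update_le {e : ℕ → ℕ} {W : ℕ} (he : ∀ i, e i ≤ W) {v : ℕ} (hv : v ≤ W) (j : ℕ) :
    ∀ i, update e j v i ≤ W := fun i => by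
  simp only [update_apply]
  split_ifs
  · exact hv
  · exact he i

theorem gapVars_le (hR : gapBase Γ c k ≤ R) (hL : (encode (Γ, k)).length ≤ R) :
    ∀ i, gapVars Γ c k i ≤ R ^ (2 + 8 * c) := by
  have hR' : R ≤ R ^ (2 + 8 * c) := Nat.le_self_pow (by omega) R
  have h2 : gapBase Γ c k ^ 2 ≤ R ^ (2 + 8 * c) :=
    (Nat.pow_le_pow_left hR 2).trans (Nat.pow_le_pow_right
      (by have := le_gapBase Γ c k; omega) (by omega))
  exact update_le (update_le (update_le (fun i => (inputVars_le Γ k i).trans (hL.trans hR'))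
    (hR.trans hR') _) h2 _) (Nat.pow_le_pow_left hR _) _

theorem gapVars_of_le (Γ : Instance) (c k : ℕ) {i : ℕ} (hi : 6 ≤ i) : gapVars Γ c k i = 0 := by
  rw [gapVars, update_of_ne (by omega), update_of_ne (by omega), update_of_ne (by omega),
    inputVars_of_le _ _ (by omega)]

theorem Runs.setup (hR : gapBase Γ c k ≤ R) (hL : (encode (Γ, k)).length ≤ R)
    (h0 : g 0 = encode (Γ, k)) (h2 : g 2 = []) (h4 : g 4 = []) :
    Runs M (setupProg c) (conf (fun _ => 0) g)
      (conf (gapVars Γ c k) (update (update g 0 []) 4 Γ.matrix)) (setupCost c (R ^ (2 + 8 * c))) := by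
  have hR' : R ≤ R ^ (2 + 8 * c) := Nat.le_self_pow (by omega) R
  have hfinal := gapVars_le hR hL
  set W := R ^ (2 + 8 * c) with hW
  set V := gapBase Γ c k with hV
  set I := inputVars Γ k with hI
  have hI3 : ∀ i, 3 ≤ i → I i = 0 := fun i hi => inputVars_of_le Γ k hi
  have bI : ∀ i, I i ≤ W := fun i => (inputVars_le Γ k i).trans (hL.trans hR')
  have bV : V ≤ W := hR.trans hR'
  have bpow : 2 ^ logFactor c k ≤ W := (Nat.le_mul_of_pos_right _ (by omega)).trans bV
  have blog : logFactor c k ≤ W := (logFactor_le_gapBase Γ c k).trans bV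
  have hg2 : update (update g 0 []) 4 Γ.matrix 2 = [] := by simp [h2]
  have s1 := Runs.readInput (M := M) h0 h2 h4
  have s2 := Runs.pushTm_var (M := M) bI hg2
    (.const (324 * c ^ 4) * (Tm.var 0 + .const 1).pow 7) (hI3 3 (by omega))
  have s3 := Runs.exp (M := M) (e := update I 3 (logFactor c k)) (i := 3) (j := 4) (by omega) hg2
    (by rw [update_of_ne (by omega), hI3 4 (by omega)]) (W := W) (by rwa [update_self])
  have s4 := Runs.pushTm_var (M := M) (e := update I 3 (2 ^ logFactor c k)) (update_le bI bpow 3) hg2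
    (.var 3 * (Tm.var 1 + .var 2 + .const 2)) (i := 4)
    (by rw [update_of_ne (by omega), hI3 4 (by omega)])
  have s5 := Runs.clear_conf_var (M := M) (e := update (update I 3 (2 ^ logFactor c k)) 4 V)
    (g := update (update g 0 []) 4 Γ.matrix) (i := 3)
  have s6 := Runs.pushTm_var (M := M) (e := update I 4 V) (update_le bI bV 4) hg2 (.var 4) (i := 3)
    (by rw [update_of_ne (by omega), hI3 3 (by omega)])
  have s7 := Runs.clear_conf_var (M := M) (e := update (update I 4 V) 3 V)
    (g := update (update g 0 []) 4 Γ.matrix) (i := 4)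
  have s8 := Runs.pushTm_var (M := M) (e := update I 3 V) (update_le bI bV 3) hg2
    ((Tm.var 3).pow 2) (i := 4) (by rw [update_of_ne (by omega), hI3 4 (by omega)])
  have s9 := Runs.pushTm_var (M := M) (e := update (update I 3 V) 4 (V ^ 2))
    (W := W) (update_le (update_le bI bV 3) (by simpa [gapVars] using hfinal 4) 4) hg2
    ((Tm.var 3).pow (2 + 8 * c)) (i := 5)
    (by rw [update_of_ne (by omega), update_of_ne (by omega), hI3 5 (by omega)])
  have t2 : (Tm.const (324 * c ^ 4) * (Tm.var 0 + .const 1).pow 7).eval I = logFactor c k := by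
    simp [logFactor, hI]
  have t4 : (Tm.var 3 * (Tm.var 1 + .var 2 + .const 2)).eval (update I 3 (2 ^ logFactor c k)) = V := by
    simp [gapBase, hI, hV]
  have t3 : update (update I 3 (logFactor c k)) 3 (2 ^ update I 3 (logFactor c k) 3) =
      update I 3 (2 ^ logFactor c k) := by rw [update_idem, update_self]
  have t5 : update (update (update I 3 (2 ^ logFactor c k)) 4 V) 3 0 = update I 4 V := by
    rw [update_comm (by omega), update_idem, ← hI3 3 le_rfl, update_eq_self]
  have t6 : (Tm.var 4).eval (update I 4 V) = V := by simp
  have t7 : update (update (update I 4 V) 3 V) 4 0 = update I 3 V := by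
    rw [update_comm (by omega), update_idem, ← hI3 4 (by omega), update_eq_self]
  have t8 : ((Tm.var 3).pow 2).eval (update I 3 V) = V ^ 2 := by simp
  have t9 : ((Tm.var 3).pow (2 + 8 * c)).eval (update (update I 3 V) 4 (V ^ 2)) =
      V ^ (2 + 8 * c) := by simp
  have b5 : update (update I 3 (2 ^ logFactor c k)) 4 V 3 ≤ W :=
    update_le (update_le bI bpow 3) bV 4 3
  have b7 : update (update I 4 V) 3 V 4 ≤ W := update_le (update_le bI bV 4) bV 3 4
  rw [t2] at s2
  rw [t3] at s3
  rw [t4] at s4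
  rw [t5] at s5
  rw [t6] at s6
  rw [t7] at s7
  rw [t8] at s8
  rw [t9] at s9
  refine (s1.seq (s2.seq (s3.seq (s4.seq (s5.seq (s6.seq (s7.seq (s8.seq s9)))))))).mono ?_
  unfold setupCost
  omega

open Tm in
/-- Complete the adjacency matrix of the gap instance to the code of the gap instance and the new
parameter. -/
def headerProg (c : ℕ) : Prog :=
  .seq (.push 6 false) <| .seq (.pushTm (var 5) 6) <| .seq (.push 6 false) <|
  .seq (.pushTm (var 4) 6) <| .seq (.push 6 false) (.pushTm (const 2 * positionsTm c) 6)

open Tm in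
/-- A bound for the time needed by `headerProg`. -/
def headerCost (c W : ℕ) : ℕ :=
  1 + (pushCost (var 5) W + (1 + (pushCost (var 4) W + (1 + pushCost (const 2 * positionsTm c) W))))

theorem polyBdd_headerCost (c : ℕ) : PolyBdd (headerCost c) :=
  (PolyBdd.const 1).add ((polyBdd_pushCost _).add ((PolyBdd.const 1).add ((polyBdd_pushCost _).add
    ((PolyBdd.const 1).add (polyBdd_pushCost _)))))

theorem Runs.header {W D : ℕ} (he : ∀ i, gapVars Γ c k i ≤ W) (h2 : g 2 = []) :
    Runs M (headerProg c)
      (conf (gapVars Γ c k) (update g 6 (gapInstance Γ c k (gapBase Γ c k) D).matrix))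
      (conf (gapVars Γ c k)
        (update g 6 (encode (gapInstance Γ c k (gapBase Γ c k) D, 2 * positions c k))))
      (headerCost c W) := by
  have pushFalse : ∀ l, Runs M (.push 6 false) (conf (gapVars Γ c k) (update g 6 l))
      (conf (gapVars Γ c k) (update g 6 (false :: l))) 1 := fun l => by
    simpa using Runs.push_conf (M := M) (e := gapVars Γ c k) (g := update g 6 l) (r := 6)
      (by omega) false
  have pushNat : ∀ (t : Tm) l, Runs M (.pushTm t 6) (conf (gapVars Γ c k) (update g 6 l))
      (conf (gapVars Γ c k) (update g 6 (List.replicate (t.eval (gapVars Γ c k)) true ++ l)))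
      (pushCost t W) := fun t l => by
    simpa using Runs.pushTm (M := M) (g := update g 6 l) he (by simpa using h2) t (r := 6) (by omega)
  have t5 : (Tm.var 5).eval (gapVars Γ c k) = gapBase Γ c k ^ (2 + 8 * c) := by simp [gapVars]
  have t4 : (Tm.var 4).eval (gapVars Γ c k) = gapBase Γ c k ^ 2 := by simp [gapVars]
  have t0 : (Tm.const 2 * positionsTm c).eval (gapVars Γ c k) = 2 * positions c k := by
    simp [gapVars]
  have := (pushFalse (gapInstance Γ c k (gapBase Γ c k) D).matrix).seq ((pushNat (.var 5) _).seq
    ((pushFalse _).seq ((pushNat (.var 4) _).seq ((pushFalse _).seq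
      (pushNat (.const 2 * positionsTm c) _)))))
  rw [t5, t4, t0] at this
  exact this

/-- Construct the gap instance and run the algorithm for the gap problem. -/
def reduceProg (c : ℕ) : Prog :=
  .seq (setupProg c) <| .seq (.table (edgeFm c)) <| .seq (headerProg c) <| .seq (.move 6 8) <|
  .seq (.call 8 9) <| .seq (.move 9 1) <| .seq (.clear 4) (.clearVars 6)

/-- A bound for the length of the code of the gap instance. -/
def codeBound (c W : ℕ) : ℕ := (Tm.const 2 * positionsTm c).bound W + W + W + W * W + 3

theorem polyBdd_codeBound (c : ℕ) : PolyBdd (codeBound c) :=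
  (((((Tm.polyBdd_bound _).add .id).add .id).add (PolyBdd.id.mul .id))).add (.const 3)

theorem length_matrix (Γ : Instance) : Γ.matrix.length = Γ.numS * Γ.numU := by
  rw [Γ.matrix_eq, List.length_ofFn]

theorem length_encode_gapInstance_le {W : ℕ} (D : ℕ) (he : ∀ i, gapVars Γ c k i ≤ W) :
    (encode (gapInstance Γ c k (gapBase Γ c k) D, 2 * positions c k)).length ≤ codeBound c W := by
  have h4 : gapBase Γ c k ^ 2 ≤ W := he 4
  have h5 : gapBase Γ c k ^ (2 + 8 * c) ≤ W := by simpa [gapVars] using he 5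
  have h0 : 2 * positions c k ≤ (Tm.const 2 * positionsTm c).bound W := by
    have := Tm.eval_le_bound he (.const 2 * positionsTm c)
    simpa [gapVars] using this
  have := Nat.mul_le_mul h4 h5
  rw [length_encode, length_matrix]
  simp only [gapInstance, codeBound]
  omega

/-- A bound for the time needed by `reduceProg`, apart from that needed by the call. -/
def reduceCost (c W : ℕ) : ℕ :=
  setupCost c W + (tableCost (edgeFm c) W + (headerCost c W + (codeBound c W * 3 + W * 14 + 24)))

theorem polyBdd_reduceCost (c : ℕ) : PolyBdd (reduceCost c) :=
  (polyBdd_setupCost c).add ((polyBdd_tableCost _).add ((polyBdd_headerCost c).add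
    ((((polyBdd_codeBound c).mul (.const 3)).add (PolyBdd.id.mul (.const 14))).add (.const 24))))

theorem runs_reduceProg {D : ℕ} (hR : gapBase Γ c k ≤ R) (hL : (encode (Γ, k)).length ≤ R)
    (hD : D < gapBase Γ c k) (hg : GoodModuli k Γ.numS (positions c k) (gapBase Γ c k) D)
    (hmin : ∀ D' < D, ¬ GoodModuli k Γ.numS (positions c k) (gapBase Γ c k) D') {b : Bool} {t : ℕ}
    (h : M.HaltsWithin (encode (gapInstance Γ c k (gapBase Γ c k) D, 2 * positions c k)) [b] t) :
    Runs M (reduceProg c) (single 0 (encode (Γ, k))) (single 1 [b])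
      (reduceCost c (R ^ (2 + 8 * c)) + t) := by
  have hR' : R ≤ R ^ (2 + 8 * c) := Nat.le_self_pow (by omega) R
  have he := gapVars_le hR hL
  have hcode := length_encode_gapInstance_le D he
  have hmat : Γ.matrix.length ≤ (encode (Γ, k)).length := by rw [length_encode]; omega
  set W := R ^ (2 + 8 * c) with hW
  set x' := encode (gapInstance Γ c k (gapBase Γ c k) D, 2 * positions c k) with hx'
  have h6 : ∀ i ≥ 6, gapVars Γ c k i = 0 := fun i hi => gapVars_of_le Γ c k hi
  let g0 : State := update (fun _ => []) 4 Γ.matrix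
  have s1 : Runs M (setupProg c) (single 0 (encode (Γ, k))) (conf (gapVars Γ c k) g0)
      (setupCost c W) := by
    rw [single_eq_conf (by omega)]
    refine (Runs.setup hR hL rfl rfl rfl).congr (conf_congr (fun _ => rfl) fun r hr => ?_)
    interval_cases r <;> simp [g0, single]
  have s2 := Runs.table (M := M) (g := g0) he h6 rfl rfl rfl (edgeFm c)
    (fun s u => bval (GapAdj Γ c k (gapBase Γ c k) D s u)) (by
      intro s hs u hu
      rw [sat_edgeFm_iff (D := D) (k := k) (Γ := Γ) rfl rfl rfl rfl rfl hD hg hmin]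
      rfl)
  have v4 : gapVars Γ c k 4 = gapBase Γ c k ^ 2 := rfl
  have v5 : gapVars Γ c k 5 = gapBase Γ c k ^ (2 + 8 * c) := by simp [gapVars]
  rw [v4, v5, ← gapInstance_matrix] at s2
  have s3 := Runs.header (M := M) (g := g0) (D := D) he rfl
  rw [← hx'] at s3
  have s4 : Runs M (.move 6 8) (conf (gapVars Γ c k) (update g0 6 x'))
      (conf (gapVars Γ c k) (update g0 8 x'.reverse)) (x'.length * 2 + 1) := by
    refine ((Runs.move_conf (by omega) (by omega) (by omega)).congr ?_).mono (by simp)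
    refine conf_congr (fun _ => rfl) fun r hr => ?_
    interval_cases r <;> simp [g0]
  have s5 : Runs M (.call 8 9) (conf (gapVars Γ c k) (update g0 8 x'.reverse))
      (conf (gapVars Γ c k) (update g0 9 [b])) (x'.length + 1 + t + 2) := by
    refine ((Runs.call_conf (y := [b]) (t := t) (by omega) (by omega) (by omega) rfl
      (by simpa using h)).congr ?_).mono (by simp)
    refine conf_congr (fun _ => rfl) fun r hr => ?_
    interval_cases r <;> simp [g0]
  have s6 : Runs M (.move 9 1) (conf (gapVars Γ c k) (update g0 9 [b]))
      (conf (gapVars Γ c k) (update g0 1 [b])) 3 := by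
    refine ((Runs.move_conf (by omega) (by omega) (by omega)).congr ?_).mono (by simp)
    refine conf_congr (fun _ => rfl) fun r hr => ?_
    interval_cases r <;> simp [g0]
  have s7 : Runs M (.clear 4) (conf (gapVars Γ c k) (update g0 1 [b]))
      (conf (gapVars Γ c k) (single 1 [b])) (Γ.matrix.length * 2 + 1) := by
    refine ((Runs.clear_conf (by omega)).congr ?_).mono (by simp [g0])
    refine conf_congr (fun _ => rfl) fun r hr => ?_
    interval_cases r <;> simp [g0, single]
  have s8 : Runs M (.clearVars 6) (conf (gapVars Γ c k) (single 1 [b])) (single 1 [b])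
      (6 * (W * 2 + 2) + 1) := by
    rw [single_eq_conf (r := 1) (by omega)]
    refine (Runs.clearVars he h6).congr ?_
    exact conf_congr (fun _ => rfl) fun r hr => by rw [conf_of_lt _ _ hr]
  refine (s1.seq (s2.seq (s3.seq (s4.seq (s5.seq (s6.seq (s7.seq s8))))))).mono ?_
  unfold reduceCost
  omega

end

theorem computable_two_pow : Computable fun n : ℕ => 2 ^ n := by
  have h : Primrec fun n : ℕ => Nat.rec (motive := fun _ => ℕ) 1 (fun _ a => a * 2) n :=
    Primrec.nat_rec₁ 1 ((Primrec.nat_mul.comp Primrec.snd (Primrec.const 2)))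
  refine (h.of_eq fun n => ?_).to_comp
  induction n with
  | zero => rfl
  | succ n ih => rw [pow_succ, ← ih]

theorem Computable.pow_const {f : ℕ → ℕ} (hf : Computable f) (n : ℕ) :
    Computable fun k => f k ^ n := by
  induction n with
  | zero => simpa using Computable.const 1
  | succ n ih => simpa [pow_succ] using Primrec.nat_mul.to_comp.comp ih hf

theorem computable_positions (c : ℕ) : Computable (positions c) := by
  have h1 : Computable fun k : ℕ => k + 1 := Computable.succ
  exact Primrec.nat_mul.to_comp.comp (Primrec.nat_mul.to_comp.comp (Computable.const _)
    (Computable.pow_const h1 2)) h1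

theorem computable_logFactor (c : ℕ) : Computable (logFactor c) :=
  Primrec.nat_mul.to_comp.comp (Computable.const _) (Computable.pow_const Computable.succ 7)

theorem setCoverFPT_of_gapSetCoverFPT {c : ℕ} (hc : 0 < c) (h : GapSetCoverFPT c) :
    SetCoverFPT := by
  obtain ⟨M, f, d, hf, h⟩ := h
  let R : ℕ → ℕ → ℕ := fun k l => 2 ^ logFactor c k * (l + 2)
  have hR : FPTBdd R := (FPTBdd.param (computable_two_pow.comp (computable_logFactor c))).mul
    (FPTBdd.length.add (.const 2))
  have hW : FPTBdd fun k l => R k l ^ (2 + 8 * c) := hR.pow _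
  have ht : FPTBdd fun k l => f (2 * positions c k) * codeBound c (R k l ^ (2 + 8 * c)) ^ d :=
    (FPTBdd.param (hf.comp (Primrec.nat_mul.to_comp.comp (Computable.const 2)
      (computable_positions c)))).mul ((hW.polyBdd (polyBdd_codeBound c)).pow d)
  have hV : ∀ Γ k, gapBase Γ c k ≤ R k (encode (Γ, k)).length := fun Γ k =>
    Nat.mul_le_mul_left _ (by rw [length_encode]; omega)
  have hL : ∀ Γ k, (encode (Γ, k)).length ≤ R k (encode (Γ, k)).length := fun Γ k =>
    (Nat.le_add_right _ 2).trans (Nat.le_mul_of_pos_left _ (by positivity))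
  have key : ∀ (Γ : Instance) (k D : ℕ) (b : Bool), D < gapBase Γ c k →
      GoodModuli k Γ.numS (positions c k) (gapBase Γ c k) D →
      (∀ D' < D, ¬ GoodModuli k Γ.numS (positions c k) (gapBase Γ c k) D') →
      M.HaltsWithin (encode (gapInstance Γ c k (gapBase Γ c k) D, 2 * positions c k)) [b]
        (f (2 * positions c k) * (encode (gapInstance Γ c k (gapBase Γ c k) D,
          2 * positions c k)).length ^ d) →
      ((reduceProg c).machine M).HaltsWithin (encode (Γ, k)) [b]
        (reduceCost c (R k (encode (Γ, k)).length ^ (2 + 8 * c)) +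
          f (2 * positions c k) * codeBound c (R k (encode (Γ, k)).length ^ (2 + 8 * c)) ^ d + 1) := by
    intro Γ k D b hD hg hmin hM
    refine (runs_reduceProg (hV Γ k) (hL Γ k) hD hg hmin (hM.mono ?_)).haltsWithin
    gcongr
    exact length_encode_gapInstance_le D (gapVars_le (hV Γ k) (hL Γ k))
  have hpc : ∀ Γ k, positions c k + copies c k ≤ gapBase Γ c k := fun Γ k =>
    (positions_add_copies_le hc k).trans (logFactor_le_gapBase Γ c k)
  refine FPTBdd.hasFPTDecider (((hW.polyBdd (polyBdd_reduceCost c)).add ht).add (.const 1))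
    (N := (reduceProg c).machine M) ?_ ?_
  · intro Γ k hk
    obtain ⟨D, hD, hg, hmin⟩ := exists_least_goodModuli Γ hc k
    have hle := le_gapBase Γ c k
    exact key Γ k D true hD hg hmin
      ((h _ _).1 (gapInstance_opt_le hc hg (hpc Γ k) (by omega) hk))
  · intro Γ k hk
    obtain ⟨D, hD, hg, hmin⟩ := exists_least_goodModuli Γ hc k
    have hle := le_gapBase Γ c k
    refine key Γ k D false hD hg hmin ((h _ _).2 ?_)
    have hlt := not_le.1 (gapInstance_lt_opt hc hg (hpc Γ k) (by omega) (by omega) hk)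
    beta_reduce
    rw [← Nat.cast_mul, ENNReal.ofReal_natCast, ← ENat.toENNReal_coe]
    exact ENat.toENNReal_lt.2 hlt

theorem HasFPTDecider.mono {yes no no' : Instance → ℕ → Prop} (h : HasFPTDecider yes no)
    (hno : ∀ Γ k, no' Γ k → no Γ k) : HasFPTDecider yes no' := by
  obtain ⟨M, f, d, hf, h⟩ := h
  exact ⟨M, f, d, hf, fun Γ k => ⟨(h Γ k).1, fun hx => (h Γ k).2 (hno Γ k hx)⟩⟩

theorem GapSetCoverFPT.mono {c c' : ℝ} (h : GapSetCoverFPT c) (hc : c ≤ c') : GapSetCoverFPT c' :=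
  HasFPTDecider.mono h fun _ _ hx => (ENNReal.ofReal_le_ofReal
    (mul_le_mul_of_nonneg_right hc (Nat.cast_nonneg _))).trans_lt hx

theorem HasFPTApproximation.mono {c c' : ℝ} (h : HasFPTApproximation c) (hc : c ≤ c') :
    HasFPTApproximation c' := by
  obtain ⟨M, f, d, hf, h⟩ := h
  refine ⟨M, f, d, hf, fun Γ k => ?_⟩
  obtain ⟨y, hy, hopt⟩ := h Γ k
  refine ⟨y, hy, fun hk => ?_⟩
  obtain ⟨C, hyC, hC, hcard⟩ := hopt hk
  exact ⟨C, hyC, hC, hcard.trans (mul_le_mul_of_nonneg_right hc (Nat.cast_nonneg _))⟩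

end ParamSetCover

theorem theorem1 (hW2 : ParamSetCover.W2NeFPT) (c : ℝ) (hc : 1 ≤ c) :
    ¬ ParamSetCover.GapSetCoverFPT c ∧ ¬ ParamSetCover.HasFPTApproximation c := by
  have hpos : 0 < ⌈c⌉₊ := Nat.ceil_pos.2 (zero_lt_one.trans_le hc)
  have hgap : ¬ ParamSetCover.GapSetCoverFPT (⌈c⌉₊ : ℝ) := fun h =>
    hW2 (ParamSetCover.setCoverFPT_of_gapSetCoverFPT hpos h)
  exact ⟨fun h => hgap (h.mono (Nat.le_ceil c)), fun h =>
    hgap (ParamSetCover.gapSetCoverFPT_of_hasFPTApproximation (h.mono (Nat.le_ceil c)))⟩
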